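/- **Setting.** Let $d\in\mathbb N$. For a multi-index $j=(j_1,\dots,j_d)$ put $|j|=\sum j_i$, $j!=\prod j_i!$. For $\hbar>0$, $a,\eta\in\mathbb R^d$ and invertible complex $d\times d$ matrices $A,B$ with $A^tB-B^tA=0$, $A^*B+B^*A=2I$, let $$\phi_0(A,B,\hbar,a,\eta,x)=(\pi\hbar)^{-d/4}(\det A)^{-1/2}\exp\Big\{-\tfrac{\langle x-a,\,BA^{-1}(x-a)\rangle}{2\hbar}+\tfrac{i\langle\eta,\,x-a\rangle}{\hbar}\Big\},$$ $$\mathcal A_m^*=\tfrac1{\sqrt{2\hbar}}\Big[\sum_n\overline{B_{nm}}(x_n-a_n)-i\sum_n\overline{A_{nm}}\big(-i\hbar\tfrac{\partial}{\partial x_n}-\eta_n\big)\Big],\qquad \phi_j=\tfrac1{\sqrt{j!}}(\mathcal A_1^*)^{j_1}\cdots(\mathcal A_d^*)^{j_d}\phi_0 .$$ **Hypotheses.** Let $V:\mathbb R^d\to\mathbb R$ be bounded below. Let $\delta>0$ and suppose $V$ extends to an analytic function in a neighbourhood of $S_\delta=\{z\in\mathbb C^d:|\mathrm{Im}\,z_j|\le\delta\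 \forall j\}$ satisfying $|V(z)|\le M\exp(\tau|z|)$ on $S_\delta$ for some $M,\tau>0$. Let $a,\eta,A,B,S$ solve, for $t\ge0$, $$\dot a=\eta,\quad \dot\eta=-\nabla V(a),\quad \dot A=iB,\quad \dot B=iV^{(2)}(a)A,\quad \dot S=\tfrac{\eta^2}{2}-V(a),$$ where $V^{(2)}$ is the Hessian of $V$, $S(0)=0$, and $A(0),B(0)$ are invertible and satisfy the two matrix conditions above; the branch of $(\det A(t))^{1/2}$ is chosen continuous in $t$. Assume there are $N>0$, $\lambda>0$ with $\|A(t)\|\le N e^{\lambda t}$ for all $t\ge0$. Let $J\in\mathbb N$ and let $c_{0,j}\in\mathbb C$ vanish for $|j|>J$ and satisfy $\sum_{|j|\le J}|c_{0,j}|^2=1$. **The approximation.** Let $X(t)^m$ be the infinite matrix of $\hbar^{-|m|/2}(x-a(t))^m$ in the basis $\phi_j(A(t),B(t),\hbar,a(t),\eta(t),\cdot)$ (it does not depend on $\hbar$), and $K_k(t)=\sum_{|m|=k}\frac{(D^mV)(a(t))}{m!}X(t)^m$. Let $c_0(t)=(c_{0,j})_j$ and, for $n\ge1$, let $c_n(t)=(c_{n,j}(t))_j$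 solve $i\dot c_n=\sum_{k=0}^{n-1}K_{n+2-k}(t)\,c_k(t)$ with $c_n(0)=0$. For $\sigma'\in(0,1)$ and $0<\hbar\le1$ let $l=\lfloor\hbar^{-\sigma'}\rfloor$ and $$\psi(x,t,\hbar)=e^{iS(t)/\hbar}\sum_{|j|\le J+3l-3}\Big(\sum_{k=0}^{l-1}\hbar^{k/2}c_{k,j}(t)\Big)\,\phi_j(A(t),B(t),\hbar,a(t),\eta(t),x).$$ **Theorem 3.4.** Let $b>0$. For all sufficiently small $T'>0$ the following holds: for every sufficiently small $\sigma'\in(0,1)$ there exist $\Gamma'>0$ and $\sigma\in(0,1)$ such that, for all $\hbar>0$ and all $t$ with $0\le t\le T'\ln(1/\hbar)$, the function $\psi(\cdot,t,\hbar)$ is in $L^2(\mathbb R^d)$ and $$\Big(\int_{|x-a(t)|>b}|\psi(x,t,\hbar)|^2\,dx\Big)^{1/2}\le\exp\{-\Gamma'/\hbar^{\sigma}\}.$$ Moreover, if $\tau$ can be taken arbitrarily small (that is, for every $\tau>0$ there is $M>0$ with $|V(z)|\le M\exp(\tau|z|)$ on $S_\delta$), then for every $\varepsilon\in(0,1)$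 the same conclusion holds with $T'=\frac{1}{6\lambda}(1-\varepsilon)$. -/

import Mathlib

open Complex Matrix MeasureTheory
open scoped BigOperators ComplexConjugate

noncomputable section

namespace Semiclassical

/-- Multi-indices of length `d`. -/
abbrev MultiIndex (d : ℕ) : Type := Fin d → ℕ

/-- The order `|j| = j₁ + ⋯ + j_d`. -/
def order {d : ℕ} (j : MultiIndex d) : ℕ := ∑ i, j i

/-- `j! = j₁! ⋯ j_d!`. -/
def multiFactorial {d : ℕ} (j : MultiIndex d) : ℕ := ∏ i, (j i).factorial

/-- The finite set of multi-indices with `|j| = n`. -/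
def indicesEq (d n : ℕ) : Finset (MultiIndex d) :=
  (Fintype.piFinset fun _ : Fin d => Finset.range (n + 1)).filter fun j => order j = n

/-- The finite set of multi-indices with `|j| ≤ n`. -/
def indicesLE (d n : ℕ) : Finset (MultiIndex d) :=
  (Fintype.piFinset fun _ : Fin d => Finset.range (n + 1)).filter fun j => order j ≤ n

theorem mem_indicesLE {d n : ℕ} {j : MultiIndex d} : j ∈ indicesLE d n ↔ order j ≤ n := by
  simp only [indicesLE, Finset.mem_filter, Fintype.mem_piFinset, Finset.mem_range,
    and_iff_right_iff_imp]
  intro h i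
  exact Nat.lt_succ_of_le ((Finset.single_le_sum (f := j) (fun _ _ => Nat.zero_le _)
    (Finset.mem_univ i)).trans h)

theorem mem_indicesEq {d n : ℕ} {j : MultiIndex d} : j ∈ indicesEq d n ↔ order j = n := by
  simp only [indicesEq, Finset.mem_filter, Fintype.mem_piFinset, Finset.mem_range,
    and_iff_right_iff_imp]
  intro h i
  exact Nat.lt_succ_of_le ((Finset.single_le_sum (f := j) (fun _ _ => Nat.zero_le _)
    (Finset.mem_univ i)).trans h.le)

section Calculus

variable {d : ℕ} {F : Type*} [NormedAddCommGroup F] [NormedSpace ℝ F]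

/-- The partial derivative `∂f/∂x_i`. -/
def pderiv (i : Fin d) (f : EuclideanSpace ℝ (Fin d) → F) : EuclideanSpace ℝ (Fin d) → F :=
  fun x => fderiv ℝ f x (EuclideanSpace.single i 1)

/-- The mixed partial derivative `D^m f = ∂₁^{m₁} ⋯ ∂_d^{m_d} f`. -/
def mixedDeriv (m : MultiIndex d) (f : EuclideanSpace ℝ (Fin d) → F) :
    EuclideanSpace ℝ (Fin d) → F :=
  (List.finRange d).foldr (fun i g => (pderiv i)^[m i] g) f

/-- The Hessian matrix of `V` at `x`. -/
def hessian (V : EuclideanSpace ℝ (Fin d) → ℝ) (x : EuclideanSpace ℝ (Fin d)) :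
    Matrix (Fin d) (Fin d) ℝ :=
  Matrix.of fun i k => pderiv i (pderiv k V) x

/-- The monomial `x^m = x₁^{m₁} ⋯ x_d^{m_d}`. -/
def monomial (m : MultiIndex d) (x : EuclideanSpace ℝ (Fin d)) : ℝ := ∏ i, x i ^ m i

end Calculus

/-! ### Potentials -/

/-- The inclusion of `ℝ^d` in `ℂ^d`. -/
def toComplex {d : ℕ} (x : EuclideanSpace ℝ (Fin d)) : EuclideanSpace ℂ (Fin d) :=
  WithLp.toLp 2 fun i => (x i : ℂ)

/-- The complex region `S_δ = {z : |Im z_j| ≤ δ for all j}`. -/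
def strip (d : ℕ) (δ : ℝ) : Set (EuclideanSpace ℂ (Fin d)) := {z | ∀ j, |(z j).im| ≤ δ}

/-- `|W(z)| ≤ M exp(τ|z|)` on `S_δ`. -/
def ExpBound {d : ℕ} (W : EuclideanSpace ℂ (Fin d) → ℂ) (δ M τ : ℝ) : Prop :=
  ∀ z ∈ strip d δ, ‖W z‖ ≤ M * Real.exp (τ * ‖z‖)

/-! ### Semiclassical wave packets -/

/-- The conditions `Aᵗ B - Bᵗ A = 0`, `A* B + B* A = 2 I` on invertible matrices `A`, `B`. -/
structure Admissible {d : ℕ} (A B : Matrix (Fin d) (Fin d) ℂ) : Prop where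
  isUnit_left : IsUnit A.det
  isUnit_right : IsUnit B.det
  symm : Aᵀ * B - Bᵀ * A = 0
  herm : Aᴴ * B + Bᴴ * A = (2 : ℂ) • (1 : Matrix (Fin d) (Fin d) ℂ)

/-- The parameters of a wave packet: the matrices `A`, `B`, the choice `sqrtDet` of a square root
of `det A`, the position `a` and the momentum `η`. -/
structure Packet (d : ℕ) where
  A : Matrix (Fin d) (Fin d) ℂ
  B : Matrix (Fin d) (Fin d) ℂ
  sqrtDet : ℂ
  a : EuclideanSpace ℝ (Fin d)
  η : EuclideanSpace ℝ (Fin d)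

namespace Packet

variable {d : ℕ} (p : Packet d) (ħ : ℝ)

/-- The raising operator
`(2ħ)^{-1/2} [∑ₙ conj(B_{nm}) (x_n - a_n) - i ∑ₙ conj(A_{nm}) (-iħ ∂/∂x_n - η_n)]`. -/
def raising (m : Fin d) (f : EuclideanSpace ℝ (Fin d) → ℂ) : EuclideanSpace ℝ (Fin d) → ℂ :=
  fun x => ((1 / Real.sqrt (2 * ħ) : ℝ) : ℂ) *
    ((∑ n, conj (p.B n m) * ((x n - p.a n : ℝ) : ℂ) * f x)
      - I * ∑ n, conj (p.A n m) * (-I * (ħ : ℂ) * pderiv n f x - (p.η n : ℂ) * f x))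

/-- The Gaussian
`φ₀ = (πħ)^{-d/4} (det A)^{-1/2} exp(-⟨x-a, BA⁻¹(x-a)⟩/(2ħ) + i⟨η, x-a⟩/ħ)`. -/
def gaussian : EuclideanSpace ℝ (Fin d) → ℂ := fun x =>
  let v : Fin d → ℂ := fun i => ((x i - p.a i : ℝ) : ℂ)
  ((Real.pi ^ (-(d : ℝ) / 4) * ħ ^ (-(d : ℝ) / 4) : ℝ) : ℂ) * p.sqrtDet⁻¹ *
    Complex.exp (-(v ⬝ᵥ ((p.B * p.A⁻¹) *ᵥ v)) / (2 * (ħ : ℂ))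
      + I * (∑ i, (p.η i : ℂ) * v i) / (ħ : ℂ))

/-- `φ_j = (j!)^{-1/2} (𝒜₁*)^{j₁} ⋯ (𝒜_d*)^{j_d} φ₀`. -/
def state (j : MultiIndex d) : EuclideanSpace ℝ (Fin d) → ℂ := fun x =>
  ((1 / Real.sqrt (multiFactorial j : ℝ) : ℝ) : ℂ) *
    (List.finRange d).foldr (fun m g => (p.raising ħ m)^[j m] g) (p.gaussian ħ) x

/-- `X^m`: the infinite matrix of the operator `ħ^{-|m|/2} (x-a)^m` in the basis `φ_j`.
(Its entries do not depend on the value of `ħ > 0`.) -/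
def posMatrix (m : MultiIndex d) : Matrix (MultiIndex d) (MultiIndex d) ℂ := fun j k =>
  ((ħ ^ (-(order m : ℝ) / 2) : ℝ) : ℂ) *
    ∫ x : EuclideanSpace ℝ (Fin d),
      conj (p.state ħ j x) * ((monomial m (x - p.a) : ℝ) : ℂ) * p.state ħ k x

end Packet

/-! ### Classical motion -/

/-- The time-dependent classical quantities. -/
structure Path (d : ℕ) where
  a : ℝ → EuclideanSpace ℝ (Fin d)
  η : ℝ → EuclideanSpace ℝ (Fin d)
  A : ℝ → Matrix (Fin d) (Fin d) ℂ
  B : ℝ → Matrix (Fin d) (Fin d) ℂ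
  S : ℝ → ℝ
  /-- the branch of the square root of `det A(t)` -/
  sqrtDet : ℝ → ℂ

/-- The wave packet parameters at time `t`. -/
def Path.packet {d : ℕ} (γ : Path d) (t : ℝ) : Packet d :=
  ⟨γ.A t, γ.B t, γ.sqrtDet t, γ.a t, γ.η t⟩

/-- `γ` solves, for `t ≥ 0`, Newton's equations, their linearization, and the equation for the
action, with initial data `A(0)`, `B(0)` subject to `Admissible` and `S(0) = 0`. The sign of
`(det A(t))^{1/2}` is fixed by continuity in `t`. -/
structure Path.IsClassical {d : ℕ} (V : EuclideanSpace ℝ (Fin d) → ℝ) (γ : Path d) : Prop where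
  admissible : Admissible (γ.A 0) (γ.B 0)
  S_zero : γ.S 0 = 0
  deriv_a : ∀ t, 0 ≤ t → HasDerivWithinAt γ.a (γ.η t) (Set.Ici 0) t
  deriv_η : ∀ t, 0 ≤ t → HasDerivWithinAt γ.η (-gradient V (γ.a t)) (Set.Ici 0) t
  deriv_A : ∀ t, 0 ≤ t → ∀ i k,
    HasDerivWithinAt (fun s => γ.A s i k) (I * γ.B t i k) (Set.Ici 0) t
  deriv_B : ∀ t, 0 ≤ t → ∀ i k,
    HasDerivWithinAt (fun s => γ.B s i k)
      (I * (((hessian V (γ.a t)).map (fun y : ℝ => (y : ℂ))) * γ.A t) i k) (Set.Ici 0) t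
  deriv_S : ∀ t, 0 ≤ t →
    HasDerivWithinAt γ.S (‖γ.η t‖ ^ 2 / 2 - V (γ.a t)) (Set.Ici 0) t
  sqrtDet_continuous : ContinuousOn γ.sqrtDet (Set.Ici 0)
  sqrtDet_sq : ∀ t, 0 ≤ t → γ.sqrtDet t ^ 2 = (γ.A t).det

/-! ### The semiclassical expansion -/

/-- The solution of the hierarchy
`i ċ₀ = 0`, `i ċ_n(t) = ∑_{k=0}^{n-1} K_{n+2-k}(t) c_k(t)` (`n ≥ 1`)
with `c₀(0)` given and `c_n(0) = 0` for `n ≥ 1`, obtained by integrating in `t`. -/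
def hierarchy {ι : Type*} (K : ℕ → ℝ → Matrix ι ι ℂ) (c₀ : ι → ℂ) : ℕ → ℝ → ι → ℂ
  | 0, _, j => c₀ j
  | n + 1, t, j =>
      -I * ∫ s in (0 : ℝ)..t,
        ∑ k : Fin (n + 1), ∑' j' : ι, K (n + 1 + 2 - k) s j j' * hierarchy K c₀ k s j'
termination_by n => n
decreasing_by exact k.2

section Expansion

variable {d : ℕ} (V : EuclideanSpace ℝ (Fin d) → ℝ) (γ : Path d) (ħ : ℝ)

/-- `K_k(t) = ∑_{|m|=k} (D^m V)(a(t)) / m! · X(t)^m`. -/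
def interaction (k : ℕ) (t : ℝ) : Matrix (MultiIndex d) (MultiIndex d) ℂ := fun j j' =>
  ∑ m ∈ indicesEq d k,
    ((mixedDeriv m V (γ.a t) / (multiFactorial m : ℝ) : ℝ) : ℂ) * (γ.packet t).posMatrix ħ m j j'

/-- The truncated coefficient `c_j(t, ħ) = ∑_{k=0}^{l-1} ħ^{k/2} c_{k,j}(t)`. -/
def truncatedCoeff (c₀ : MultiIndex d → ℂ) (l : ℕ) (t : ℝ) (j : MultiIndex d) : ℂ :=
  ∑ k ∈ Finset.range l, ((ħ ^ ((k : ℝ) / 2) : ℝ) : ℂ) * hierarchy (interaction V γ ħ) c₀ k t j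

/-- The approximation
`ψ(x, t, ħ) = e^{iS(t)/ħ} ∑_{|j| ≤ J+3l-3} c_j(t, ħ) φ_j(A(t), B(t), ħ, a(t), η(t), x)`
truncated at `l = ⌊ħ^{-σ'}⌋`. -/
def approximation (J : ℕ) (c₀ : MultiIndex d → ℂ) (σ' : ℝ) (t : ℝ)
    (x : EuclideanSpace ℝ (Fin d)) : ℂ :=
  let l : ℕ := ⌊ħ ^ (-σ')⌋₊
  Complex.exp (I * (γ.S t : ℂ) / (ħ : ℂ)) *
    ∑ j ∈ indicesLE d (J + 3 * l - 3),
      truncatedCoeff V γ ħ c₀ l t j * (γ.packet t).state ħ j x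

end Expansion

/-- Localization on the time scale `T' ln(1/ħ)`: for every sufficiently small truncation exponent
`σ' ∈ (0,1)` there are `Γ' > 0` and `σ ∈ (0,1)` such that for all `ħ > 0` and
`0 ≤ t ≤ T' ln(1/ħ)` the approximation is square integrable and its `L²` norm outside the ball of
radius `b` about `a(t)` is at most `exp(-Γ'/ħ^σ)`. -/
def LocalizedUpTo {d : ℕ} (V : EuclideanSpace ℝ (Fin d) → ℝ) (γ : Path d)
    (J : ℕ) (c₀ : MultiIndex d → ℂ) (b T' : ℝ) : Prop :=
  ∃ σ₀ ∈ Set.Ioo (0 : ℝ) 1, ∀ σ' ∈ Set.Ioc 0 σ₀, ∃ Γ' > 0, ∃ σ ∈ Set.Ioo (0 : ℝ) 1,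
    ∀ ħ > 0, ∀ t, 0 ≤ t → t ≤ T' * Real.log (1 / ħ) →
      Integrable (fun x => ‖approximation V γ ħ J c₀ σ' t x‖ ^ 2) ∧
      (∫ x in {x | b < ‖x - γ.a t‖}, ‖approximation V γ ħ J c₀ σ' t x‖ ^ 2) ^ (1 / 2 : ℝ)
        ≤ Real.exp (-Γ' / ħ ^ σ)

end Semiclassical

end

/-! Write w = 1/ħ. Each state φ_j is a polynomial times the Gaussian φ₀, and the raising and
lowering operators act on the polynomial factor alone. They satisfy the canonical commutation
relations and are mutually adjoint for |φ₀|², so the φ_j are orthonormal, and x - a is √(ħ/2) times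
a combination of them with coefficients from A and its conjugate (`Packet.X_mul_eq`). Multiplying by
a coordinate therefore raises the degree by at most one and multiplies the ℓ¹ norm of the
coefficients by at most √ħ · 2dα · √(degree + 1), where α bounds the entries of A.

Chebyshev's inequality with a moment of order 2q then bounds the mass outside the ball by d · (const
· ħ α² (n + q))^q · K² (`Packet.Expands.integral_outside_le`), where n is the degree and K the ℓ¹
norm of the coefficients of ψ. On the time scale T' ln w with T'λ < 1/6, α² is at most const ·
w^(1/3). For l ≤ w^(1/4) and q ≈ w^(1/2) the base is at most w^(-1/12) once w is large, so the
moment factor is at most w^(-q/12).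

Against this, crude bounds on K suffice. Cauchy's estimates on the strip, linear growth of a(t) by
energy conservation, and the band structure of the hierarchy give K ≤ w^(Q l) with Q fixed: every
ingredient is polynomial in w, because e^(ct) is a power of w on this time scale (`hierarchy_bound`,
`exists_coefficient_bound`). Since l ≤ w^(1/4) is far below q, the outside mass is at most
exp(-w^(1/2)/24) for w ≥ U. The rate τ influences only Q, so the single condition T'λ < 1/6 serves
both claims.

The bound is required for all ħ > 0. For ħ > 1 no admissible t exists. For 1/U ≤ ħ ≤ 1, a small σ'
forces l = 1, so ψ is a normalized combination of states with constant coefficients. A nonzero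
polynomial times a Gaussian has positive mass in every ball about the centre, and compactness in (t,
ħ) makes this mass at least some κ > 0 (`exists_inside_mass`). The outside mass is then at most 1 -
κ, which a small Γ' accommodates. -/

noncomputable section

namespace Semiclassical

/-! ### Cauchy estimates for the potential on the strip. -/

section CauchyEstimates

variable {d : ℕ}

/-- The complex partial derivative `∂F/∂z_i`. -/
def cderiv (i : Fin d) (F : EuclideanSpace ℂ (Fin d) → ℂ) : EuclideanSpace ℂ (Fin d) → ℂ :=
  fun z => fderiv ℂ F z (EuclideanSpace.single i 1)

/-- The mixed complex partial derivative. -/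
def mixedCDeriv (m : MultiIndex d) (F : EuclideanSpace ℂ (Fin d) → ℂ) :
    EuclideanSpace ℂ (Fin d) → ℂ :=
  (List.finRange d).foldr (fun i g => (cderiv i)^[m i] g) F

theorem analyticOnNhd_cderiv {s : Set (EuclideanSpace ℂ (Fin d))}
    {F : EuclideanSpace ℂ (Fin d) → ℂ} (hF : AnalyticOnNhd ℂ F s) (i : Fin d) :
    AnalyticOnNhd ℂ (cderiv i F) s := fun z hz =>
  ((ContinuousLinearMap.apply ℂ ℂ (EuclideanSpace.single i (1 : ℂ))).analyticAt _).comp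
    (hF.fderiv z hz)

theorem analyticOnNhd_iterate_cderiv {s : Set (EuclideanSpace ℂ (Fin d))}
    {F : EuclideanSpace ℂ (Fin d) → ℂ} (hF : AnalyticOnNhd ℂ F s) (i : Fin d) (k : ℕ) :
    AnalyticOnNhd ℂ ((cderiv i)^[k] F) s := by
  induction k with
  | zero => exact hF
  | succ k ih => rw [Function.iterate_succ_apply']; exact analyticOnNhd_cderiv ih i

/-- The inclusion `ℝ^d → ℂ^d` as a continuous real-linear map. -/
def toComplexL (d : ℕ) : EuclideanSpace ℝ (Fin d) →L[ℝ] EuclideanSpace ℂ (Fin d) :=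
  LinearMap.toContinuousLinearMap
    { toFun := toComplex
      map_add' := fun x y => by ext i; simp [toComplex]
      map_smul' := fun c x => by ext i; simp [toComplex] }

theorem toComplexL_apply (x : EuclideanSpace ℝ (Fin d)) : toComplexL d x = toComplex x := rfl

theorem toComplex_single (i : Fin d) :
    toComplex (EuclideanSpace.single i (1 : ℝ)) = EuclideanSpace.single i (1 : ℂ) := by
  ext k
  by_cases h : k = i <;> simp [toComplex, h]

theorem norm_toComplex (x : EuclideanSpace ℝ (Fin d)) : ‖toComplex x‖ = ‖x‖ := by
  simp [EuclideanSpace.norm_eq, toComplex]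

theorem toComplex_mem_strip {δ : ℝ} (hδ : 0 ≤ δ) (x : EuclideanSpace ℝ (Fin d)) :
    toComplex x ∈ strip d δ := fun j => by simpa [toComplex] using hδ

/-- Along real directions the complex derivative restricts to the real one, and taking real parts is
real-linear. Real derivatives of V thus become real parts of complex derivatives of its extension,
to which Cauchy's estimate applies. -/
theorem pderiv_re_comp_toComplex {F : EuclideanSpace ℂ (Fin d) → ℂ}
    {x : EuclideanSpace ℝ (Fin d)} (hF : AnalyticAt ℂ F (toComplex x)) (i : Fin d) :
    pderiv i (fun y => (F (toComplex y)).re) x = (cderiv i F (toComplex x)).re := by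
  have h1 : HasFDerivAt F ((fderiv ℂ F (toComplex x)).restrictScalars ℝ) (toComplexL d x) :=
    hF.differentiableAt.hasFDerivAt.restrictScalars ℝ
  have h3 := Complex.reCLM.hasFDerivAt.comp x (h1.comp x (toComplexL d).hasFDerivAt)
  unfold pderiv
  have h4 : fderiv ℝ (fun y => (F (toComplex y)).re) x = _ := h3.fderiv
  rw [h4]
  simp [toComplexL_apply, toComplex_single, cderiv]

theorem iterate_pderiv_re_comp_toComplex {F : EuclideanSpace ℂ (Fin d) → ℂ} {δ : ℝ} (hδ : 0 ≤ δ)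
    (hF : AnalyticOnNhd ℂ F (strip d δ)) (i : Fin d) (k : ℕ) :
    (pderiv i)^[k] (fun y => (F (toComplex y)).re) =
      fun y => ((cderiv i)^[k] F (toComplex y)).re := by
  induction k with
  | zero => rfl
  | succ k ih =>
    rw [Function.iterate_succ_apply', Function.iterate_succ_apply', ih]
    funext y
    exact pderiv_re_comp_toComplex
      (analyticOnNhd_iterate_cderiv hF i k _ (toComplex_mem_strip hδ y)) i

theorem mixedDeriv_re_comp_toComplex {F : EuclideanSpace ℂ (Fin d) → ℂ} {δ : ℝ} (hδ : 0 ≤ δ)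
    (hF : AnalyticOnNhd ℂ F (strip d δ)) (m : MultiIndex d) (x : EuclideanSpace ℝ (Fin d)) :
    mixedDeriv m (fun y => (F (toComplex y)).re) x = (mixedCDeriv m F (toComplex x)).re := by
  have key : ∀ L : List (Fin d),
      AnalyticOnNhd ℂ (L.foldr (fun i g => (cderiv i)^[m i] g) F) (strip d δ) ∧
      L.foldr (fun i g => (pderiv i)^[m i] g) (fun y => (F (toComplex y)).re) =
        fun y => (L.foldr (fun i g => (cderiv i)^[m i] g) F (toComplex y)).re := by
    intro L
    induction L with
    | nil => exact ⟨hF, rfl⟩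
    | cons i L ih =>
      refine ⟨analyticOnNhd_iterate_cderiv ih.1 i _, ?_⟩
      simp only [List.foldr_cons]
      rw [ih.2, iterate_pderiv_re_comp_toComplex hδ ih.1]
  exact congrFun (key _).2 x

theorem strip_mono {δ δ' : ℝ} (h : δ ≤ δ') : strip d δ ⊆ strip d δ' :=
  fun _ hz j => (hz j).trans h

/-- Cauchy's estimate on a strip. -/
theorem ExpBound.cderiv {F : EuclideanSpace ℂ (Fin d) → ℂ} {δ M τ r : ℝ} (hτ : 0 ≤ τ)
    (hM : 0 ≤ M) (hF : AnalyticOnNhd ℂ F (strip d δ)) (hb : ExpBound F δ M τ) (hr : 0 < r)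
    (i : Fin d) : ExpBound (Semiclassical.cderiv i F) (δ - r) (M * (Real.exp (τ * r) / r)) τ := by
  intro z hz
  set e : EuclideanSpace ℂ (Fin d) := EuclideanSpace.single i 1
  -- Only the i-th coordinate moves, so a disc of radius r uses up at most r of the half-width; the
  -- rest is the one-variable Cauchy estimate on that disc.
  have hmem : ∀ w : ℂ, ‖w‖ ≤ r → z + w • e ∈ strip d δ := by
    intro w hw j
    have h1 := hz j
    have h2 : |((w • e) j).im| ≤ r := by
      by_cases h : j = i
      · simpa [e, h] using (Complex.abs_im_le_norm w).trans hw
      · simpa [e, h] using hr.le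
    calc |((z + w • e) j).im| = |(z j).im + ((w • e) j).im| := by simp
      _ ≤ |(z j).im| + |((w • e) j).im| := abs_add_le _ _
      _ ≤ δ := by linarith
  have hline : ∀ w : ℂ, HasDerivAt (fun w : ℂ => z + w • e) e w := fun w => by
    simpa using ((hasDerivAt_id w).smul_const e).const_add z
  have hdiff : ∀ w : ℂ, ‖w‖ ≤ r → HasDerivAt (fun w : ℂ => F (z + w • e))
      (fderiv ℂ F (z + w • e) e) w := fun w hw =>
    (hF _ (hmem w hw)).differentiableAt.hasFDerivAt.comp_hasDerivAt w (hline w)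
  have hd : DiffContOnCl ℂ (fun w : ℂ => F (z + w • e)) (Metric.ball 0 r) := by
    apply DifferentiableOn.diffContOnCl
    intro w hw
    rw [closure_ball _ hr.ne'] at hw
    exact (hdiff w (by simpa using hw)).differentiableAt.differentiableWithinAt
  have hC : ∀ w ∈ Metric.sphere (0 : ℂ) r, ‖F (z + w • e)‖ ≤
      M * Real.exp (τ * r) * Real.exp (τ * ‖z‖) := by
    intro w hw
    have hw' : ‖w‖ = r := by simpa using hw
    refine (hb _ (hmem w hw'.le)).trans ?_
    rw [mul_assoc, ← Real.exp_add]
    have : ‖z + w • e‖ ≤ ‖z‖ + r := by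
      refine (norm_add_le _ _).trans ?_
      simp [e, norm_smul, hw']
    gcongr
    nlinarith
  have := Complex.norm_deriv_le_of_forall_mem_sphere_norm_le hr hd hC
  rw [(hdiff 0 (by simpa using hr.le)).deriv] at this
  simp only [zero_smul, add_zero] at this
  refine this.trans (le_of_eq ?_)
  ring

theorem ExpBound.iterate_cderiv {F : EuclideanSpace ℂ (Fin d) → ℂ} {δ M τ r : ℝ} (hτ : 0 ≤ τ)
    (hM : 0 ≤ M) (hF : AnalyticOnNhd ℂ F (strip d δ)) (hb : ExpBound F δ M τ) (hr : 0 < r)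
    (i : Fin d) (k : ℕ) :
    ExpBound ((Semiclassical.cderiv i)^[k] F) (δ - k * r) (M * (Real.exp (τ * r) / r) ^ k) τ := by
  induction k with
  | zero => simpa using hb
  | succ k ih =>
    rw [Function.iterate_succ_apply']
    have hF' := (analyticOnNhd_iterate_cderiv hF i k).mono
      (strip_mono (show δ - k * r ≤ δ by nlinarith [k.cast_nonneg (α := ℝ)]))
    have := ExpBound.cderiv hτ (by positivity) hF' ih hr i
    convert this using 1
    · push_cast; ring
    · rw [pow_succ]; ring

/-- Every differentiation, in whichever variable, costs width r and a factor exp(τr)/r, so only the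
total number of derivatives counts. -/
theorem ExpBound.mixedCDeriv {F : EuclideanSpace ℂ (Fin d) → ℂ} {δ M τ r : ℝ} (hτ : 0 ≤ τ)
    (hM : 0 ≤ M) (hF : AnalyticOnNhd ℂ F (strip d δ)) (hb : ExpBound F δ M τ) (hr : 0 < r)
    (m : MultiIndex d) :
    ExpBound (Semiclassical.mixedCDeriv m F) (δ - order m * r)
      (M * (Real.exp (τ * r) / r) ^ order m) τ := by
  have key : ∀ L : List (Fin d),
      AnalyticOnNhd ℂ (L.foldr (fun i g => (Semiclassical.cderiv i)^[m i] g) F) (strip d δ) ∧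
      ExpBound (L.foldr (fun i g => (Semiclassical.cderiv i)^[m i] g) F)
        (δ - ((L.map m).sum : ℕ) * r) (M * (Real.exp (τ * r) / r) ^ (L.map m).sum) τ := by
    intro L
    induction L with
    | nil => exact ⟨hF, by simpa using hb⟩
    | cons i L ih =>
      refine ⟨analyticOnNhd_iterate_cderiv ih.1 i _, ?_⟩
      have hF' := ih.1.mono
        (strip_mono (show δ - ((L.map m).sum : ℕ) * r ≤ δ by
          nlinarith [((L.map m).sum).cast_nonneg (α := ℝ)]))
      have := ExpBound.iterate_cderiv hτ (by positivity) hF' ih.2 hr i (m i)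
      have hs : (List.map m (i :: L)).sum = (L.map m).sum + m i := by
        rw [List.map_cons, List.sum_cons, add_comm]
      convert this using 1
      · rfl
      · rw [hs]; push_cast; ring
      · rw [hs, pow_add]; ring
  have h := (key (List.finRange d)).2
  have hs : ((List.finRange d).map m).sum = order m := by
    rw [order, ← List.sum_ofFn, List.ofFn_eq_map]
  rwa [hs] at h

variable {V : EuclideanSpace ℝ (Fin d) → ℝ} {W : EuclideanSpace ℂ (Fin d) → ℂ} {δ : ℝ}

theorem eq_re_extension (hWV : ∀ x, W (toComplex x) = (V x : ℂ)) :
    V = fun x => (W (toComplex x)).re := by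
  funext x; simp [hWV]

/-- The radius r = δ/|m| lets the |m| differentiations exhaust the strip exactly, down to width
zero, which still contains the real points. The factor |m|^|m| is affordable because only |m| ≤ l +
1 will occur. -/
theorem abs_mixedDeriv_le {M τ : ℝ} (hδ : 0 < δ) (hW : AnalyticOnNhd ℂ W (strip d δ))
    (hWV : ∀ x, W (toComplex x) = (V x : ℂ)) (hM : 0 ≤ M) (hτ : 0 ≤ τ) (hb : ExpBound W δ M τ)
    (m : MultiIndex d) (hm : 0 < order m) (x : EuclideanSpace ℝ (Fin d)) :
    |mixedDeriv m V x| ≤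
      M * (Real.exp (τ * δ) * order m / δ) ^ order m * Real.exp (τ * ‖x‖) := by
  have hm' : (0 : ℝ) < order m := by exact_mod_cast hm
  have hm1 : (1 : ℝ) ≤ order m := by exact_mod_cast hm
  rw [eq_re_extension hWV, mixedDeriv_re_comp_toComplex hδ.le hW]
  refine (Complex.abs_re_le_norm _).trans ?_
  have hr : 0 < δ / order m := by positivity
  have h := ExpBound.mixedCDeriv hτ hM hW hb hr m (toComplex x)
    (toComplex_mem_strip (by rw [mul_div_cancel₀ _ hm'.ne']; simp) x)
  rw [norm_toComplex] at h
  refine h.trans ?_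
  have : δ / order m ≤ δ := div_le_self hδ.le hm1
  have h2 : Real.exp (τ * (δ / order m)) / (δ / order m) ≤ Real.exp (τ * δ) * order m / δ := by
    rw [div_div_eq_mul_div]
    gcongr
  gcongr

theorem contDiff_potential (hδ : 0 ≤ δ) (hW : AnalyticOnNhd ℂ W (strip d δ))
    (hWV : ∀ x, W (toComplex x) = (V x : ℂ)) : ContDiff ℝ 2 V := by
  rw [eq_re_extension hWV, contDiff_iff_contDiffAt]
  intro x
  have h1 : ContDiffAt ℝ 2 W (toComplexL d x) :=
    ((hW _ (toComplex_mem_strip hδ x)).contDiffAt (n := 2)).restrict_scalars ℝ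
  exact Complex.reCLM.contDiff.contDiffAt.comp x (h1.comp x (toComplexL d).contDiff.contDiffAt)

theorem hessian_isSymm (hV : ContDiff ℝ 2 V) (x : EuclideanSpace ℝ (Fin d)) :
    (hessian V x)ᵀ = hessian V x := by
  have hd : Differentiable ℝ (fderiv ℝ V) :=
    (hV.fderiv_right (m := 1) (by norm_num)).differentiable (by norm_num)
  have h : ∀ i k, pderiv i (pderiv k V) x =
      fderiv ℝ (fderiv ℝ V) x (EuclideanSpace.single i 1) (EuclideanSpace.single k 1) := by
    intro i k
    have h1 := ((ContinuousLinearMap.apply ℝ ℝ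
      (EuclideanSpace.single k (1 : ℝ))).hasFDerivAt).comp x (hd x).hasFDerivAt
    have h2 : fderiv ℝ (pderiv k V) x = _ := h1.fderiv
    rw [pderiv, h2]
    rfl
  ext i k
  simp only [hessian, transpose_apply, of_apply, h]
  exact (hV.contDiffAt.isSymmSndFDerivAt (by simp)).eq _ _

end CauchyEstimates

/-! ### Conservation laws of the classical flow. -/

section ClassicalMotion

variable {d : ℕ} {V : EuclideanSpace ℝ (Fin d) → ℝ} {γ : Path d}

theorem eq_initial_of_hasDerivWithinAt_zero {E : Type*} [NormedAddCommGroup E] [NormedSpace ℝ E]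
    {f : ℝ → E} (hf : ∀ t, 0 ≤ t → HasDerivWithinAt f 0 (Set.Ici 0) t) {t : ℝ} (ht : 0 ≤ t) :
    f t = f 0 :=
  constant_of_has_deriv_right_zero (a := 0) (b := t)
    (fun s hs => (hf s hs.1).continuousWithinAt.mono Set.Icc_subset_Ici_self)
    (fun s hs => (hf s hs.1).mono (Set.Ici_subset_Ici.2 hs.1)) t ⟨ht, le_rfl⟩

theorem isUnit_det_of_mulVec {A : Matrix (Fin d) (Fin d) ℂ} (h : ∀ v, A *ᵥ v = 0 → v = 0) :
    IsUnit A.det := by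
  by_contra hdet
  have h0 : A.det = 0 := by simpa using hdet
  obtain ⟨v, hv, hAv⟩ := Matrix.exists_mulVec_eq_zero_iff.2 h0
  exact hv (h v hAv)

open scoped ComplexOrder in
-- If Av = 0 or Bv = 0, then ⟨v, (A*B + B*A)v⟩ vanishes, but it equals 2|v|². Invertibility
-- therefore need not be propagated in time separately.
theorem Admissible.of_relations {A B : Matrix (Fin d) (Fin d) ℂ} (hs : Aᵀ * B - Bᵀ * A = 0)
    (hh : Aᴴ * B + Bᴴ * A = (2 : ℂ) • (1 : Matrix (Fin d) (Fin d) ℂ)) : Admissible A B := by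
  have key : ∀ v : Fin d → ℂ, A *ᵥ v = 0 ∨ B *ᵥ v = 0 → v = 0 := by
    intro v hv
    have h1 : star v ⬝ᵥ ((Aᴴ * B + Bᴴ * A) *ᵥ v) = 0 := by
      rw [add_mulVec, dotProduct_add, ← mulVec_mulVec, ← mulVec_mulVec,
        dotProduct_mulVec _ Aᴴ, dotProduct_mulVec _ Bᴴ, ← star_mulVec, ← star_mulVec]
      rcases hv with h | h <;> simp [h]
    rw [hh, smul_mulVec, one_mulVec, dotProduct_smul] at h1
    have h2 : star v ⬝ᵥ v = 0 := (smul_eq_zero.1 h1).resolve_left two_ne_zero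
    exact dotProduct_star_self_eq_zero.1 h2
  exact ⟨isUnit_det_of_mulVec fun v hv => key v (.inl hv),
    isUnit_det_of_mulVec fun v hv => key v (.inr hv), hs, hh⟩

/-- Both matrix relations have zero time derivative: the terms in B cancel, and so do the terms in
the Hessian, because it is real and symmetric. -/
theorem Path.IsClassical.admissible_at (hγ : γ.IsClassical V) (hV : ContDiff ℝ 2 V) {t : ℝ}
    (ht : 0 ≤ t) : Admissible (γ.A t) (γ.B t) := by
  set H : ℝ → Matrix (Fin d) (Fin d) ℂ := fun s => (hessian V (γ.a s)).map (fun y : ℝ => (y : ℂ))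
    with hH
  have hHt : ∀ s, (H s)ᵀ = H s := fun s => by
    simp only [hH, ← Matrix.transpose_map, hessian_isSymm hV]
  have hHs : ∀ s, (H s)ᴴ = H s := fun s => by
    conv_rhs => rw [← hHt]
    ext i k
    simp [hH, conjTranspose_apply]
  apply Admissible.of_relations
  · rw [← hγ.admissible.symm]
    ext i k
    refine eq_initial_of_hasDerivWithinAt_zero
      (f := fun s => ((γ.A s)ᵀ * γ.B s - (γ.B s)ᵀ * γ.A s) i k) (fun s hs => ?_) ht
    have h := (HasDerivWithinAt.fun_sum (u := Finset.univ) fun n _ =>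
      (hγ.deriv_A s hs n i).mul (hγ.deriv_B s hs n k)).sub
      (HasDerivWithinAt.fun_sum (u := Finset.univ) fun n _ =>
      (hγ.deriv_B s hs n i).mul (hγ.deriv_A s hs n k))
    refine (h.congr_deriv ?_)
    have e : (γ.A s)ᵀ * (H s * γ.A s) - (H s * γ.A s)ᵀ * γ.A s = 0 := by
      rw [transpose_mul, hHt, Matrix.mul_assoc, sub_self]
    have e' := congrFun (congrFun e i) k
    rw [Matrix.sub_apply, mul_apply, mul_apply, ← Finset.sum_sub_distrib] at e'
    rw [← Finset.sum_sub_distrib]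
    calc _ = I * ∑ n, ((γ.A s)ᵀ i n * (H s * γ.A s) n k - (H s * γ.A s)ᵀ i n * γ.A s n k) := by
          rw [Finset.mul_sum]
          refine Finset.sum_congr rfl fun n _ => ?_
          simp only [transpose_apply, hH]
          ring
      _ = 0 := by rw [e']; simp
  · rw [← hγ.admissible.herm]
    ext i k
    refine eq_initial_of_hasDerivWithinAt_zero
      (f := fun s => ((γ.A s)ᴴ * γ.B s + (γ.B s)ᴴ * γ.A s) i k) (fun s hs => ?_) ht
    have h := (HasDerivWithinAt.fun_sum (u := Finset.univ) fun n _ =>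
      ((hγ.deriv_A s hs n i).star).mul (hγ.deriv_B s hs n k)).add
      (HasDerivWithinAt.fun_sum (u := Finset.univ) fun n _ =>
      ((hγ.deriv_B s hs n i).star).mul (hγ.deriv_A s hs n k))
    refine (h.congr_deriv ?_)
    have e : (γ.A s)ᴴ * (H s * γ.A s) - (H s * γ.A s)ᴴ * γ.A s = 0 := by
      rw [conjTranspose_mul, hHs, Matrix.mul_assoc, sub_self]
    have e' := congrFun (congrFun e i) k
    rw [Matrix.sub_apply, mul_apply, mul_apply, ← Finset.sum_sub_distrib] at e'
    rw [← Finset.sum_add_distrib]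
    calc _ = I * ∑ n, ((γ.A s)ᴴ i n * (H s * γ.A s) n k - (H s * γ.A s)ᴴ i n * γ.A s n k) := by
          rw [Finset.mul_sum]
          refine Finset.sum_congr rfl fun n _ => ?_
          simp only [conjTranspose_apply, hH, star_mul', Complex.star_def, Complex.conj_I]
          ring
      _ = 0 := by rw [e']; simp

theorem Path.IsClassical.energy_eq (hγ : γ.IsClassical V) (hV : ContDiff ℝ 2 V) {t : ℝ}
    (ht : 0 ≤ t) : ‖γ.η t‖ ^ 2 / 2 + V (γ.a t) = ‖γ.η 0‖ ^ 2 / 2 + V (γ.a 0) := by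
  refine eq_initial_of_hasDerivWithinAt_zero
    (f := fun s => ‖γ.η s‖ ^ 2 / 2 + V (γ.a s)) (fun s hs => ?_) ht
  have h1 := (hγ.deriv_η s hs).norm_sq.div_const 2
  have hg : HasGradientAt V (gradient V (γ.a s)) (γ.a s) :=
    (hV.differentiable (by norm_num) _).hasGradientAt
  have h2 := hg.hasFDerivAt.comp_hasDerivWithinAt s (hγ.deriv_a s hs)
  refine (h1.add h2).congr_deriv ?_
  simp only [inner_neg_right, InnerProductSpace.toDual_apply_apply]
  rw [real_inner_comm]
  ring

/-- Energy conservation makes the classical position grow at most linearly. -/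
theorem Path.IsClassical.exists_norm_a_le (hγ : γ.IsClassical V) (hV : ContDiff ℝ 2 V)
    (hVbdd : BddBelow (Set.range V)) :
    ∃ v, 0 ≤ v ∧ ∀ t, 0 ≤ t → ‖γ.a t‖ ≤ ‖γ.a 0‖ + v * t := by
  obtain ⟨c, hc⟩ := hVbdd
  have hη : ∀ t, 0 ≤ t → ‖γ.η t‖ ≤ Real.sqrt (‖γ.η 0‖ ^ 2 + 2 * (V (γ.a 0) - c)) := by
    intro t ht
    apply Real.le_sqrt_of_sq_le
    have h1 := hγ.energy_eq hV ht
    have h2 : c ≤ V (γ.a t) := hc ⟨_, rfl⟩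
    linarith
  refine ⟨Real.sqrt (‖γ.η 0‖ ^ 2 + 2 * (V (γ.a 0) - c)), Real.sqrt_nonneg _, fun t ht => ?_⟩
  have h := Convex.norm_image_sub_le_of_norm_hasDerivWithin_le hγ.deriv_a hη (convex_Ici 0)
    (Set.mem_Ici.2 le_rfl) (Set.mem_Ici.2 ht)
  rw [sub_zero, Real.norm_eq_abs, abs_of_nonneg ht] at h
  have := norm_sub_norm_le (γ.a t) (γ.a 0)
  linarith

theorem norm_entry_le (A : Matrix (Fin d) (Fin d) ℂ) (i k : Fin d) :
    ‖A i k‖ ≤ ‖Matrix.toEuclideanCLM (n := Fin d) (𝕜 := ℂ) A‖ := by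
  have h := (Matrix.toEuclideanCLM (n := Fin d) (𝕜 := ℂ) A).le_opNorm (EuclideanSpace.single k 1)
  rw [PiLp.norm_single, norm_one, mul_one] at h
  refine le_trans ?_ ((PiLp.norm_apply_le _ i).trans h)
  apply le_of_eq
  congr 1
  simp [Matrix.ofLp_toEuclideanCLM]

theorem Path.IsClassical.continuousOn_A (hγ : γ.IsClassical V) (i k : Fin d) :
    ContinuousOn (fun t => γ.A t i k) (Set.Ici 0) :=
  fun t ht => (hγ.deriv_A t ht i k).continuousWithinAt

theorem Path.IsClassical.continuousOn_B (hγ : γ.IsClassical V) (i k : Fin d) :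
    ContinuousOn (fun t => γ.B t i k) (Set.Ici 0) :=
  fun t ht => (hγ.deriv_B t ht i k).continuousWithinAt

theorem Path.IsClassical.continuousOn_η (hγ : γ.IsClassical V) :
    ContinuousOn γ.η (Set.Ici 0) :=
  fun t ht => (hγ.deriv_η t ht).continuousWithinAt

end ClassicalMotion

/-! ### Matrix identities implied by the relations between A and B. -/

section AdmissibleAlgebra

variable {d : ℕ} {A B : Matrix (Fin d) (Fin d) ℂ}

theorem Admissible.inv_mul (h : Admissible A B) : A⁻¹ * A = 1 :=
  Matrix.nonsing_inv_mul A h.isUnit_left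

theorem Admissible.mul_inv (h : Admissible A B) : A * A⁻¹ = 1 :=
  Matrix.mul_nonsing_inv A h.isUnit_left

theorem Admissible.transpose_exponent (h : Admissible A B) : (B * A⁻¹)ᵀ = B * A⁻¹ := by
  have h1 : Bᵀ * A = Aᵀ * B := (sub_eq_zero.1 h.symm).symm
  have h2 : (A⁻¹)ᵀ * Aᵀ = 1 := by rw [← transpose_mul, h.mul_inv, transpose_one]
  calc (B * A⁻¹)ᵀ = (A⁻¹)ᵀ * (Bᵀ * A) * A⁻¹ := by
        rw [transpose_mul, Matrix.mul_assoc, Matrix.mul_assoc, h.mul_inv, Matrix.mul_one]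
    _ = B * A⁻¹ := by rw [h1, ← Matrix.mul_assoc, h2, Matrix.one_mul]

/-- This is A*B + B*A = 2 multiplied by (A⁻¹)* on the left and A⁻¹ on the right. As BA⁻¹ is
symmetric, its entrywise real part is (A⁻¹)*A⁻¹, which governs the decay of |φ₀|². -/
theorem Admissible.exponent_add_conjTranspose (h : Admissible A B) :
    B * A⁻¹ + (B * A⁻¹)ᴴ = (2 : ℂ) • ((A⁻¹)ᴴ * A⁻¹) := by
  have h2 : (A⁻¹)ᴴ * Aᴴ = 1 := by rw [← conjTranspose_mul, h.mul_inv, conjTranspose_one]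
  have h3 := congrArg (fun M => (A⁻¹)ᴴ * M * A⁻¹) h.herm
  simp only [Matrix.mul_add, Matrix.add_mul] at h3
  rw [← Matrix.mul_assoc, h2, Matrix.one_mul, Matrix.mul_assoc, Matrix.mul_assoc, h.mul_inv,
    Matrix.mul_one] at h3
  rw [conjTranspose_mul, h3, Matrix.mul_smul, Matrix.smul_mul, Matrix.mul_one]

theorem Admissible.transpose_precision (h : Admissible A B) :
    ((A⁻¹)ᴴ * A⁻¹)ᵀ = (A⁻¹)ᴴ * A⁻¹ := by
  have h1 := congrArg Matrix.transpose h.exponent_add_conjTranspose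
  have h2 : ((B * A⁻¹)ᴴ)ᵀ = (B * A⁻¹)ᴴ := by
    conv_rhs => rw [← h.transpose_exponent]
    rfl
  rw [transpose_add, h.transpose_exponent, h2, h.exponent_add_conjTranspose, transpose_smul] at h1
  exact (smul_right_injective _ (two_ne_zero' ℂ) h1).symm

/-- AA* inverts the symmetric matrix (A⁻¹)*A⁻¹. Being Hermitian as well, it is real; this reality
makes the raising operators commute and the derivative terms cancel in the formula for the position
operator. -/
theorem Admissible.transpose_covariance (h : Admissible A B) : (A * Aᴴ)ᵀ = A * Aᴴ := by
  have h2 : (A⁻¹)ᴴ * Aᴴ = 1 := by rw [← conjTranspose_mul, h.mul_inv, conjTranspose_one]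
  have h3 : Aᴴ * (A⁻¹)ᴴ = 1 := by rw [← conjTranspose_mul, h.inv_mul, conjTranspose_one]
  have e1 : (A * Aᴴ) * ((A⁻¹)ᴴ * A⁻¹) = 1 := by
    rw [Matrix.mul_assoc, ← Matrix.mul_assoc Aᴴ, h3, Matrix.one_mul, h.mul_inv]
  have e2 := congrArg Matrix.transpose e1
  rw [transpose_mul, h.transpose_precision, transpose_one] at e2
  calc (A * Aᴴ)ᵀ = (A * Aᴴ) * ((A⁻¹)ᴴ * A⁻¹) * (A * Aᴴ)ᵀ := by rw [e1, Matrix.one_mul]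
    _ = A * Aᴴ := by rw [Matrix.mul_assoc, e2, Matrix.mul_one]

theorem Admissible.inv_mul_conj_symm (h : Admissible A B) :
    Aᴴ * (A⁻¹)ᵀ = A⁻¹ * (Aᴴ)ᵀ := by
  have h1 : Aᵀ * (A⁻¹)ᵀ = 1 := by rw [← transpose_mul, h.inv_mul, transpose_one]
  calc Aᴴ * (A⁻¹)ᵀ = A⁻¹ * (A * Aᴴ) * (A⁻¹)ᵀ := by
        rw [← Matrix.mul_assoc, h.inv_mul, Matrix.one_mul]
    _ = A⁻¹ * (Aᴴ)ᵀ * (Aᵀ * (A⁻¹)ᵀ) := by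
        rw [← h.transpose_covariance, transpose_mul]; simp only [Matrix.mul_assoc]
    _ = _ := by rw [h1, Matrix.mul_one]

end AdmissibleAlgebra

/-! ### Linear forms and constant-coefficient vector fields on polynomials. -/

section Polynomials

open MvPolynomial

variable {d : ℕ}

/-- The linear form `∑ v_n X_n`. -/
def linForm (v : Fin d → ℂ) : MvPolynomial (Fin d) ℂ := ∑ n, C (v n) * X n

/-- The constant coefficient vector field `∑ v_n ∂_n`. -/
def dirDeriv (v : Fin d → ℂ) :
    Derivation ℂ (MvPolynomial (Fin d) ℂ) (MvPolynomial (Fin d) ℂ) :=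
  mkDerivation ℂ fun n => C (v n)

theorem dirDeriv_X (v : Fin d → ℂ) (n : Fin d) : dirDeriv v (X n) = C (v n) :=
  mkDerivation_X _ _ _

theorem dirDeriv_C (v : Fin d → ℂ) (c : ℂ) : dirDeriv v (C c) = 0 :=
  derivation_C _ _

theorem dirDeriv_two (v : Fin d → ℂ) : dirDeriv v 2 = 0 := by
  rw [← map_ofNat C 2, dirDeriv_C]

theorem derivation_sum_apply (f : Fin d → Derivation ℂ (MvPolynomial (Fin d) ℂ)
    (MvPolynomial (Fin d) ℂ)) (P : MvPolynomial (Fin d) ℂ) : (∑ n, f n) P = ∑ n, f n P := by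
  have h := map_sum (Derivation.coeFnAddMonoidHom (R := ℂ) (A := MvPolynomial (Fin d) ℂ)
    (M := MvPolynomial (Fin d) ℂ)) f Finset.univ
  have h2 := congrFun h P
  exact h2.trans (Finset.sum_apply _ _ _)

theorem dirDeriv_eq_sum (v : Fin d → ℂ) (P : MvPolynomial (Fin d) ℂ) :
    dirDeriv v P = ∑ n, C (v n) * MvPolynomial.pderiv n P := by
  have : dirDeriv v = ∑ n, v n • MvPolynomial.pderiv n := by
    apply MvPolynomial.derivation_ext
    intro i
    rw [dirDeriv_X, derivation_sum_apply]
    simp [Pi.single_apply, MvPolynomial.pderiv_X, MvPolynomial.smul_eq_C_mul]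
  rw [this, derivation_sum_apply]
  simp [MvPolynomial.smul_eq_C_mul]

theorem dirDeriv_linForm (v w : Fin d → ℂ) : dirDeriv v (linForm w) = C (∑ n, w n * v n) := by
  simp [linForm, dirDeriv_X]

theorem dirDeriv_comm (v w : Fin d → ℂ) (P : MvPolynomial (Fin d) ℂ) :
    dirDeriv v (dirDeriv w P) = dirDeriv w (dirDeriv v P) := by
  have : ⁅dirDeriv v, dirDeriv w⁆ = 0 := by
    apply MvPolynomial.derivation_ext
    intro i
    simp [Derivation.commutator_apply, dirDeriv_X]
  have h := congrArg (fun D : Derivation ℂ _ _ => D P) this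
  simpa [Derivation.commutator_apply, sub_eq_zero] using h

end Polynomials

/-! ### Ladder operators on the polynomial factor. -/

namespace Packet

open MvPolynomial

variable {d : ℕ} (p : Packet d) (ħ : ℝ)

/-- The raising operator on the polynomial factor of a wave packet. -/
def raisePoly (m : Fin d) : MvPolynomial (Fin d) ℂ →ₗ[ℂ] MvPolynomial (Fin d) ℂ :=
  ((1 / Real.sqrt (2 * ħ) : ℝ) : ℂ) •
    (LinearMap.mulLeft ℂ (2 * linForm fun n => p.A⁻¹ m n)
      - (ħ : ℂ) • (dirDeriv fun n => conj (p.A n m)).toLinearMap)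

/-- The lowering operator on the polynomial factor of a wave packet. -/
def lowerPoly (m : Fin d) : MvPolynomial (Fin d) ℂ →ₗ[ℂ] MvPolynomial (Fin d) ℂ :=
  ((Real.sqrt (ħ / 2) : ℝ) : ℂ) • (dirDeriv fun n => p.A n m).toLinearMap

theorem raisePoly_apply (m : Fin d) (P : MvPolynomial (Fin d) ℂ) :
    p.raisePoly ħ m P = ((1 / Real.sqrt (2 * ħ) : ℝ) : ℂ) •
      (2 * linForm (fun n => p.A⁻¹ m n) * P
        - (ħ : ℂ) • dirDeriv (fun n => conj (p.A n m)) P) := by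
  simp only [raisePoly, LinearMap.smul_apply, LinearMap.sub_apply, LinearMap.mulLeft_apply]
  rfl

theorem lowerPoly_apply (m : Fin d) (P : MvPolynomial (Fin d) ℂ) :
    p.lowerPoly ħ m P = ((Real.sqrt (ħ / 2) : ℝ) : ℂ) • dirDeriv (fun n => p.A n m) P := by
  simp [lowerPoly]

variable {p ħ}

theorem sqrt_mul_sqrt (hħ : 0 < ħ) : Real.sqrt (ħ / 2) * (1 / Real.sqrt (2 * ħ)) = 1 / 2 := by
  have h : Real.sqrt (2 * ħ) = 2 * Real.sqrt (ħ / 2) := by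
    rw [show 2 * ħ = 2 ^ 2 * (ħ / 2) by ring, Real.sqrt_mul (by norm_num),
      Real.sqrt_sq (by norm_num)]
  have h2 : Real.sqrt (ħ / 2) ≠ 0 := by positivity
  rw [h]; field_simp

theorem sqrt_mul_sqrt_complex (hħ : 0 < ħ) :
    ((Real.sqrt (ħ / 2) : ℝ) : ℂ) * ((1 / Real.sqrt (2 * ħ) : ℝ) : ℂ) = 1 / 2 := by
  rw [← Complex.ofReal_mul, sqrt_mul_sqrt hħ]; norm_num

/-- The multiplications commute with each other, as do the derivatives. The cross terms contribute
constants, the entries of A⁻¹ times the entrywise conjugate of A, and that matrix is symmetric by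
`Admissible.inv_mul_conj_symm`. -/
theorem raisePoly_comm (hp : Admissible p.A p.B) (m k : Fin d) (P : MvPolynomial (Fin d) ℂ) :
    p.raisePoly ħ m (p.raisePoly ħ k P) = p.raisePoly ħ k (p.raisePoly ħ m P) := by
  have hs : ∑ n, p.A⁻¹ k n * conj (p.A n m) = ∑ n, p.A⁻¹ m n * conj (p.A n k) := by
    have h := congrFun (congrFun hp.inv_mul_conj_symm m) k
    simp only [mul_apply, transpose_apply, conjTranspose_apply, Complex.star_def] at h
    rw [← h]
    exact Finset.sum_congr rfl fun n _ => mul_comm _ _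
  simp only [raisePoly_apply, map_sub, Derivation.leibniz, dirDeriv_linForm,
    dirDeriv_comm (fun n => conj (p.A n m)) (fun n => conj (p.A n k)), smul_sub,
    smul_add, hs, MvPolynomial.smul_eq_C_mul, smul_eq_mul, dirDeriv_C, dirDeriv_two]
  ring

/-- The canonical commutation relation: differentiating the k-th linear form along the m-th column
of A gives (A⁻¹A)_{km}, and the prefactors combine to 1. -/
theorem lowerPoly_raisePoly (hp : Admissible p.A p.B) (hħ : 0 < ħ) (m k : Fin d)
    (P : MvPolynomial (Fin d) ℂ) :
    p.lowerPoly ħ m (p.raisePoly ħ k P) =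
      p.raisePoly ħ k (p.lowerPoly ħ m P) + if m = k then P else 0 := by
  have hs : ∑ n, p.A⁻¹ k n * p.A n m = if m = k then 1 else 0 := by
    have h := congrFun (congrFun hp.inv_mul k) m
    rw [mul_apply, one_apply] at h
    simpa [eq_comm] using h
  have hc : (C ((Real.sqrt (ħ / 2) : ℝ) : ℂ) : MvPolynomial (Fin d) ℂ) *
      C ((1 / Real.sqrt (2 * ħ) : ℝ) : ℂ) * 2 = 1 := by
    rw [← C_mul, sqrt_mul_sqrt_complex hħ, ← map_ofNat C 2,
      ← C_mul]
    norm_num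
  simp only [raisePoly_apply, lowerPoly_apply, map_sub, Derivation.leibniz,
    dirDeriv_linForm, hs, dirDeriv_comm (fun n => conj (p.A n k)) (fun n => p.A n m), smul_sub,
    smul_add, MvPolynomial.smul_eq_C_mul, smul_eq_mul, dirDeriv_C, dirDeriv_two]
  split_ifs
  · simp only [C_1]
    linear_combination P * hc
  · simp only [C_0]
    ring

/-- The multiplication parts reassemble to the coordinate by AA⁻¹ = 1, and the derivative parts
cancel because AA* is real. This identity is the source of the factor √ħ · |A| carried by each power
of x - a. -/
theorem X_mul_eq (hp : Admissible p.A p.B) (hħ : 0 < ħ) (n : Fin d) (P : MvPolynomial (Fin d) ℂ) :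
    X n * P = ((Real.sqrt (ħ / 2) : ℝ) : ℂ) •
      ∑ m, (p.A n m • p.raisePoly ħ m P + conj (p.A n m) • p.lowerPoly ħ m P) := by
  have hX : ∑ m, p.A n m • linForm (fun k => p.A⁻¹ m k) = X n := by
    simp only [linForm, Finset.smul_sum]
    simp only [MvPolynomial.smul_eq_C_mul, ← mul_assoc, ← C_mul]
    rw [Finset.sum_comm]
    have key : ∀ k, ∑ m, C (p.A n m * p.A⁻¹ m k) * (X k : MvPolynomial (Fin d) ℂ) =
        if n = k then X k else 0 := by
      intro k
      rw [← Finset.sum_mul, ← map_sum]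
      have h := congrFun (congrFun hp.mul_inv n) k
      rw [mul_apply, one_apply] at h
      rw [h]; split_ifs <;> simp
    simp only [key, Finset.sum_ite_eq, Finset.mem_univ, if_true]
  have hD : ∑ m, p.A n m • dirDeriv (fun k => conj (p.A k m)) P =
      ∑ m, conj (p.A n m) • dirDeriv (fun k => p.A k m) P := by
    simp only [dirDeriv_eq_sum, Finset.smul_sum, MvPolynomial.smul_eq_C_mul, ← mul_assoc, ← C_mul]
    rw [Finset.sum_comm]
    conv_rhs => rw [Finset.sum_comm]
    refine Finset.sum_congr rfl fun k _ => ?_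
    rw [← Finset.sum_mul, ← Finset.sum_mul, ← map_sum, ← map_sum]
    have h := congrFun (congrFun hp.transpose_covariance k) n
    simp only [transpose_apply, mul_apply, conjTranspose_apply, Complex.star_def] at h
    rw [h]
    congr 2
    exact Finset.sum_congr rfl fun n _ => mul_comm _ _
  have h1 : ∀ m, p.A n m • p.raisePoly ħ m P + conj (p.A n m) • p.lowerPoly ħ m P =
      ((1 / Real.sqrt (2 * ħ) : ℝ) : ℂ) • (2 * (p.A n m • linForm (fun k => p.A⁻¹ m k)) * P)
      - (((1 / Real.sqrt (2 * ħ) : ℝ) : ℂ) * ħ) • (p.A n m • dirDeriv (fun k => conj (p.A k m)) P)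
      + ((Real.sqrt (ħ / 2) : ℝ) : ℂ) • (conj (p.A n m) • dirDeriv (fun k => p.A k m) P) := by
    intro m
    simp only [raisePoly_apply, lowerPoly_apply, MvPolynomial.smul_eq_C_mul, C_mul]
    ring
  have hs : ((1 / Real.sqrt (2 * ħ) : ℝ) : ℂ) * ħ = ((Real.sqrt (ħ / 2) : ℝ) : ℂ) := by
    have := sqrt_mul_sqrt hħ
    have h3 : Real.sqrt (ħ / 2) * Real.sqrt (ħ / 2) = ħ / 2 := Real.mul_self_sqrt (by positivity)
    rw [← Complex.ofReal_mul]
    congr 1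
    have h4 : ħ = 2 * (Real.sqrt (ħ / 2) * Real.sqrt (ħ / 2)) := by rw [h3]; ring
    calc 1 / √(2 * ħ) * ħ = 2 * Real.sqrt (ħ / 2) * (√(ħ / 2) * (1 / √(2 * ħ))) := by
          nth_rewrite 2 [h4]; ring
      _ = _ := by rw [this]; ring
  simp only [h1, Finset.sum_add_distrib, Finset.sum_sub_distrib, ← Finset.smul_sum,
    ← Finset.sum_mul, ← Finset.mul_sum, hX, hD, hs, sub_add_cancel]
  rw [smul_smul, sqrt_mul_sqrt_complex hħ, MvPolynomial.smul_eq_C_mul,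
    ← map_ofNat C 2, ← mul_assoc, ← mul_assoc, ← C_mul]
  norm_num

end Packet

/-! ### Polynomials as functions of x - a. -/

section Evaluation

open MvPolynomial

variable {d : ℕ} (a : EuclideanSpace ℝ (Fin d))

/-- The function `x ↦ P(x - a)`. -/
def evalAt (P : MvPolynomial (Fin d) ℂ) (x : EuclideanSpace ℝ (Fin d)) : ℂ :=
  MvPolynomial.eval (fun i => ((x i - a i : ℝ) : ℂ)) P

theorem differentiable_coord (i : Fin d) :
    Differentiable ℝ fun x : EuclideanSpace ℝ (Fin d) => ((x i - a i : ℝ) : ℂ) := by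
  have : Differentiable ℝ fun x : EuclideanSpace ℝ (Fin d) => x i - a i :=
    ((EuclideanSpace.proj (𝕜 := ℝ) i).differentiable).sub_const _
  exact Complex.ofRealCLM.differentiable.comp this

theorem pderiv_coord (n i : Fin d) (x : EuclideanSpace ℝ (Fin d)) :
    pderiv n (fun x : EuclideanSpace ℝ (Fin d) => ((x i - a i : ℝ) : ℂ)) x =
      if i = n then 1 else 0 := by
  have h1 : HasFDerivAt (fun x : EuclideanSpace ℝ (Fin d) => x i - a i)
      (EuclideanSpace.proj (𝕜 := ℝ) i) x :=
    ((EuclideanSpace.proj (𝕜 := ℝ) i).hasFDerivAt).sub_const _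
  have h2 := Complex.ofRealCLM.hasFDerivAt.comp x h1
  have h3 : fderiv ℝ (fun x : EuclideanSpace ℝ (Fin d) => ((x i - a i : ℝ) : ℂ)) x = _ := h2.fderiv
  rw [pderiv, h3]
  by_cases h : i = n <;> simp [h]

theorem pderiv_mul {f g : EuclideanSpace ℝ (Fin d) → ℂ} {x : EuclideanSpace ℝ (Fin d)}
    (hf : DifferentiableAt ℝ f x) (hg : DifferentiableAt ℝ g x) (n : Fin d) :
    pderiv n (fun y => f y * g y) x = f x * pderiv n g x + g x * pderiv n f x := by
  have : fderiv ℝ (fun y => f y * g y) x = _ := fderiv_mul hf hg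
  rw [pderiv, this]
  simp [pderiv]

theorem evalAt_aux (P : MvPolynomial (Fin d) ℂ) : Differentiable ℝ (evalAt a P) ∧
    ∀ n x, pderiv n (evalAt a P) x = evalAt a (MvPolynomial.pderiv n P) x := by
  induction P using MvPolynomial.induction_on with
  | C c =>
    have : evalAt a (C c) = fun _ => c := by funext x; simp [evalAt]
    rw [this]
    refine ⟨differentiable_const c, fun n x => ?_⟩
    simp [pderiv, evalAt]
  | add P Q hP hQ =>
    have : evalAt a (P + Q) = evalAt a P + evalAt a Q := by funext x; simp [evalAt]
    rw [this]
    refine ⟨hP.1.add hQ.1, fun n x => ?_⟩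
    rw [pderiv, fderiv_add (hP.1 x) (hQ.1 x), map_add]
    have h1 := hP.2 n x
    have h2 := hQ.2 n x
    simp only [pderiv, evalAt] at h1 h2 ⊢
    simp [h1, h2]
  | mul_X P i hP =>
    have : evalAt a (P * X i) = fun x => evalAt a P x * ((x i - a i : ℝ) : ℂ) := by
      funext x; simp [evalAt]
    rw [this]
    refine ⟨hP.1.mul (differentiable_coord a i), fun n x => ?_⟩
    rw [pderiv_mul (hP.1 x) (differentiable_coord a i x), hP.2, pderiv_coord]
    simp only [evalAt, Derivation.leibniz, MvPolynomial.pderiv_X, smul_eq_mul, map_add, map_mul,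
      eval_X, Pi.single_apply]
    split_ifs <;> simp

theorem differentiable_evalAt (P : MvPolynomial (Fin d) ℂ) : Differentiable ℝ (evalAt a P) :=
  (evalAt_aux a P).1

theorem continuous_evalAt (P : MvPolynomial (Fin d) ℂ) : Continuous (evalAt a P) :=
  (differentiable_evalAt a P).continuous

theorem pderiv_evalAt (P : MvPolynomial (Fin d) ℂ) (n : Fin d) (x : EuclideanSpace ℝ (Fin d)) :
    pderiv n (evalAt a P) x = evalAt a (MvPolynomial.pderiv n P) x := (evalAt_aux a P).2 n x

end Evaluation

/-! ### The states as polynomials times the Gaussian. -/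

namespace Packet

open MvPolynomial

variable {d : ℕ} (p : Packet d) (ħ : ℝ)

/-- The function `P(x - a) φ₀(x)`. -/
def wave (P : MvPolynomial (Fin d) ℂ) (x : EuclideanSpace ℝ (Fin d)) : ℂ :=
  evalAt p.a P x * p.gaussian ħ x

/-- The exponent of the Gaussian, as a polynomial in `x - a`. -/
def exponentPoly : MvPolynomial (Fin d) ℂ :=
  C (-(1 / (2 * (ħ : ℂ)))) * ∑ j, X j * linForm (fun k => (p.B * p.A⁻¹) j k)
    + C (I / (ħ : ℂ)) * linForm fun k => (p.η k : ℂ)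

theorem evalAt_linForm (a : EuclideanSpace ℝ (Fin d)) (v : Fin d → ℂ)
    (x : EuclideanSpace ℝ (Fin d)) :
    evalAt a (linForm v) x = ∑ k, v k * ((x k - a k : ℝ) : ℂ) := by
  simp [evalAt, linForm]

theorem gaussian_eq_exp (x : EuclideanSpace ℝ (Fin d)) : p.gaussian ħ x =
    ((Real.pi ^ (-(d : ℝ) / 4) * ħ ^ (-(d : ℝ) / 4) : ℝ) : ℂ) * p.sqrtDet⁻¹ *
      Complex.exp (evalAt p.a (p.exponentPoly ħ) x) := by
  unfold gaussian
  simp only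
  congr 2
  simp only [evalAt, exponentPoly, linForm, map_add, map_mul, map_sum, eval_C, eval_X,
    dotProduct, mulVec]
  ring

theorem evalAt_pderiv_exponentPoly (hp : Admissible p.A p.B) (n : Fin d)
    (x : EuclideanSpace ℝ (Fin d)) :
    evalAt p.a (MvPolynomial.pderiv n (p.exponentPoly ħ)) x =
      (-(∑ k, (p.B * p.A⁻¹) n k * ((x k - p.a k : ℝ) : ℂ)) + I * p.η n) / ħ := by
  have hlin : ∀ v : Fin d → ℂ, MvPolynomial.pderiv n (linForm v) = C (v n) := fun v => by
    simp [linForm, MvPolynomial.pderiv_X, Pi.single_apply]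
  have hsym : ∀ j, (p.B * p.A⁻¹) j n = (p.B * p.A⁻¹) n j := fun j =>
    congrFun (congrFun hp.transpose_exponent n) j
  have h : MvPolynomial.pderiv n (p.exponentPoly ħ) =
      C (-(1 / (2 * (ħ : ℂ)))) * (C 2 * linForm (fun k => (p.B * p.A⁻¹) n k))
        + C (I / (ħ : ℂ)) * C (p.η n : ℂ) := by
    simp only [exponentPoly, map_add, Derivation.leibniz, map_sum, MvPolynomial.pderiv_C, hlin,
      smul_eq_mul, MvPolynomial.pderiv_X, Pi.single_apply, hsym, Finset.sum_add_distrib, mul_zero,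
      add_zero]
    congr 2
    simp only [mul_ite, mul_one, mul_zero, Finset.sum_ite_eq', Finset.mem_univ,
      if_true]
    rw [show (C (2 : ℂ) : MvPolynomial (Fin d) ℂ) = 2 from map_ofNat C 2, two_mul]
    congr 1
    simp only [linForm]
    exact Finset.sum_congr rfl fun j _ => mul_comm _ _
  rw [h]
  have hl := evalAt_linForm p.a (fun k => (p.B * p.A⁻¹) n k) x
  simp only [evalAt] at hl ⊢
  simp only [map_add, map_mul, eval_C, hl]
  ring

theorem differentiable_gaussian : Differentiable ℝ (p.gaussian ħ) := by
  have : p.gaussian ħ = fun x => ((Real.pi ^ (-(d : ℝ) / 4) * ħ ^ (-(d : ℝ) / 4) : ℝ) : ℂ) *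
      p.sqrtDet⁻¹ * Complex.exp (evalAt p.a (p.exponentPoly ħ) x) :=
    funext (p.gaussian_eq_exp ħ)
  rw [this]
  exact ((differentiable_evalAt p.a _).cexp).const_mul _

theorem pderiv_gaussian (hp : Admissible p.A p.B) (n : Fin d) (x : EuclideanSpace ℝ (Fin d)) :
    pderiv n (p.gaussian ħ) x =
      (-(∑ k, (p.B * p.A⁻¹) n k * ((x k - p.a k : ℝ) : ℂ)) + I * p.η n) / ħ * p.gaussian ħ x := by
  rw [← p.evalAt_pderiv_exponentPoly ħ hp, ← pderiv_evalAt, p.gaussian_eq_exp]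
  have : p.gaussian ħ = fun x => ((Real.pi ^ (-(d : ℝ) / 4) * ħ ^ (-(d : ℝ) / 4) : ℝ) : ℂ) *
      p.sqrtDet⁻¹ * Complex.exp (evalAt p.a (p.exponentPoly ħ) x) :=
    funext (p.gaussian_eq_exp ħ)
  rw [this]
  have h := ((differentiable_evalAt p.a (p.exponentPoly ħ) x).hasFDerivAt.cexp).const_mul
    (((Real.pi ^ (-(d : ℝ) / 4) * ħ ^ (-(d : ℝ) / 4) : ℝ) : ℂ) * p.sqrtDet⁻¹)
  rw [pderiv, h.fderiv]
  simp only [pderiv, _root_.smul_apply, smul_eq_mul]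
  ring

/-- Differentiating the Gaussian produces -BA⁻¹(x - a) + iη over ħ. The momentum terms cancel, and
B* + A*BA⁻¹ = 2A⁻¹ leaves multiplication by a linear form involving A alone. -/
theorem raising_wave (hp : Admissible p.A p.B) (hħ : 0 < ħ) (m : Fin d)
    (P : MvPolynomial (Fin d) ℂ) :
    p.raising ħ m (p.wave ħ P) = p.wave ħ (p.raisePoly ħ m P) := by
  funext x
  set y : Fin d → ℂ := fun i => ((x i - p.a i : ℝ) : ℂ) with hy
  have hd : ∀ n, pderiv n (p.wave ħ P) x =
      evalAt p.a P x * ((-(∑ k, (p.B * p.A⁻¹) n k * y k) + I * p.η n) / ħ * p.gaussian ħ x)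
        + p.gaussian ħ x * evalAt p.a (MvPolynomial.pderiv n P) x := by
    intro n
    unfold wave
    rw [pderiv_mul (differentiable_evalAt _ _ x) (p.differentiable_gaussian ħ x),
      p.pderiv_gaussian ħ hp, pderiv_evalAt]
  have hlin : ∑ n, conj (p.B n m) * y n + ∑ n, conj (p.A n m) * ∑ k, (p.B * p.A⁻¹) n k * y k =
      2 * ∑ n, p.A⁻¹ m n * y n := by
    have h : p.Bᴴ + p.Aᴴ * (p.B * p.A⁻¹) = (2 : ℂ) • p.A⁻¹ := by
      have h3 := congrArg (fun M => M * p.A⁻¹) hp.herm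
      simp only [Matrix.add_mul] at h3
      rw [Matrix.mul_assoc, Matrix.mul_assoc, hp.mul_inv, Matrix.mul_one, add_comm] at h3
      rw [h3, Matrix.smul_mul, Matrix.one_mul]
    generalize p.B * p.A⁻¹ = Z at h ⊢
    have h4 := congrFun (congrArg (fun M => M *ᵥ y) h) m
    simp only [add_mulVec, ← mulVec_mulVec, smul_mulVec] at h4
    simp only [mulVec, dotProduct, conjTranspose_apply, Pi.add_apply, Pi.smul_apply, smul_eq_mul,
      Complex.star_def] at h4
    exact h4
  have hħ' : (ħ : ℂ) ≠ 0 := by exact_mod_cast hħ.ne'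
  have hR : evalAt p.a (p.raisePoly ħ m P) x = ((1 / Real.sqrt (2 * ħ) : ℝ) : ℂ) *
      (2 * (∑ n, p.A⁻¹ m n * y n) * evalAt p.a P x
        - ħ * ∑ n, conj (p.A n m) * evalAt p.a (MvPolynomial.pderiv n P) x) := by
    rw [raisePoly_apply, dirDeriv_eq_sum]
    simp [evalAt, linForm, MvPolynomial.smul_eq_C_mul, hy]
  have hterm : ∀ n, conj (p.A n m) *
      (-I * (ħ : ℂ) * pderiv n (p.wave ħ P) x - (p.η n : ℂ) * p.wave ħ P x) =
      -I * p.gaussian ħ x * (ħ * (conj (p.A n m) * evalAt p.a (MvPolynomial.pderiv n P) x)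
       - evalAt p.a P x * (conj (p.A n m) * ∑ k, (p.B * p.A⁻¹) n k * y k)) := by
    intro n
    rw [hd, wave]
    field_simp
    linear_combination (-(conj (p.A n m) * evalAt p.a P x * p.η n * p.gaussian ħ x)) * I_sq
  rw [raising]
  simp only [hterm]
  rw [← Finset.mul_sum, Finset.sum_sub_distrib, ← Finset.mul_sum, ← Finset.mul_sum,
    ← Finset.sum_mul, wave, wave, hR, ← hlin]
  linear_combination (((1 / Real.sqrt (2 * ħ) : ℝ) : ℂ) * p.gaussian ħ x *
    (ħ * (∑ n, conj (p.A n m) * evalAt p.a (MvPolynomial.pderiv n P) x)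
     - evalAt p.a P x * ∑ n, (conj (p.A n m) * ∑ k, (p.B * p.A⁻¹) n k * y k))) * I_sq

/-- The polynomial factor of `(𝒜₁*)^{j₁} ⋯ (𝒜_d*)^{j_d} φ₀`. -/
def hermitePoly (j : MultiIndex d) : MvPolynomial (Fin d) ℂ :=
  (List.finRange d).foldr (fun m P => (p.raisePoly ħ m)^[j m] P) 1

/-- The polynomial factor of `φ_j`. -/
def statePoly (j : MultiIndex d) : MvPolynomial (Fin d) ℂ :=
  ((1 / Real.sqrt (multiFactorial j : ℝ) : ℝ) : ℂ) • p.hermitePoly ħ j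

theorem wave_smul (c : ℂ) (P : MvPolynomial (Fin d) ℂ) (x : EuclideanSpace ℝ (Fin d)) :
    p.wave ħ (c • P) x = c * p.wave ħ P x := by
  simp [wave, evalAt, MvPolynomial.smul_eq_C_mul, mul_assoc]

theorem wave_sum {ι : Type*} (s : Finset ι) (f : ι → MvPolynomial (Fin d) ℂ)
    (x : EuclideanSpace ℝ (Fin d)) :
    p.wave ħ (∑ j ∈ s, f j) x = ∑ j ∈ s, p.wave ħ (f j) x := by
  simp [wave, evalAt, Finset.sum_mul]

theorem state_eq_wave (hp : Admissible p.A p.B) (hħ : 0 < ħ) (j : MultiIndex d) :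
    p.state ħ j = p.wave ħ (p.statePoly ħ j) := by
  have hit : ∀ (m : Fin d) (k : ℕ) (P : MvPolynomial (Fin d) ℂ),
      (p.raising ħ m)^[k] (p.wave ħ P) = p.wave ħ ((p.raisePoly ħ m)^[k] P) := by
    intro m k P
    induction k with
    | zero => rfl
    | succ k ih => rw [Function.iterate_succ_apply', ih, p.raising_wave ħ hp hħ,
        Function.iterate_succ_apply']
  have hfold : ∀ L : List (Fin d),
      L.foldr (fun m g => (p.raising ħ m)^[j m] g) (p.gaussian ħ) =
        p.wave ħ (L.foldr (fun m P => (p.raisePoly ħ m)^[j m] P) 1) := by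
    intro L
    induction L with
    | nil => funext x; simp [wave, evalAt]
    | cons m L ih => simp only [List.foldr_cons, ih, hit]
  funext x
  rw [state, hfold, statePoly, wave_smul, hermitePoly]

variable {p ħ}

/-- Since the raising operators commute, an extra one can be moved from its place in the ordered
product to the front. -/
theorem hermitePoly_add_single (hp : Admissible p.A p.B) (j : MultiIndex d) (k : Fin d) :
    p.hermitePoly ħ (j + Pi.single k 1) = p.raisePoly ħ k (p.hermitePoly ħ j) := by
  have hit : ∀ (m : Fin d) (n : ℕ) (P : MvPolynomial (Fin d) ℂ),
      p.raisePoly ħ k ((p.raisePoly ħ m)^[n] P) = (p.raisePoly ħ m)^[n] (p.raisePoly ħ k P) := by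
    intro m n P
    exact (Function.Commute.iterate_right
      (f := p.raisePoly ħ k) (g := p.raisePoly ħ m) (fun Q => raisePoly_comm hp k m Q) n) P
  -- Absence of duplicates matters: the exponent at k must be increased exactly once.
  have key : ∀ L : List (Fin d), L.Nodup →
      L.foldr (fun m P => (p.raisePoly ħ m)^[(j + Pi.single k 1 : MultiIndex d) m] P) 1 =
        if k ∈ L then p.raisePoly ħ k (L.foldr (fun m P => (p.raisePoly ħ m)^[j m] P) 1)
        else L.foldr (fun m P => (p.raisePoly ħ m)^[j m] P) 1 := by
    intro L hL
    induction L with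
    | nil => simp
    | cons m L ih =>
      rw [List.nodup_cons] at hL
      simp only [List.foldr_cons, ih hL.2, List.mem_cons]
      by_cases hk : k = m
      · subst hk
        simp [hL.1, Function.iterate_succ_apply']
      · have h0 : (j + Pi.single k 1 : MultiIndex d) m = j m := by simp [Ne.symm hk]
        simp only [hk, false_or, h0]
        split_ifs
        · rw [hit]
        · rfl
  have h := key (List.finRange d) (List.nodup_finRange d)
  rw [if_pos (List.mem_finRange k)] at h
  exact h

theorem hermitePoly_zero : p.hermitePoly ħ 0 = 1 := by
  have : ∀ L : List (Fin d),
      L.foldr (fun m P => (p.raisePoly ħ m)^[(0 : MultiIndex d) m] P) 1 = 1 := by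
    intro L
    induction L with
    | nil => rfl
    | cons m L ih => simp
  exact this _

end Packet

/-! ### Adding and removing a unit in a multi-index. -/

section MultiIndices

variable {d : ℕ}

theorem order_add_single (j : MultiIndex d) (k : Fin d) :
    order (j + Pi.single k 1) = order j + 1 := by
  simp [order, Finset.sum_add_distrib]

theorem order_zero : order (0 : MultiIndex d) = 0 := by simp [order]

theorem order_eq_zero {j : MultiIndex d} (h : order j = 0) : j = 0 := by
  funext i
  simpa using (Finset.sum_eq_zero_iff.1 h) i (Finset.mem_univ i)

theorem sub_single_add_single {j : MultiIndex d} {k : Fin d} (h : j k ≠ 0) :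
    j - Pi.single k 1 + Pi.single k 1 = j := by
  funext i
  by_cases hi : i = k
  · subst hi; simp; omega
  · simp [hi]

theorem le_order (j : MultiIndex d) (k : Fin d) : j k ≤ order j :=
  Finset.single_le_sum (f := j) (fun _ _ => Nat.zero_le _) (Finset.mem_univ k)

theorem multiIndex_induction {motive : MultiIndex d → Prop} (zero : motive 0)
    (add_single : ∀ j k, motive j → motive (j + Pi.single k 1)) (j : MultiIndex d) : motive j := by
  obtain ⟨n, hn⟩ : ∃ n, order j = n := ⟨_, rfl⟩
  induction n generalizing j with
  | zero => rw [order_eq_zero hn]; exact zero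
  | succ n ih =>
    obtain ⟨k, hk⟩ : ∃ k, j k ≠ 0 := by
      by_contra! h
      have : j = 0 := funext h
      rw [this, order_zero] at hn
      omega
    rw [← sub_single_add_single hk]
    apply add_single
    apply ih
    have := order_add_single (j - Pi.single k 1) k
    rw [sub_single_add_single hk] at this
    omega

theorem multiFactorial_add_single (j : MultiIndex d) (k : Fin d) :
    multiFactorial (j + Pi.single k 1) = (j k + 1) * multiFactorial j := by
  unfold multiFactorial
  rw [← Finset.mul_prod_erase _ _ (Finset.mem_univ k),
    ← Finset.mul_prod_erase _ (fun i => (j i).factorial) (Finset.mem_univ k), ← mul_assoc]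
  congr 1
  · simp [Nat.factorial_succ]
  · refine Finset.prod_congr rfl fun i hi => ?_
    simp [Finset.ne_of_mem_erase hi]

theorem multiFactorial_pos (j : MultiIndex d) : 0 < multiFactorial j :=
  Finset.prod_pos fun _ _ => Nat.factorial_pos _

end MultiIndices

/-! ### Ladder operators on the Hermite polynomials and normalized states. -/

namespace Packet

variable {d : ℕ} {p : Packet d} {ħ : ℝ}

/-- Lowering kills the constant 1, and each commutation past a raising operator of index k leaves
one copy, whence the factor j_k. For j_k = 0 the truncated subtraction does no harm, as the
coefficient vanishes. -/
theorem lowerPoly_hermitePoly (hp : Admissible p.A p.B) (hħ : 0 < ħ) (k : Fin d)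
    (j : MultiIndex d) : p.lowerPoly ħ k (p.hermitePoly ħ j) =
      (j k : ℂ) • p.hermitePoly ħ (j - Pi.single k 1) := by
  induction j using multiIndex_induction with
  | zero =>
    have h1 : dirDeriv (fun n => p.A n k) 1 = 0 := Derivation.map_one_eq_zero _
    simp [hermitePoly_zero, lowerPoly_apply, h1]
  | add_single j i ih =>
    rw [hermitePoly_add_single hp, lowerPoly_raisePoly hp hħ, ih, map_smul]
    by_cases hki : k = i
    · subst hki
      have h1 : j + Pi.single k 1 - Pi.single k 1 = j := by funext n; simp
      rw [h1]
      by_cases hj : j k = 0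
      · simp [hj]
      · rw [← hermitePoly_add_single hp, sub_single_add_single hj]
        simp [add_smul]
    · have h0 : (j + Pi.single i 1 : MultiIndex d) k = j k := by simp [hki]
      rw [h0, if_neg hki, add_zero, ← hermitePoly_add_single hp]
      congr 2
      funext n
      by_cases hn : n = k
      · subst hn; simp [hki]
      · simp [Pi.single_apply, hn]

theorem raisePoly_statePoly (hp : Admissible p.A p.B) (k : Fin d) (j : MultiIndex d) :
    p.raisePoly ħ k (p.statePoly ħ j) =
      ((Real.sqrt (j k + 1) : ℝ) : ℂ) • p.statePoly ħ (j + Pi.single k 1) := by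
  rw [statePoly, statePoly, map_smul, ← hermitePoly_add_single hp, smul_smul,
    multiFactorial_add_single, ← Complex.ofReal_mul]
  congr 2
  have h1 : (0 : ℝ) < multiFactorial j := by exact_mod_cast multiFactorial_pos j
  push_cast
  rw [Real.sqrt_mul (by positivity)]
  have h2 : 0 < Real.sqrt ((j k : ℝ) + 1) := by positivity
  field_simp

theorem lowerPoly_statePoly (hp : Admissible p.A p.B) (hħ : 0 < ħ) (k : Fin d)
    (j : MultiIndex d) :
    p.lowerPoly ħ k (p.statePoly ħ j) =
      ((Real.sqrt (j k) : ℝ) : ℂ) • p.statePoly ħ (j - Pi.single k 1) := by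
  rw [statePoly, statePoly, map_smul, lowerPoly_hermitePoly hp hħ, smul_smul, smul_smul]
  by_cases hj : j k = 0
  · simp [hj]
  congr 1
  have h1 : (0 : ℝ) < multiFactorial (j - Pi.single k 1) := by
    exact_mod_cast multiFactorial_pos _
  have h3 := multiFactorial_add_single (j - Pi.single k 1) k
  rw [sub_single_add_single hj] at h3
  have h4 : ((j - Pi.single k 1 : MultiIndex d) k + 1 : ℕ) = j k := by simp; omega
  rw [h4] at h3
  rw [h3, ← Complex.ofReal_natCast, ← Complex.ofReal_mul, ← Complex.ofReal_mul]
  congr 1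
  have h2 : (0 : ℝ) < j k := by exact_mod_cast Nat.pos_of_ne_zero hj
  push_cast
  rw [Real.sqrt_mul h2.le]
  have h5 : 0 < Real.sqrt (j k : ℝ) := by positivity
  have h6 : Real.sqrt (j k : ℝ) * Real.sqrt (j k) = j k := Real.mul_self_sqrt h2.le
  field_simp
  linarith [h6]

end Packet

/-! ### Real Gaussian integrals and domination of polynomials. -/

section RealGaussian

variable {d : ℕ}

open scoped MatrixOrder in
theorem exists_eq_transpose_mul_self {S : Matrix (Fin d) (Fin d) ℝ} (h : S.PosSemidef) :
    ∃ C : Matrix (Fin d) (Fin d) ℝ, S = Cᵀ * C := by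
  obtain ⟨C, hC⟩ := CStarAlgebra.nonneg_iff_eq_star_mul_self.1 (Matrix.nonneg_iff_posSemidef.2 h)
  exact ⟨C, hC⟩

theorem det_toEuclideanLin (C : Matrix (Fin d) (Fin d) ℝ) :
    LinearMap.det (Matrix.toEuclideanLin C) = C.det := by
  have h : Matrix.toEuclideanLin C = _ := congrFun (congrArg _ (Matrix.toLpLin_eq_toLin 2 2)) C
  rw [h, LinearMap.det_toLin]

theorem exists_norm_le_mul_norm {C : Matrix (Fin d) (Fin d) ℝ} (hC : C.det ≠ 0) :
    ∃ K > 0, ∀ y : EuclideanSpace ℝ (Fin d), ‖y‖ ≤ K * ‖Matrix.toEuclideanLin C y‖ := by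
  -- The added 1 keeps the constant positive even for d = 0.
  refine ⟨‖Matrix.toEuclideanCLM (n := Fin d) (𝕜 := ℝ) C⁻¹‖ + 1, by positivity, fun y => ?_⟩
  have h1 : Matrix.toEuclideanCLM (n := Fin d) (𝕜 := ℝ) C⁻¹ (Matrix.toEuclideanLin C y) = y := by
    have h2 : Matrix.toEuclideanLin C y = Matrix.toEuclideanCLM (n := Fin d) (𝕜 := ℝ) C y := rfl
    rw [h2, ← mul_apply_eq_comp, ← map_mul,
      Matrix.nonsing_inv_mul _ (isUnit_iff_ne_zero.2 hC), map_one]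
    rfl
  calc ‖y‖ = ‖Matrix.toEuclideanCLM (n := Fin d) (𝕜 := ℝ) C⁻¹ (Matrix.toEuclideanLin C y)‖ := by
        rw [h1]
    _ ≤ ‖Matrix.toEuclideanCLM (n := Fin d) (𝕜 := ℝ) C⁻¹‖ * ‖Matrix.toEuclideanLin C y‖ :=
        ContinuousLinearMap.le_opNorm _ _
    _ ≤ _ := by gcongr; linarith

theorem integral_exp_neg_norm_sq_linear {C : Matrix (Fin d) (Fin d) ℝ} (hC : C.det ≠ 0) {c : ℝ}
    (hc : 0 < c) (a : EuclideanSpace ℝ (Fin d)) :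
    ∫ x : EuclideanSpace ℝ (Fin d), Real.exp (-c * ‖Matrix.toEuclideanLin C (x - a)‖ ^ 2) =
      |C.det|⁻¹ * (Real.pi / c) ^ ((d : ℝ) / 2) := by
  rw [integral_sub_right_eq_self
    (fun x => Real.exp (-c * ‖Matrix.toEuclideanLin C x‖ ^ 2)) a]
  have hdet : LinearMap.det (Matrix.toEuclideanLin C) ≠ 0 := by rwa [det_toEuclideanLin]
  have hmap := Measure.map_linearMap_addHaar_eq_smul_addHaar
    (volume : Measure (EuclideanSpace ℝ (Fin d))) hdet
  have hcont : Continuous (Matrix.toEuclideanLin C) := LinearMap.continuous_of_finiteDimensional _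
  have h1 := integral_map (μ := (volume : Measure (EuclideanSpace ℝ (Fin d))))
    hcont.aemeasurable (f := fun x => Real.exp (-c * ‖x‖ ^ 2))
    (by apply Continuous.aestronglyMeasurable; fun_prop)
  rw [← h1, hmap, integral_smul_measure, GaussianFourier.integral_rexp_neg_mul_sq_norm hc,
    det_toEuclideanLin, ENNReal.toReal_ofReal (abs_nonneg _), abs_inv]
  simp

theorem integrable_exp_neg_norm_sub_sq {c : ℝ} (hc : 0 < c) (a : EuclideanSpace ℝ (Fin d)) :
    Integrable fun x : EuclideanSpace ℝ (Fin d) => Real.exp (-c * ‖x - a‖ ^ 2) := by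
  have h := (GaussianFourier.integrable_cexp_neg_mul_sq_norm_add (b := (c : ℂ))
    (V := EuclideanSpace ℝ (Fin d)) (by simpa using hc) 0 0).norm.comp_sub_right a
  refine h.congr (Filter.Eventually.of_forall fun x => ?_)
  simp [Complex.norm_exp, ← Complex.ofReal_pow, ← Complex.ofReal_mul]

/-- The rate ε is arbitrary so that the induction can spend ε/2 on the polynomial and ε/2 on one
further coordinate. -/
theorem exists_norm_evalAt_le (a : EuclideanSpace ℝ (Fin d)) (P : MvPolynomial (Fin d) ℂ) :
    ∀ ε > 0, ∃ K, 0 ≤ K ∧ ∀ x, ‖evalAt a P x‖ ≤ K * Real.exp (ε * ‖x - a‖ ^ 2) := by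
  induction P using MvPolynomial.induction_on with
  | C c =>
    intro ε hε
    refine ⟨‖c‖, norm_nonneg _, fun x => ?_⟩
    have : 1 ≤ Real.exp (ε * ‖x - a‖ ^ 2) := Real.one_le_exp (by positivity)
    simpa [evalAt] using le_mul_of_one_le_right (norm_nonneg c) this
  | add P Q hP hQ =>
    intro ε hε
    obtain ⟨K₁, h1, hP⟩ := hP ε hε
    obtain ⟨K₂, h2, hQ⟩ := hQ ε hε
    refine ⟨K₁ + K₂, by positivity, fun x => ?_⟩
    have : evalAt a (P + Q) x = evalAt a P x + evalAt a Q x := by simp [evalAt]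
    rw [this, add_mul]
    exact (norm_add_le _ _).trans (add_le_add (hP x) (hQ x))
  | mul_X P i hP =>
    intro ε hε
    obtain ⟨K, hK, hP⟩ := hP (ε / 2) (by positivity)
    refine ⟨K * (1 + 2 / ε), by positivity, fun x => ?_⟩
    have : evalAt a (P * MvPolynomial.X i) x = evalAt a P x * ((x i - a i : ℝ) : ℂ) := by
      simp [evalAt]
    rw [this, norm_mul]
    have h1 : ‖((x i - a i : ℝ) : ℂ)‖ ≤ ‖x - a‖ := by
      rw [Complex.norm_real]; exact PiLp.norm_apply_le (x - a) i
    have h2 : ‖x - a‖ ≤ (1 + 2 / ε) * Real.exp (ε / 2 * ‖x - a‖ ^ 2) := by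
      have h3 := Real.add_one_le_exp (ε / 2 * ‖x - a‖ ^ 2)
      have h4 : (1 + 2 / ε) * (ε / 2 * ‖x - a‖ ^ 2 + 1) ≤
        (1 + 2 / ε) * Real.exp (ε / 2 * ‖x - a‖ ^ 2) := by gcongr
      refine le_trans ?_ h4
      have h5 : (1 + 2 / ε) * (ε / 2 * ‖x - a‖ ^ 2 + 1) =
          ε / 2 * ‖x - a‖ ^ 2 + ‖x - a‖ ^ 2 + 1 + 2 / ε := by field_simp; ring
      rw [h5]
      have : 0 < 2 / ε := by positivity
      have : 0 ≤ ε / 2 * ‖x - a‖ ^ 2 := by positivity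
      nlinarith [sq_nonneg (‖x - a‖ - 1)]
    calc ‖evalAt a P x‖ * ‖((x i - a i : ℝ) : ℂ)‖
        ≤ (K * Real.exp (ε / 2 * ‖x - a‖ ^ 2)) * ((1 + 2 / ε) * Real.exp (ε / 2 * ‖x - a‖ ^ 2)) :=
          mul_le_mul (hP x) (h1.trans h2) (norm_nonneg _) (by positivity)
      _ = K * (1 + 2 / ε) * (Real.exp (ε / 2 * ‖x - a‖ ^ 2) * Real.exp (ε / 2 * ‖x - a‖ ^ 2)) := by
          ring
      _ = _ := by rw [← Real.exp_add]; ring_nf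

end RealGaussian

/-! ### Modulus, integrability and normalization of the Gaussian. -/

namespace Packet

open MvPolynomial

variable {d : ℕ} (p : Packet d) (ħ : ℝ)

/-- The real part of `B A⁻¹`: the quadratic form in the modulus of the Gaussian. -/
def precision : Matrix (Fin d) (Fin d) ℝ := Matrix.of fun j k => ((p.B * p.A⁻¹) j k).re

variable {p ħ}

theorem conj_exponent (hp : Admissible p.A p.B) (j k : Fin d) :
    (p.B * p.A⁻¹) j k + conj ((p.B * p.A⁻¹) j k) = 2 * ((p.A⁻¹)ᴴ * p.A⁻¹) j k := by
  have h := congrFun (congrFun hp.exponent_add_conjTranspose j) k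
  have h2 : (p.B * p.A⁻¹)ᴴ j k = conj ((p.B * p.A⁻¹) j k) := by
    rw [conjTranspose_apply, Complex.star_def]
    congr 1
    exact congrFun (congrFun hp.transpose_exponent j) k
  rw [Matrix.add_apply, h2] at h
  exact h

theorem precision_apply (hp : Admissible p.A p.B) (j k : Fin d) :
    (p.precision j k : ℂ) = ((p.A⁻¹)ᴴ * p.A⁻¹) j k := by
  have h := conj_exponent hp j k
  rw [Complex.add_conj] at h
  have h2 : (2 : ℂ) * (((p.B * p.A⁻¹) j k).re : ℂ) = 2 * ((p.A⁻¹)ᴴ * p.A⁻¹) j k := by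
    rw [← h]; push_cast; ring
  exact mul_left_cancel₀ two_ne_zero h2

/-- With A⁻¹ = R + iS, R and S real, the real matrix (A⁻¹)*A⁻¹ equals RᵀR + SᵀS, hence is positive
semidefinite and has a real factor C. Taking determinants gives |det C| = |det A⁻¹|, which is
exactly what normalizes φ₀. -/
theorem exists_precision_eq (hp : Admissible p.A p.B) :
    ∃ C : Matrix (Fin d) (Fin d) ℝ, p.precision = Cᵀ * C ∧ |C.det| * ‖p.A.det‖ = 1 := by
  have hpos : p.precision.PosSemidef := by
    have h : p.precision = (p.A⁻¹.map Complex.re)ᴴ * p.A⁻¹.map Complex.re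
        + (p.A⁻¹.map Complex.im)ᴴ * p.A⁻¹.map Complex.im := by
      ext j k
      rw [← Complex.ofReal_re (p.precision j k), precision_apply hp, Matrix.add_apply, mul_apply,
        mul_apply, mul_apply, Complex.re_sum, ← Finset.sum_add_distrib]
      exact Finset.sum_congr rfl fun n _ => by simp [conjTranspose_apply]
    rw [h]
    exact (posSemidef_conjTranspose_mul_self _).add (posSemidef_conjTranspose_mul_self _)
  obtain ⟨C, hC⟩ := exists_eq_transpose_mul_self hpos
  refine ⟨C, hC, ?_⟩
  have h1 : ((p.precision.det : ℝ) : ℂ) = conj (p.A⁻¹.det) * p.A⁻¹.det := by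
    have h2 : p.precision.map Complex.ofRealHom = (p.A⁻¹)ᴴ * p.A⁻¹ := by
      ext j k; exact precision_apply hp j k
    have h3 := Complex.ofRealHom.map_det p.precision
    rw [RingHom.mapMatrix_apply, h2, det_mul, det_conjTranspose] at h3
    exact h3
  rw [Complex.conj_mul', hC, det_mul, det_transpose] at h1
  have h4 : C.det * C.det = ‖p.A⁻¹.det‖ ^ 2 := by exact_mod_cast h1
  have h5 : |C.det| = ‖p.A⁻¹.det‖ := by
    rw [← abs_norm, ← sq_eq_sq_iff_abs_eq_abs, ← h4, sq]
  rw [h5, ← norm_mul, ← det_mul, hp.inv_mul, det_one, norm_one]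

theorem dotProduct_precision {C : Matrix (Fin d) (Fin d) ℝ} (hC : p.precision = Cᵀ * C)
    (y : EuclideanSpace ℝ (Fin d)) :
    ∑ j, ∑ k, y j * p.precision j k * y k = ‖Matrix.toEuclideanLin C y‖ ^ 2 := by
  have h1 : ‖Matrix.toEuclideanLin C y‖ ^ 2 = (C *ᵥ y.ofLp) ⬝ᵥ (C *ᵥ y.ofLp) := by
    rw [EuclideanSpace.norm_sq_eq]
    simp [dotProduct, Matrix.toLpLin_apply, sq]
  rw [h1, dotProduct_mulVec, vecMul_mulVec, ← hC]
  simp only [vecMul, dotProduct, Finset.sum_mul]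
  rw [Finset.sum_comm]

theorem norm_gaussian_sq (hħ : 0 < ħ) (hdet : p.sqrtDet ^ 2 = p.A.det)
    {C : Matrix (Fin d) (Fin d) ℝ} (hC : p.precision = Cᵀ * C) (x : EuclideanSpace ℝ (Fin d)) :
    ‖p.gaussian ħ x‖ ^ 2 = (Real.pi * ħ) ^ (-(d : ℝ) / 2) * ‖p.A.det‖⁻¹ *
      Real.exp (-(1 / ħ) * ‖Matrix.toEuclideanLin C (x - p.a)‖ ^ 2) := by
  have hre : (-((fun i => ((x i - p.a i : ℝ) : ℂ)) ⬝ᵥ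
      ((p.B * p.A⁻¹) *ᵥ fun i => ((x i - p.a i : ℝ) : ℂ))) / (2 * (ħ : ℂ))
      + I * (∑ i, (p.η i : ℂ) * ((x i - p.a i : ℝ) : ℂ)) / (ħ : ℂ)).re =
      -(‖Matrix.toEuclideanLin C (x - p.a)‖ ^ 2) / (2 * ħ) := by
    have e1 : (I * (∑ i, (p.η i : ℂ) * ((x i - p.a i : ℝ) : ℂ)) / (ħ : ℂ)).re = 0 := by
      rw [Complex.div_ofReal_re, show (∑ i, (p.η i : ℂ) * ((x i - p.a i : ℝ) : ℂ)) =
        ((∑ i, p.η i * (x i - p.a i) : ℝ) : ℂ) by push_cast; rfl]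
      simp
    have e2 : ((fun i => ((x i - p.a i : ℝ) : ℂ)) ⬝ᵥ
        ((p.B * p.A⁻¹) *ᵥ fun i => ((x i - p.a i : ℝ) : ℂ))).re =
        ‖Matrix.toEuclideanLin C (x - p.a)‖ ^ 2 := by
      rw [← dotProduct_precision hC]
      simp only [dotProduct, mulVec, Complex.re_sum, Finset.mul_sum]
      refine Finset.sum_congr rfl fun j _ => Finset.sum_congr rfl fun k _ => ?_
      rw [Complex.re_ofReal_mul, Complex.re_mul_ofReal, precision]
      simp [mul_assoc]
    rw [Complex.add_re, e1, add_zero, show (2 * (ħ : ℂ)) = ((2 * ħ : ℝ) : ℂ) by push_cast; rfl,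
      Complex.div_ofReal_re, Complex.neg_re, e2]
  have hd : ‖p.sqrtDet‖ ^ 2 = ‖p.A.det‖ := by rw [← norm_pow, hdet]
  unfold gaussian
  simp only
  rw [norm_mul, norm_mul, Complex.norm_exp, hre, Complex.norm_real, norm_inv, mul_pow, mul_pow,
    inv_pow, hd, ← Real.exp_nat_mul, Real.norm_eq_abs, sq_abs, mul_pow,
    ← Real.rpow_natCast, ← Real.rpow_mul Real.pi_pos.le, ← Real.rpow_natCast,
    ← Real.rpow_mul hħ.le, Real.mul_rpow Real.pi_pos.le hħ.le]
  congr 2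
  · congr 2 <;> · push_cast; ring
  · push_cast; field_simp

theorem integrable_evalAt_mul_density (hp : Admissible p.A p.B) (hħ : 0 < ħ)
    (hdet : p.sqrtDet ^ 2 = p.A.det) (P : MvPolynomial (Fin d) ℂ) :
    Integrable fun x => evalAt p.a P x * (conj (p.gaussian ħ x) * p.gaussian ħ x) := by
  obtain ⟨C, hC, hCA⟩ := exists_precision_eq hp
  have hC0 : C.det ≠ 0 := by rintro h; simp [h] at hCA
  obtain ⟨K, hK, hKC⟩ := exists_norm_le_mul_norm hC0
  -- The density decays at least at rate 1/(ħK²), twice this ε: one half absorbs the polynomial, the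
  -- other remains integrable.
  have hε : 0 < 1 / (2 * ħ * K ^ 2) := by positivity
  obtain ⟨M, hM, hP⟩ := exists_norm_evalAt_le p.a P _ hε
  have hcont : Continuous (p.gaussian ħ) := (p.differentiable_gaussian ħ).continuous
  refine ((integrable_exp_neg_norm_sub_sq hε p.a).const_mul
    (M * ((Real.pi * ħ) ^ (-(d : ℝ) / 2) * ‖p.A.det‖⁻¹))).mono'
    (((continuous_evalAt _ _).mul
      ((Complex.continuous_conj.comp hcont).mul hcont)).aestronglyMeasurable)
    (Filter.Eventually.of_forall fun x => ?_)
  have hc0 : 0 ≤ (Real.pi * ħ) ^ (-(d : ℝ) / 2) * ‖p.A.det‖⁻¹ := by positivity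
  rw [norm_mul, Complex.conj_mul', ← Complex.ofReal_pow, Complex.norm_real, Real.norm_eq_abs,
    abs_of_nonneg (by positivity), norm_gaussian_sq hħ hdet hC]
  have h1 : -(1 / ħ) * ‖Matrix.toEuclideanLin C (x - p.a)‖ ^ 2 ≤
      -(2 * (1 / (2 * ħ * K ^ 2))) * ‖x - p.a‖ ^ 2 := by
    have h2 : ‖x - p.a‖ ^ 2 ≤ K ^ 2 * ‖Matrix.toEuclideanLin C (x - p.a)‖ ^ 2 := by
      rw [← mul_pow]; gcongr; exact hKC _
    have h3 : 2 * (1 / (2 * ħ * K ^ 2)) * ‖x - p.a‖ ^ 2 ≤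
        2 * (1 / (2 * ħ * K ^ 2)) * (K ^ 2 * ‖Matrix.toEuclideanLin C (x - p.a)‖ ^ 2) := by
      gcongr
    have h4 : 2 * (1 / (2 * ħ * K ^ 2)) * (K ^ 2 * ‖Matrix.toEuclideanLin C (x - p.a)‖ ^ 2) =
        1 / ħ * ‖Matrix.toEuclideanLin C (x - p.a)‖ ^ 2 := by field_simp
    linarith
  calc _ ≤ (M * Real.exp (1 / (2 * ħ * K ^ 2) * ‖x - p.a‖ ^ 2)) *
        ((Real.pi * ħ) ^ (-(d : ℝ) / 2) * ‖p.A.det‖⁻¹ *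
          Real.exp (-(2 * (1 / (2 * ħ * K ^ 2))) * ‖x - p.a‖ ^ 2)) := by
        gcongr
        exact hP x
    _ = M * ((Real.pi * ħ) ^ (-(d : ℝ) / 2) * ‖p.A.det‖⁻¹) *
        (Real.exp (1 / (2 * ħ * K ^ 2) * ‖x - p.a‖ ^ 2) *
          Real.exp (-(2 * (1 / (2 * ħ * K ^ 2))) * ‖x - p.a‖ ^ 2)) := by ring
    _ = _ := by rw [← Real.exp_add]; ring_nf

theorem integral_density (hp : Admissible p.A p.B) (hħ : 0 < ħ)
    (hdet : p.sqrtDet ^ 2 = p.A.det) :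
    ∫ x, conj (p.gaussian ħ x) * p.gaussian ħ x = 1 := by
  obtain ⟨C, hC, hCA⟩ := exists_precision_eq hp
  have hC0 : C.det ≠ 0 := by rintro h; simp [h] at hCA
  have hA0 : ‖p.A.det‖ ≠ 0 := by rintro h; simp [h] at hCA
  have h1 : ∀ x, conj (p.gaussian ħ x) * p.gaussian ħ x =
      (((Real.pi * ħ) ^ (-(d : ℝ) / 2) * ‖p.A.det‖⁻¹ *
      Real.exp (-(1 / ħ) * ‖Matrix.toEuclideanLin C (x - p.a)‖ ^ 2) : ℝ) : ℂ) := fun x => by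
    rw [Complex.conj_mul', ← Complex.ofReal_pow, norm_gaussian_sq hħ hdet hC]
  simp only [h1]
  rw [integral_complex_ofReal, integral_const_mul, integral_exp_neg_norm_sq_linear hC0 (by positivity)]
  rw [div_div_eq_mul_div, div_one, neg_div, Real.rpow_neg (by positivity)]
  have h2 : (Real.pi * ħ) ^ ((d : ℝ) / 2) ≠ 0 := by positivity
  have h3 : ((Real.pi * ħ) ^ ((d : ℝ) / 2))⁻¹ * ‖p.A.det‖⁻¹ *
      (|C.det|⁻¹ * (Real.pi * ħ) ^ ((d : ℝ) / 2)) = (|C.det| * ‖p.A.det‖)⁻¹ := by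
    field_simp
  rw [h3, hCA]; simp

end Packet

/-! ### Orthonormality of the states by integration by parts. -/

namespace Packet

open MvPolynomial

variable {d : ℕ} {p : Packet d} {ħ : ℝ}

/-- The integral of `P(x - a)` against the probability density `|φ₀|²`. -/
def gaussMean (p : Packet d) (ħ : ℝ) (P : MvPolynomial (Fin d) ℂ) : ℂ :=
  ∫ x, evalAt p.a P x * (conj (p.gaussian ħ x) * p.gaussian ħ x)

theorem evalAt_add (a : EuclideanSpace ℝ (Fin d)) (P Q : MvPolynomial (Fin d) ℂ)
    (x : EuclideanSpace ℝ (Fin d)) : evalAt a (P + Q) x = evalAt a P x + evalAt a Q x := by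
  simp [evalAt]

theorem evalAt_C_mul (a : EuclideanSpace ℝ (Fin d)) (c : ℂ) (P : MvPolynomial (Fin d) ℂ)
    (x : EuclideanSpace ℝ (Fin d)) : evalAt a (C c * P) x = c * evalAt a P x := by
  simp [evalAt]

theorem evalAt_mul (a : EuclideanSpace ℝ (Fin d)) (P Q : MvPolynomial (Fin d) ℂ)
    (x : EuclideanSpace ℝ (Fin d)) : evalAt a (P * Q) x = evalAt a P x * evalAt a Q x := by
  simp [evalAt]

theorem gaussMean_add (hp : Admissible p.A p.B) (hħ : 0 < ħ) (hdet : p.sqrtDet ^ 2 = p.A.det)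
    (P Q : MvPolynomial (Fin d) ℂ) :
    p.gaussMean ħ (P + Q) = p.gaussMean ħ P + p.gaussMean ħ Q := by
  unfold gaussMean
  rw [← integral_add (integrable_evalAt_mul_density hp hħ hdet P)
    (integrable_evalAt_mul_density hp hħ hdet Q)]
  congr 1; funext x
  rw [evalAt_add, add_mul]

theorem gaussMean_C_mul (c : ℂ) (P : MvPolynomial (Fin d) ℂ) :
    p.gaussMean ħ (C c * P) = c * p.gaussMean ħ P := by
  unfold gaussMean
  rw [← integral_const_mul]
  congr 1; funext x
  rw [evalAt_C_mul, mul_assoc]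

theorem gaussMean_one (hp : Admissible p.A p.B) (hħ : 0 < ħ) (hdet : p.sqrtDet ^ 2 = p.A.det) :
    p.gaussMean ħ 1 = 1 := by
  simpa [gaussMean, evalAt] using integral_density hp hħ hdet

theorem gaussMean_sum (hp : Admissible p.A p.B) (hħ : 0 < ħ) (hdet : p.sqrtDet ^ 2 = p.A.det)
    {ι : Type*} (s : Finset ι) (f : ι → MvPolynomial (Fin d) ℂ) :
    p.gaussMean ħ (∑ i ∈ s, f i) = ∑ i ∈ s, p.gaussMean ħ (f i) := by
  classical
  induction s using Finset.induction_on with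
  | empty =>
    have := gaussMean_C_mul (p := p) (ħ := ħ) 0 0
    simpa using this
  | insert i s hi ih => rw [Finset.sum_insert hi, Finset.sum_insert hi, gaussMean_add hp hħ hdet, ih]

theorem pderiv_conj {f : EuclideanSpace ℝ (Fin d) → ℂ} {x : EuclideanSpace ℝ (Fin d)}
    (hf : DifferentiableAt ℝ f x) (n : Fin d) :
    pderiv n (fun y => conj (f y)) x = conj (pderiv n f x) := by
  have h := (Complex.conjCLE : ℂ →L[ℝ] ℂ).hasFDerivAt.comp x hf.hasFDerivAt
  have h2 : fderiv ℝ (fun y => conj (f y)) x = _ := h.fderiv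
  rw [pderiv, h2]
  simp [pderiv]

theorem pderiv_density (hp : Admissible p.A p.B) (n : Fin d) (x : EuclideanSpace ℝ (Fin d)) :
    pderiv n (fun x => conj (p.gaussian ħ x) * p.gaussian ħ x) x =
      -(2 / ħ) * (∑ k, ((p.A⁻¹)ᴴ * p.A⁻¹) n k * ((x k - p.a k : ℝ) : ℂ)) *
        (conj (p.gaussian ħ x) * p.gaussian ħ x) := by
  have hd : DifferentiableAt ℝ (p.gaussian ħ) x := p.differentiable_gaussian ħ x
  have hdc : DifferentiableAt ℝ (fun y => conj (p.gaussian ħ y)) x :=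
    ((Complex.conjCLE : ℂ →L[ℝ] ℂ).hasFDerivAt.comp x hd.hasFDerivAt).differentiableAt
  rw [pderiv_mul hdc hd, pderiv_conj hd, p.pderiv_gaussian ħ hp]
  have h : 2 * ∑ k, ((p.A⁻¹)ᴴ * p.A⁻¹) n k * ((x k - p.a k : ℝ) : ℂ) =
      (∑ k, (p.B * p.A⁻¹) n k * ((x k - p.a k : ℝ) : ℂ)) +
        ∑ k, conj ((p.B * p.A⁻¹) n k) * ((x k - p.a k : ℝ) : ℂ) := by
    rw [← Finset.sum_add_distrib, Finset.mul_sum]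
    refine Finset.sum_congr rfl fun k _ => ?_
    rw [← add_mul, conj_exponent hp, mul_assoc]
  simp only [map_mul, map_div₀, map_add, map_neg, map_sum, Complex.conj_ofReal, Complex.conj_I]
  linear_combination (1 / ħ * (conj (p.gaussian ħ x) * p.gaussian ħ x)) * h

/-- Integration by parts against the Gaussian density. -/
theorem gaussMean_pderiv (hp : Admissible p.A p.B) (hħ : 0 < ħ) (hdet : p.sqrtDet ^ 2 = p.A.det)
    (n : Fin d) (P : MvPolynomial (Fin d) ℂ) :
    p.gaussMean ħ (MvPolynomial.pderiv n P) =
      2 / ħ * p.gaussMean ħ (linForm (fun k => ((p.A⁻¹)ᴴ * p.A⁻¹) n k) * P) := by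
  set g : EuclideanSpace ℝ (Fin d) → ℂ := fun x => conj (p.gaussian ħ x) * p.gaussian ħ x with hg
  set v : EuclideanSpace ℝ (Fin d) := EuclideanSpace.single n 1 with hv
  have hgd : Differentiable ℝ g := by
    intro x
    have hd : DifferentiableAt ℝ (p.gaussian ħ) x := p.differentiable_gaussian ħ x
    have hdc : DifferentiableAt ℝ (fun y => conj (p.gaussian ħ y)) x :=
      ((Complex.conjCLE : ℂ →L[ℝ] ℂ).hasFDerivAt.comp x hd.hasFDerivAt).differentiableAt
    exact hdc.mul hd
  have e1 : ∀ x, fderiv ℝ (evalAt p.a P) x v = evalAt p.a (MvPolynomial.pderiv n P) x :=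
    pderiv_evalAt p.a P n
  have e2 : ∀ x, evalAt p.a P x * fderiv ℝ g x v =
      -(2 / ħ) * (evalAt p.a (linForm (fun k => ((p.A⁻¹)ᴴ * p.A⁻¹) n k) * P) x * g x) := by
    intro x
    have h := pderiv_density (ħ := ħ) hp n x
    rw [pderiv] at h
    rw [hg, hv, h, evalAt_mul, evalAt_linForm]
    ring
  have hI := integral_mul_fderiv_eq_neg_fderiv_mul_of_integrable (μ := volume) (𝕜 := ℂ)
    (f := evalAt p.a P) (g := g) (v := v)
    (by simp only [e1]; exact integrable_evalAt_mul_density hp hħ hdet _)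
    (by simp only [e2]; exact (integrable_evalAt_mul_density hp hħ hdet _).const_mul _)
    (integrable_evalAt_mul_density hp hħ hdet P)
    (fun x _ => differentiable_evalAt _ _ x) (fun x _ => hgd x)
  simp only [e1, e2] at hI
  rw [integral_const_mul] at hI
  change ∫ x, evalAt p.a (MvPolynomial.pderiv n P) x * g x = 2 / ħ *
    ∫ x, evalAt p.a (linForm (fun k => ((p.A⁻¹)ᴴ * p.A⁻¹) n k) * P) x * g x
  linear_combination hI

/-- The polynomial with conjugated coefficients. -/
def conjPoly (P : MvPolynomial (Fin d) ℂ) : MvPolynomial (Fin d) ℂ :=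
  MvPolynomial.map (starRingEnd ℂ) P

theorem evalAt_conjPoly (a : EuclideanSpace ℝ (Fin d)) (P : MvPolynomial (Fin d) ℂ)
    (x : EuclideanSpace ℝ (Fin d)) : evalAt a (conjPoly P) x = conj (evalAt a P x) := by
  unfold evalAt conjPoly
  rw [MvPolynomial.map_eval]
  congr 2
  funext i
  simp

theorem conj_wave_mul_wave (P Q : MvPolynomial (Fin d) ℂ) (x : EuclideanSpace ℝ (Fin d)) :
    conj (p.wave ħ P x) * p.wave ħ Q x =
      evalAt p.a (conjPoly P * Q) x * (conj (p.gaussian ħ x) * p.gaussian ħ x) := by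
  rw [evalAt_mul, evalAt_conjPoly, wave, wave, map_mul]; ring

theorem integral_conj_wave_mul_wave (P Q : MvPolynomial (Fin d) ℂ) :
    ∫ x, conj (p.wave ħ P x) * p.wave ħ Q x = p.gaussMean ħ (conjPoly P * Q) := by
  simp only [conj_wave_mul_wave, gaussMean]

theorem conjPoly_dirDeriv (v : Fin d → ℂ) (P : MvPolynomial (Fin d) ℂ) :
    conjPoly (dirDeriv v P) = dirDeriv (fun n => conj (v n)) (conjPoly P) := by
  simp [dirDeriv_eq_sum, conjPoly, MvPolynomial.pderiv_map]

/-- Contracting the integration by parts with a column of the conjugate of A turns (A⁻¹)*A⁻¹ into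
A⁻¹, the linear form of the raising operator. -/
theorem gaussMean_dirDeriv (hp : Admissible p.A p.B) (hħ : 0 < ħ)
    (hdet : p.sqrtDet ^ 2 = p.A.det) (m : Fin d) (P : MvPolynomial (Fin d) ℂ) :
    p.gaussMean ħ (dirDeriv (fun n => conj (p.A n m)) P) =
      2 / ħ * p.gaussMean ħ (linForm (fun k => p.A⁻¹ m k) * P) := by
  have h3 : p.Aᴴ * (p.A⁻¹)ᴴ = 1 := by rw [← conjTranspose_mul, hp.inv_mul, conjTranspose_one]
  have h4 : p.Aᴴ * ((p.A⁻¹)ᴴ * p.A⁻¹) = p.A⁻¹ := by rw [← Matrix.mul_assoc, h3, Matrix.one_mul]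
  have h5 : ∑ n, C (conj (p.A n m)) * linForm (fun k => ((p.A⁻¹)ᴴ * p.A⁻¹) n k) =
      linForm fun k => p.A⁻¹ m k := by
    simp only [linForm, Finset.mul_sum]
    rw [Finset.sum_comm]
    refine Finset.sum_congr rfl fun k _ => ?_
    conv_rhs => rw [← h4, mul_apply, map_sum, Finset.sum_mul]
    refine Finset.sum_congr rfl fun n _ => ?_
    rw [← mul_assoc, ← C_mul]
    rfl
  rw [dirDeriv_eq_sum, gaussMean_sum hp hħ hdet, ← h5, Finset.sum_mul, gaussMean_sum hp hħ hdet,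
    Finset.mul_sum]
  refine Finset.sum_congr rfl fun n _ => ?_
  rw [gaussMean_C_mul, gaussMean_pderiv hp hħ hdet, mul_assoc (C _), gaussMean_C_mul]
  ring

/-- Adjointness: completing the derivative of Q to a total derivative of the product, its mean
cancels the multiplication term exactly. What survives is the derivative of the conjugate of P, that
is, the conjugate of the lowered P. -/
theorem gaussMean_conj_mul_raisePoly (hp : Admissible p.A p.B) (hħ : 0 < ħ)
    (hdet : p.sqrtDet ^ 2 = p.A.det) (m : Fin d) (P Q : MvPolynomial (Fin d) ℂ) :
    p.gaussMean ħ (conjPoly P * p.raisePoly ħ m Q) =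
      p.gaussMean ħ (conjPoly (p.lowerPoly ħ m P) * Q) := by
  set D := dirDeriv fun n => conj (p.A n m) with hD
  set ℓ := linForm fun k => p.A⁻¹ m k with hℓ
  set r : ℂ := ((1 / Real.sqrt (2 * ħ) : ℝ) : ℂ) with hr
  have h1 : conjPoly P * p.raisePoly ħ m Q =
      C (r * 2) * (ℓ * (conjPoly P * Q)) + (C (-(r * ħ)) * D (conjPoly P * Q)
        + C (r * ħ) * (D (conjPoly P) * Q)) := by
    rw [raisePoly_apply, Derivation.leibniz]
    simp only [MvPolynomial.smul_eq_C_mul, smul_eq_mul, C_mul, C_neg, map_ofNat]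
    ring
  have hrħ : r * ħ = ((Real.sqrt (ħ / 2) : ℝ) : ℂ) := by
    rw [hr, ← Complex.ofReal_mul]
    congr 1
    have h2 : Real.sqrt (2 * ħ) = 2 * Real.sqrt (ħ / 2) := by
      rw [show 2 * ħ = 2 ^ 2 * (ħ / 2) by ring, Real.sqrt_mul (by norm_num),
        Real.sqrt_sq (by norm_num)]
    have h3 : Real.sqrt (ħ / 2) * Real.sqrt (ħ / 2) = ħ / 2 := Real.mul_self_sqrt (by positivity)
    have h4 : 0 < Real.sqrt (ħ / 2) := by positivity
    rw [h2]
    field_simp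
    linarith [h3]
  have h2 : conjPoly (p.lowerPoly ħ m P) * Q = C (r * ħ) * (D (conjPoly P) * Q) := by
    have h3 := conjPoly_dirDeriv (fun n => p.A n m) P
    rw [hrħ, lowerPoly_apply, hD, ← h3]
    simp [conjPoly, MvPolynomial.smul_eq_C_mul, mul_assoc]
  have hħ' : (ħ : ℂ) ≠ 0 := by exact_mod_cast hħ.ne'
  rw [h1, h2, gaussMean_add hp hħ hdet, gaussMean_add hp hħ hdet, gaussMean_C_mul,
    gaussMean_C_mul, gaussMean_C_mul, gaussMean_dirDeriv hp hħ hdet]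
  field_simp
  ring

/-- Raising operators on the right factor are moved one at a time to the left, where they lower j;
the factors j_i so produced multiply to j!. -/
theorem gaussMean_hermitePoly (hp : Admissible p.A p.B) (hħ : 0 < ħ)
    (hdet : p.sqrtDet ^ 2 = p.A.det) (j k : MultiIndex d) :
    p.gaussMean ħ (conjPoly (p.hermitePoly ħ j) * p.hermitePoly ħ k) =
      if j = k then (multiFactorial j : ℂ) else 0 := by
  induction k using multiIndex_induction generalizing j with
  | zero =>
    induction j using multiIndex_induction with
    | zero =>
      simp [hermitePoly_zero, conjPoly, gaussMean_one hp hħ hdet, multiFactorial]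
    | add_single j i _ =>
      have hne : j + Pi.single i 1 ≠ 0 := by
        intro h
        have := order_add_single j i
        rw [h, order_zero] at this
        omega
      rw [if_neg hne]
      have h1 := gaussMean_conj_mul_raisePoly hp hħ hdet i 1 (p.hermitePoly ħ j)
      have h2 : p.lowerPoly ħ i 1 = 0 := by
        rw [lowerPoly_apply, Derivation.map_one_eq_zero, smul_zero]
      rw [h2, ← hermitePoly_add_single hp] at h1
      have h3 : p.gaussMean ħ (conjPoly 0 * p.hermitePoly ħ j) = 0 := by
        simp [conjPoly, gaussMean, evalAt]
      rw [h3] at h1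
      -- With k = 0 the raising operator sits in the conjugated factor; conjugating the integral
      -- brings it to the right, where its adjoint meets and kills 1.
      have h4 : p.gaussMean ħ (conjPoly (p.hermitePoly ħ (j + Pi.single i 1)) * 1) =
          conj (p.gaussMean ħ (conjPoly 1 * p.hermitePoly ħ (j + Pi.single i 1))) := by
        rw [← integral_conj_wave_mul_wave, ← integral_conj_wave_mul_wave, ← integral_conj]
        congr 1; funext x
        simp [mul_comm]
      rw [hermitePoly_zero, h4, h1, map_zero]
  | add_single k i ih =>
    rw [hermitePoly_add_single hp, gaussMean_conj_mul_raisePoly hp hħ hdet,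
      lowerPoly_hermitePoly hp hħ]
    have h1 : conjPoly ((j i : ℂ) • p.hermitePoly ħ (j - Pi.single i 1)) * p.hermitePoly ħ k =
        C (j i : ℂ) * (conjPoly (p.hermitePoly ħ (j - Pi.single i 1)) * p.hermitePoly ħ k) := by
      simp [conjPoly, MvPolynomial.smul_eq_C_mul, mul_assoc]
    rw [h1, gaussMean_C_mul, ih]
    by_cases hji : j i = 0
    · have hne : j ≠ k + Pi.single i 1 := by rintro rfl; simp at hji
      simp [hji, hne]
    · have hiff : j - Pi.single i 1 = k ↔ j = k + Pi.single i 1 := by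
        constructor
        · rintro rfl; exact (sub_single_add_single hji).symm
        · rintro rfl; funext n; simp
      by_cases hjk : j = k + Pi.single i 1
      · rw [if_pos (hiff.2 hjk), if_pos hjk, hiff.2 hjk, hjk, multiFactorial_add_single]
        simp
      · rw [if_neg (mt hiff.1 hjk), if_neg hjk, mul_zero]

/-- The states `φ_j` are orthonormal. -/
theorem integral_conj_state_mul_state (hp : Admissible p.A p.B) (hħ : 0 < ħ)
    (hdet : p.sqrtDet ^ 2 = p.A.det) (j k : MultiIndex d) :
    ∫ x, conj (p.wave ħ (p.statePoly ħ j) x) * p.wave ħ (p.statePoly ħ k) x =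
      if j = k then 1 else 0 := by
  simp only [statePoly, wave_smul, map_mul, Complex.conj_ofReal]
  have h1 : ∀ x, ((1 / Real.sqrt (multiFactorial j : ℝ) : ℝ) : ℂ) *
      conj (p.wave ħ (p.hermitePoly ħ j) x) *
      (((1 / Real.sqrt (multiFactorial k : ℝ) : ℝ) : ℂ) * p.wave ħ (p.hermitePoly ħ k) x) =
      (((1 / Real.sqrt (multiFactorial j : ℝ) : ℝ) : ℂ) *
        ((1 / Real.sqrt (multiFactorial k : ℝ) : ℝ) : ℂ)) *
        (conj (p.wave ħ (p.hermitePoly ħ j) x) * p.wave ħ (p.hermitePoly ħ k) x) := fun x => by ring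
  simp only [h1]
  rw [integral_const_mul, integral_conj_wave_mul_wave, gaussMean_hermitePoly hp hħ hdet]
  split_ifs with h
  · subst h
    have h2 : (0 : ℝ) < multiFactorial j := by exact_mod_cast multiFactorial_pos j
    rw [← Complex.ofReal_natCast, ← Complex.ofReal_mul, ← Complex.ofReal_mul]
    have h3 : Real.sqrt (multiFactorial j : ℝ) * Real.sqrt (multiFactorial j) = multiFactorial j :=
      Real.mul_self_sqrt h2.le
    have h4 : 0 < Real.sqrt (multiFactorial j : ℝ) := by positivity
    have h5 : 1 / Real.sqrt (multiFactorial j : ℝ) * (1 / Real.sqrt (multiFactorial j : ℝ)) *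
        multiFactorial j = 1 := by
      rw [div_mul_div_comm, h3]; field_simp
    rw [h5, Complex.ofReal_one]
  · ring

theorem integrable_conj_wave_mul_wave (hp : Admissible p.A p.B) (hħ : 0 < ħ)
    (hdet : p.sqrtDet ^ 2 = p.A.det) (P Q : MvPolynomial (Fin d) ℂ) :
    Integrable fun x => conj (p.wave ħ P x) * p.wave ħ Q x := by
  simp only [conj_wave_mul_wave]
  exact integrable_evalAt_mul_density hp hħ hdet _

theorem integrable_norm_wave_sq (hp : Admissible p.A p.B) (hħ : 0 < ħ)
    (hdet : p.sqrtDet ^ 2 = p.A.det) (P : MvPolynomial (Fin d) ℂ) :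
    Integrable fun x => ‖p.wave ħ P x‖ ^ 2 := by
  have h := (integrable_conj_wave_mul_wave hp hħ hdet P P).re
  refine h.congr (Filter.Eventually.of_forall fun x => ?_)
  simp only [Complex.conj_mul']
  rw [← Complex.ofReal_pow]
  exact Complex.ofReal_re _

theorem integral_conj_state_mul_sum (hp : Admissible p.A p.B) (hħ : 0 < ħ)
    (hdet : p.sqrtDet ^ 2 = p.A.det) (s : Finset (MultiIndex d)) (c : MultiIndex d → ℂ)
    (j : MultiIndex d) :
    ∫ x, conj (p.wave ħ (p.statePoly ħ j) x) * p.wave ħ (∑ k ∈ s, c k • p.statePoly ħ k) x =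
      if j ∈ s then c j else 0 := by
  have h1 : ∀ x, conj (p.wave ħ (p.statePoly ħ j) x) *
      p.wave ħ (∑ k ∈ s, c k • p.statePoly ħ k) x =
      ∑ k ∈ s, c k * (conj (p.wave ħ (p.statePoly ħ j) x) * p.wave ħ (p.statePoly ħ k) x) := by
    intro x
    rw [wave_sum, Finset.mul_sum]
    exact Finset.sum_congr rfl fun k _ => by rw [wave_smul]; ring
  simp only [h1]
  rw [integral_finsetSum _ fun k _ =>
    (integrable_conj_wave_mul_wave hp hħ hdet _ _).const_mul _]
  simp only [integral_const_mul, integral_conj_state_mul_state hp hħ hdet]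
  simp

theorem integral_norm_wave_sq (hp : Admissible p.A p.B) (hħ : 0 < ħ)
    (hdet : p.sqrtDet ^ 2 = p.A.det) (s : Finset (MultiIndex d)) (c : MultiIndex d → ℂ) :
    ∫ x, ‖p.wave ħ (∑ k ∈ s, c k • p.statePoly ħ k) x‖ ^ 2 = ∑ k ∈ s, ‖c k‖ ^ 2 := by
  set P := ∑ k ∈ s, c k • p.statePoly ħ k with hP
  have h1 : ((∫ x, ‖p.wave ħ P x‖ ^ 2 : ℝ) : ℂ) = ∫ x, conj (p.wave ħ P x) * p.wave ħ P x := by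
    rw [← integral_complex_ofReal]
    congr 1; funext x
    rw [Complex.conj_mul', Complex.ofReal_pow]
  have h2 : ∀ x, conj (p.wave ħ P x) * p.wave ħ P x =
      ∑ k ∈ s, conj (c k) * (conj (p.wave ħ (p.statePoly ħ k) x) * p.wave ħ P x) := by
    intro x
    have h : conj (p.wave ħ P x) =
        ∑ k ∈ s, conj (c k) * conj (p.wave ħ (p.statePoly ħ k) x) := by
      rw [hP, wave_sum, map_sum]
      exact Finset.sum_congr rfl fun k _ => by rw [wave_smul, map_mul]
    rw [h, Finset.sum_mul]
    exact Finset.sum_congr rfl fun k _ => mul_assoc _ _ _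
  have h3 : ((∫ x, ‖p.wave ħ P x‖ ^ 2 : ℝ) : ℂ) = ((∑ k ∈ s, ‖c k‖ ^ 2 : ℝ) : ℂ) := by
    rw [h1]
    simp only [h2]
    rw [integral_finsetSum _ fun k _ =>
      (integrable_conj_wave_mul_wave hp hħ hdet _ _).const_mul _, Complex.ofReal_sum]
    refine Finset.sum_congr rfl fun k hk => ?_
    rw [integral_const_mul, hP, integral_conj_state_mul_sum hp hħ hdet, if_pos hk,
      Complex.conj_mul', Complex.ofReal_pow]
  exact_mod_cast h3

end Packet

/-! ### ℓ¹ coefficient bounds, position matrices and moments. -/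

namespace Packet

open MvPolynomial

variable {d : ℕ} {p : Packet d} {ħ : ℝ}

/-- `P` is the polynomial factor of a combination of the states `φ_j` with `|j| ≤ n`, the absolute
values of whose coefficients add up to at most `K`. -/
def Expands (p : Packet d) (ħ : ℝ) (P : MvPolynomial (Fin d) ℂ) (n : ℕ) (K : ℝ) : Prop :=
  ∃ c : MultiIndex d → ℂ, P = ∑ j ∈ indicesLE d n, c j • p.statePoly ħ j ∧
    ∑ j ∈ indicesLE d n, ‖c j‖ ≤ K

theorem indicesLE_mono {n n' : ℕ} (h : n ≤ n') : indicesLE d n ⊆ indicesLE d n' := fun _ hj =>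
  mem_indicesLE.2 ((mem_indicesLE.1 hj).trans h)

theorem Expands.mono {P : MvPolynomial (Fin d) ℂ} {n n' : ℕ} {K K' : ℝ}
    (h : p.Expands ħ P n K) (hn : n ≤ n') (hK : K ≤ K') : p.Expands ħ P n' K' := by
  classical
  obtain ⟨c, hc, hs⟩ := h
  have hsub : (indicesLE d n').filter (· ∈ indicesLE d n) = indicesLE d n := by
    ext j
    simp only [Finset.mem_filter, and_iff_right_iff_imp]
    exact fun h => indicesLE_mono hn h
  refine ⟨fun j => if j ∈ indicesLE d n then c j else 0, ?_, ?_⟩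
  · simp only [ite_smul, zero_smul]
    rw [← Finset.sum_filter, hsub, hc]
  · have : ∀ j, ‖(if j ∈ indicesLE d n then c j else 0)‖ = if j ∈ indicesLE d n then ‖c j‖ else 0 :=
      fun j => by split_ifs <;> simp
    simp only [this]
    rw [← Finset.sum_filter, hsub]
    exact hs.trans hK

theorem Expands.add {P Q : MvPolynomial (Fin d) ℂ} {n : ℕ} {K L : ℝ}
    (hP : p.Expands ħ P n K) (hQ : p.Expands ħ Q n L) : p.Expands ħ (P + Q) n (K + L) := by
  obtain ⟨c, hc, hs⟩ := hP
  obtain ⟨c', hc', hs'⟩ := hQ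
  refine ⟨fun j => c j + c' j, ?_, ?_⟩
  · simp only [add_smul, Finset.sum_add_distrib]
    rw [← hc, ← hc']
  · calc ∑ j ∈ indicesLE d n, ‖c j + c' j‖ ≤ ∑ j ∈ indicesLE d n, (‖c j‖ + ‖c' j‖) :=
          Finset.sum_le_sum fun j _ => norm_add_le _ _
      _ ≤ K + L := by rw [Finset.sum_add_distrib]; exact add_le_add hs hs'

theorem Expands.smul {P : MvPolynomial (Fin d) ℂ} {n : ℕ} {K : ℝ}
    (hP : p.Expands ħ P n K) (a : ℂ) : p.Expands ħ (a • P) n (‖a‖ * K) := by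
  obtain ⟨c, hc, hs⟩ := hP
  refine ⟨fun j => a * c j, ?_, ?_⟩
  · rw [hc, Finset.smul_sum]
    exact Finset.sum_congr rfl fun j _ => smul_smul _ _ _
  · simp only [norm_mul]
    rw [← Finset.mul_sum]
    gcongr

theorem expands_zero (n : ℕ) : p.Expands ħ 0 n 0 := ⟨0, by simp, by simp⟩

theorem Expands.sum {ι : Type*} {s : Finset ι} {P : ι → MvPolynomial (Fin d) ℂ} {n : ℕ}
    {K : ι → ℝ} (h : ∀ i ∈ s, p.Expands ħ (P i) n (K i)) :
    p.Expands ħ (∑ i ∈ s, P i) n (∑ i ∈ s, K i) := by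
  classical
  induction s using Finset.induction_on with
  | empty => simpa using expands_zero n
  | insert _ _ hi ih =>
    rw [Finset.sum_insert hi, Finset.sum_insert hi]
    exact (h _ (Finset.mem_insert_self _ _)).add
      (ih fun k hk => h k (Finset.mem_insert_of_mem hk))

theorem expands_statePoly {j : MultiIndex d} {n : ℕ} (h : order j ≤ n) :
    p.Expands ħ (p.statePoly ħ j) n 1 := by
  classical
  refine ⟨fun k => if k = j then 1 else 0, ?_, ?_⟩
  · simp [ite_smul, mem_indicesLE, h]
  · have : ∀ k, ‖(if k = j then (1 : ℂ) else 0)‖ = if k = j then 1 else 0 := fun k => by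
      split_ifs <;> simp
    simp only [this]
    simp [mem_indicesLE, h]

theorem order_sub_single_le (j : MultiIndex d) (k : Fin d) :
    order (j - Pi.single k 1) ≤ order j :=
  Finset.sum_le_sum fun _ _ => Nat.sub_le _ _

/-- Multiplication by a coordinate in the basis of the states. -/
theorem expands_X_mul_statePoly (hp : Admissible p.A p.B) (hħ : 0 < ħ) {α : ℝ}
    (hα : ∀ i k, ‖p.A i k‖ ≤ α) (i : Fin d) {j : MultiIndex d} {n : ℕ} (hj : order j ≤ n) :
    p.Expands ħ (X i * p.statePoly ħ j) (n + 1)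
      (Real.sqrt ħ * (2 * d * α) * Real.sqrt (n + 1)) := by
  have hα0 : 0 ≤ α := (norm_nonneg _).trans (hα i i)
  have hjm : ∀ m, Real.sqrt (j m + 1) ≤ Real.sqrt (n + 1) := fun m => by
    apply Real.sqrt_le_sqrt
    have : (j m : ℝ) ≤ n := by exact_mod_cast (le_order j m).trans hj
    linarith
  have hjm' : ∀ m, Real.sqrt (j m) ≤ Real.sqrt (n + 1) := fun m =>
    (Real.sqrt_le_sqrt (by linarith)).trans (hjm m)
  rw [X_mul_eq hp hħ]
  have h1 : ∀ m ∈ (Finset.univ : Finset (Fin d)), p.Expands ħ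
      (p.A i m • p.raisePoly ħ m (p.statePoly ħ j) +
        conj (p.A i m) • p.lowerPoly ħ m (p.statePoly ħ j)) (n + 1)
      (2 * α * Real.sqrt (n + 1)) := by
    intro m _
    rw [raisePoly_statePoly hp, lowerPoly_statePoly hp hħ]
    have e1 := ((expands_statePoly (p := p) (ħ := ħ) (j := j + Pi.single m 1) (n := n + 1)
      (by rw [order_add_single]; omega)).smul ((Real.sqrt (j m + 1) : ℝ) : ℂ)).smul (p.A i m)
    have e2 := ((expands_statePoly (p := p) (ħ := ħ) (j := j - Pi.single m 1) (n := n + 1)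
      ((order_sub_single_le j m).trans (by omega))).smul
        ((Real.sqrt (j m) : ℝ) : ℂ)).smul (conj (p.A i m))
    refine (e1.add e2).mono le_rfl ?_
    rw [Complex.norm_real, Complex.norm_real, RCLike.norm_conj, Real.norm_eq_abs, Real.norm_eq_abs,
      abs_of_nonneg (Real.sqrt_nonneg _), abs_of_nonneg (Real.sqrt_nonneg _), mul_one, mul_one]
    have b1 := mul_le_mul (hα i m) (hjm m) (Real.sqrt_nonneg _) hα0
    have b2 := mul_le_mul (hα i m) (hjm' m) (Real.sqrt_nonneg _) hα0
    linarith
  refine ((Expands.sum h1).smul _).mono le_rfl ?_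
  rw [Complex.norm_real, Real.norm_eq_abs, abs_of_nonneg (Real.sqrt_nonneg _), Finset.sum_const,
    Finset.card_univ, Fintype.card_fin, nsmul_eq_mul]
  have h2 : Real.sqrt (ħ / 2) ≤ Real.sqrt ħ := Real.sqrt_le_sqrt (by linarith)
  calc Real.sqrt (ħ / 2) * (d * (2 * α * Real.sqrt (n + 1)))
      ≤ Real.sqrt ħ * (d * (2 * α * Real.sqrt (n + 1))) := by gcongr
    _ = _ := by ring

theorem Expands.X_mul (hp : Admissible p.A p.B) (hħ : 0 < ħ) {α : ℝ}
    (hα : ∀ i k, ‖p.A i k‖ ≤ α) (i : Fin d) {P : MvPolynomial (Fin d) ℂ} {n : ℕ} {K : ℝ}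
    (h : p.Expands ħ P n K) :
    p.Expands ħ (X i * P) (n + 1) (Real.sqrt ħ * (2 * d * α) * Real.sqrt (n + 1) * K) := by
  have hα0 : 0 ≤ α := (norm_nonneg _).trans (hα i i)
  obtain ⟨c, hc, hs⟩ := h
  have h1 : X i * P = ∑ j ∈ indicesLE d n, c j • (X i * p.statePoly ħ j) := by
    rw [hc, Finset.mul_sum]
    exact Finset.sum_congr rfl fun j _ => by rw [mul_smul_comm]
  rw [h1]
  refine (Expands.sum fun j hj =>
    (expands_X_mul_statePoly hp hħ hα i (mem_indicesLE.1 hj)).smul (c j)).mono le_rfl ?_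
  rw [← Finset.sum_mul, mul_comm]
  gcongr

/-- The monomial `X^m`. -/
def monoPoly (m : MultiIndex d) : MvPolynomial (Fin d) ℂ := ∏ i, X i ^ m i

theorem monoPoly_add_single (m : MultiIndex d) (k : Fin d) :
    monoPoly (m + Pi.single k 1) = X k * monoPoly m := by
  have h : ∏ i, (X i : MvPolynomial (Fin d) ℂ) ^ (Pi.single k 1 : MultiIndex d) i = X k := by
    rw [Finset.prod_eq_single k]
    · simp
    · intro i _ hi; simp [hi]
    · simp
  simp only [monoPoly, Pi.add_apply, pow_add, Finset.prod_mul_distrib, h, mul_comm]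

/-- The number q bounds every degree reached along the way, so all |m| multiplications cost the same
factor. -/
theorem Expands.monoPoly_mul (hp : Admissible p.A p.B) (hħ : 0 < ħ) {α : ℝ}
    (hα : ∀ i k, ‖p.A i k‖ ≤ α) (hα0 : 0 ≤ α) {P : MvPolynomial (Fin d) ℂ} {n : ℕ} {K : ℝ}
    (hK : 0 ≤ K) (h : p.Expands ħ P n K) {q : ℕ} (m : MultiIndex d) (hq : n + order m ≤ q) :
    p.Expands ħ (monoPoly m * P) (n + order m)
      ((Real.sqrt ħ * (2 * d * α) * Real.sqrt q) ^ order m * K) := by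
  induction m using multiIndex_induction with
  | zero => simpa [monoPoly, order_zero] using h
  | add_single m k ih =>
    rw [order_add_single] at hq ⊢
    have ih' := (ih (by omega)).X_mul hp hħ hα k
    rw [monoPoly_add_single, mul_assoc]
    refine ih'.mono (by omega) ?_
    rw [pow_succ', mul_assoc (Real.sqrt ħ * (2 * d * α) * Real.sqrt q)]
    have : Real.sqrt ((n + order m : ℕ) + 1) ≤ Real.sqrt q := by
      apply Real.sqrt_le_sqrt
      exact_mod_cast hq
    gcongr

theorem Expands.integral_norm_wave_sq_le (hp : Admissible p.A p.B) (hħ : 0 < ħ)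
    (hdet : p.sqrtDet ^ 2 = p.A.det) {P : MvPolynomial (Fin d) ℂ} {n : ℕ} {K : ℝ}
    (h : p.Expands ħ P n K) : ∫ x, ‖p.wave ħ P x‖ ^ 2 ≤ K ^ 2 := by
  obtain ⟨c, hc, hs⟩ := h
  rw [hc, integral_norm_wave_sq hp hħ hdet]
  refine (Finset.sum_sq_le_sq_sum_of_nonneg fun j _ => norm_nonneg (c j)).trans ?_
  have : 0 ≤ ∑ j ∈ indicesLE d n, ‖c j‖ := Finset.sum_nonneg fun _ _ => norm_nonneg _
  gcongr

theorem evalAt_monoPoly (a : EuclideanSpace ℝ (Fin d)) (m : MultiIndex d)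
    (x : EuclideanSpace ℝ (Fin d)) : evalAt a (monoPoly m) x = ((monomial m (x - a) : ℝ) : ℂ) := by
  simp [evalAt, monoPoly, Semiclassical.monomial]

theorem wave_mul (P Q : MvPolynomial (Fin d) ℂ) (x : EuclideanSpace ℝ (Fin d)) :
    p.wave ħ (P * Q) x = evalAt p.a P x * p.wave ħ Q x := by
  rw [wave, evalAt_mul, wave, mul_assoc]

theorem posMatrix_eq (hp : Admissible p.A p.B) (hħ : 0 < ħ) (m j k : MultiIndex d) :
    p.posMatrix ħ m j k = ((ħ ^ (-(order m : ℝ) / 2) : ℝ) : ℂ) *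
      ∫ x, conj (p.wave ħ (p.statePoly ħ j) x) * p.wave ħ (monoPoly m * p.statePoly ħ k) x := by
  unfold posMatrix
  congr 2; funext x
  rw [p.state_eq_wave ħ hp hħ, p.state_eq_wave ħ hp hħ, wave_mul, evalAt_monoPoly, mul_assoc]

/-- Multiplying by |m| coordinates cannot lift φ_k above degree |k| + |m|, and φ_j is orthogonal to
everything below its own degree. -/
theorem posMatrix_eq_zero (hp : Admissible p.A p.B) (hħ : 0 < ħ)
    (hdet : p.sqrtDet ^ 2 = p.A.det) {m j k : MultiIndex d} (h : order k + order m < order j) :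
    p.posMatrix ħ m j k = 0 := by
  have hα : ∀ i l, ‖p.A i l‖ ≤ ‖Matrix.toEuclideanCLM (n := Fin d) (𝕜 := ℂ) p.A‖ :=
    norm_entry_le p.A
  obtain ⟨c, hc, -⟩ := (expands_statePoly (p := p) (ħ := ħ) (le_refl (order k))).monoPoly_mul
    hp hħ hα (norm_nonneg _) zero_le_one m le_rfl
  rw [posMatrix_eq hp hħ, hc, integral_conj_state_mul_sum hp hħ hdet, if_neg, mul_zero]
  rw [mem_indicesLE]
  omega

/-- By orthonormality an entry is a coefficient in the expansion of (x - a)^m φ_k, and the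
normalization ħ^(-|m|/2) cancels the √ħ of each coordinate. -/
theorem norm_posMatrix_le (hp : Admissible p.A p.B) (hħ : 0 < ħ)
    (hdet : p.sqrtDet ^ 2 = p.A.det) {α : ℝ} (hα : ∀ i k, ‖p.A i k‖ ≤ α) (hα0 : 0 ≤ α)
    (m j k : MultiIndex d) {q : ℕ} (hq : order k + order m ≤ q) :
    ‖p.posMatrix ħ m j k‖ ≤ (2 * d * α * Real.sqrt q) ^ order m := by
  obtain ⟨c, hc, hs⟩ := (expands_statePoly (p := p) (ħ := ħ) (le_refl (order k))).monoPoly_mul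
    hp hħ hα hα0 zero_le_one m hq
  rw [posMatrix_eq hp hħ, hc, integral_conj_state_mul_sum hp hħ hdet, norm_mul]
  have hscale : ħ ^ (-(order m : ℝ) / 2) * Real.sqrt ħ ^ order m = 1 := by
    rw [Real.sqrt_eq_rpow, ← Real.rpow_natCast, ← Real.rpow_mul hħ.le, ← Real.rpow_add hħ]
    convert Real.rpow_zero ħ using 2
    ring
  have h0 : 0 ≤ (Real.sqrt ħ * (2 * d * α) * Real.sqrt q) ^ order m := by positivity
  have h1 : ‖if j ∈ indicesLE d (order k + order m) then c j else 0‖ ≤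
      (Real.sqrt ħ * (2 * d * α) * Real.sqrt q) ^ order m := by
    split_ifs with hj
    · refine (Finset.single_le_sum (f := fun j => ‖c j‖) (fun _ _ => norm_nonneg _) hj).trans ?_
      simpa using hs
    · simpa using h0
  rw [Complex.norm_real, Real.norm_eq_abs, abs_of_nonneg (by positivity)]
  calc _ ≤ ħ ^ (-(order m : ℝ) / 2) * (Real.sqrt ħ * (2 * d * α) * Real.sqrt q) ^ order m := by
        gcongr
    _ = (ħ ^ (-(order m : ℝ) / 2) * Real.sqrt ħ ^ order m) * (2 * d * α * Real.sqrt q) ^ order m := by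
        rw [mul_assoc (Real.sqrt ħ), mul_pow (Real.sqrt ħ), ← mul_assoc]
    _ = _ := by rw [hscale, one_mul]

/-- Chebyshev's inequality with a moment of order `2q`. -/
theorem Expands.integral_outside_le (hp : Admissible p.A p.B) (hħ : 0 < ħ)
    (hdet : p.sqrtDet ^ 2 = p.A.det) {α : ℝ} (hα : ∀ i k, ‖p.A i k‖ ≤ α) (hα0 : 0 ≤ α)
    {P : MvPolynomial (Fin d) ℂ} {n : ℕ} {K : ℝ} (hK : 0 ≤ K) (h : p.Expands ħ P n K) (q : ℕ)
    {b : ℝ} (hb : 0 < b) :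
    ∫ x in {x | b < ‖x - p.a‖}, ‖p.wave ħ P x‖ ^ 2 ≤
      d * (d / b ^ 2 * (ħ * (2 * d * α) ^ 2 * (n + q : ℕ))) ^ q * K ^ 2 := by
  have hmeas : MeasurableSet {x : EuclideanSpace ℝ (Fin d) | b < ‖x - p.a‖} :=
    (isOpen_lt continuous_const (by fun_prop)).measurableSet
  have hint : ∀ i : Fin d, Integrable fun x =>
      (d / b ^ 2) ^ q * ‖p.wave ħ (monoPoly (Pi.single i q) * P) x‖ ^ 2 := fun i =>
    (integrable_norm_wave_sq hp hħ hdet _).const_mul _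
  have hpt : ∀ x ∈ {x : EuclideanSpace ℝ (Fin d) | b < ‖x - p.a‖}, ‖p.wave ħ P x‖ ^ 2 ≤
      ∑ i, (d / b ^ 2) ^ q * ‖p.wave ħ (monoPoly (Pi.single i q) * P) x‖ ^ 2 := by
    intro x hx
    -- Outside the ball some coordinate carries at least the average share of b². Summing over i
    -- then makes the pure powers x_i^q the only moments needed.
    obtain ⟨i, hi⟩ : ∃ i, b ^ 2 / d ≤ (x i - p.a i) ^ 2 := by
      by_contra! hcon
      have h1 : ‖x - p.a‖ ^ 2 ≤ b ^ 2 := by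
        rw [EuclideanSpace.norm_sq_eq]
        calc ∑ i, ‖(x - p.a) i‖ ^ 2 ≤ ∑ _i : Fin d, b ^ 2 / d :=
              Finset.sum_le_sum fun i _ => by
                rw [Real.norm_eq_abs, sq_abs]; exact (hcon i).le
          _ = d * (b ^ 2 / d) := by simp
          _ ≤ b ^ 2 := by
              rcases eq_or_ne (d : ℝ) 0 with h0 | h0
              · rw [h0, zero_mul]; positivity
              · rw [mul_div_cancel₀ _ h0]
      exact absurd hx (not_lt.2 ((sq_le_sq₀ (norm_nonneg _) hb.le).1 h1))
    have hd0 : (0 : ℝ) < d := by exact_mod_cast i.pos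
    have h2 : 1 ≤ (d / b ^ 2) ^ q * ((x i - p.a i) ^ 2) ^ q := by
      rw [← mul_pow]
      apply one_le_pow₀
      rw [div_le_iff₀ hd0] at hi
      rw [div_mul_eq_mul_div, one_le_div (by positivity)]
      linarith
    have h3 : ‖p.wave ħ (monoPoly (Pi.single i q) * P) x‖ ^ 2 =
        ((x i - p.a i) ^ 2) ^ q * ‖p.wave ħ P x‖ ^ 2 := by
      have : monoPoly (Pi.single i q) = (X i : MvPolynomial (Fin d) ℂ) ^ q := by
        unfold monoPoly
        rw [Finset.prod_eq_single i]
        · simp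
        · intro k _ hk; simp [hk]
        · simp
      rw [wave_mul, norm_mul, mul_pow, this]
      congr 1
      simp only [evalAt, map_pow, eval_X]
      rw [norm_pow, Complex.norm_real, Real.norm_eq_abs, ← pow_mul, mul_comm, pow_mul, sq_abs]
    calc ‖p.wave ħ P x‖ ^ 2 ≤ (d / b ^ 2) ^ q * ((x i - p.a i) ^ 2) ^ q * ‖p.wave ħ P x‖ ^ 2 :=
          le_mul_of_one_le_left (by positivity) h2
      _ = (d / b ^ 2) ^ q * ‖p.wave ħ (monoPoly (Pi.single i q) * P) x‖ ^ 2 := by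
          rw [h3, mul_assoc]
      _ ≤ _ := Finset.single_le_sum
          (f := fun i => (d / b ^ 2) ^ q * ‖p.wave ħ (monoPoly (Pi.single i q) * P) x‖ ^ 2)
          (fun k _ => by positivity) (Finset.mem_univ i)
  have hsum : Integrable fun x =>
      ∑ i, (d / b ^ 2) ^ q * ‖p.wave ħ (monoPoly (Pi.single i q) * P) x‖ ^ 2 :=
    integrable_finsetSum _ fun i _ => hint i
  calc ∫ x in {x | b < ‖x - p.a‖}, ‖p.wave ħ P x‖ ^ 2
      ≤ ∫ x in {x | b < ‖x - p.a‖},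
          ∑ i, (d / b ^ 2) ^ q * ‖p.wave ħ (monoPoly (Pi.single i q) * P) x‖ ^ 2 :=
        setIntegral_mono_on (integrable_norm_wave_sq hp hħ hdet P).integrableOn
          hsum.integrableOn hmeas hpt
    _ ≤ ∫ x, ∑ i, (d / b ^ 2) ^ q * ‖p.wave ħ (monoPoly (Pi.single i q) * P) x‖ ^ 2 :=
        setIntegral_le_integral hsum
          (Filter.Eventually.of_forall fun x => Finset.sum_nonneg fun i _ => by positivity)
    _ = ∑ i, (d / b ^ 2) ^ q * ∫ x, ‖p.wave ħ (monoPoly (Pi.single i q) * P) x‖ ^ 2 := by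
        rw [integral_finsetSum _ fun i _ => hint i]
        simp only [integral_const_mul]
    _ ≤ ∑ _i : Fin d, (d / b ^ 2) ^ q *
          ((Real.sqrt ħ * (2 * d * α) * Real.sqrt (n + q : ℕ)) ^ q * K) ^ 2 := by
        refine Finset.sum_le_sum fun i _ => ?_
        have ho : order (Pi.single i q : MultiIndex d) = q := by simp [order]
        have h1 := h.monoPoly_mul hp hħ hα hα0 hK (q := n + q) (Pi.single i q) (by rw [ho])
        rw [ho] at h1
        gcongr
        exact h1.integral_norm_wave_sq_le hp hħ hdet
    _ = _ := by
        rw [Finset.sum_const, Finset.card_univ, Fintype.card_fin, nsmul_eq_mul]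
        have h1 : ((Real.sqrt ħ * (2 * d * α) * Real.sqrt (n + q : ℕ)) ^ q) ^ 2 =
            (ħ * (2 * d * α) ^ 2 * (n + q : ℕ)) ^ q := by
          rw [← pow_mul, mul_comm q 2, pow_mul, mul_pow _ (Real.sqrt (n + q : ℕ)), mul_pow (Real.sqrt ħ),
            Real.sq_sqrt hħ.le, Real.sq_sqrt (Nat.cast_nonneg _)]
        rw [mul_pow _ K, h1, mul_pow (d / b ^ 2 : ℝ)]
        ring

end Packet

/-! ### Growth of the solutions of the coefficient hierarchy. -/

section Hierarchy

variable {d : ℕ}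

theorem card_indicesLE_le (n : ℕ) : (indicesLE d n).card ≤ (n + 1) ^ d := by
  refine (Finset.card_filter_le _ _).trans ?_
  simp [Fintype.card_piFinset]

theorem card_indicesEq_le (n : ℕ) : (indicesEq d n).card ≤ (n + 1) ^ d := by
  refine (Finset.card_filter_le _ _).trans ?_
  simp [Fintype.card_piFinset]

theorem hierarchy_succ {ι : Type*} (K : ℕ → ℝ → Matrix ι ι ℂ) (c₀ : ι → ℂ) (n : ℕ) (t : ℝ)
    (j : ι) : hierarchy K c₀ (n + 1) t j = -I * ∫ s in (0 : ℝ)..t,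
        ∑ k : Fin (n + 1), ∑' j' : ι, K (n + 1 + 2 - k) s j j' * hierarchy K c₀ k s j' := by
  rw [hierarchy]

theorem hierarchy_zero {ι : Type*} (K : ℕ → ℝ → Matrix ι ι ℂ) (c₀ : ι → ℂ) (t : ℝ)
    (j : ι) : hierarchy K c₀ 0 t j = c₀ j := by
  rw [hierarchy]

/-- A crude bound for the solution of a hierarchy of banded equations. -/
theorem hierarchy_bound {K : ℕ → ℝ → Matrix (MultiIndex d) (MultiIndex d) ℂ}
    {c₀ : MultiIndex d → ℂ} {J L : ℕ} {T G C₀ : ℝ} (hG : 1 ≤ G)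
    (hC₀ : ∀ j, ‖c₀ j‖ ≤ C₀) (hc₀ : ∀ j, J < order j → c₀ j = 0)
    (hband : ∀ k, ∀ s ∈ Set.Icc 0 T, ∀ j j', order j' + k < order j → K k s j j' = 0)
    (hK : ∀ k, 3 ≤ k → k ≤ L + 2 → ∀ s ∈ Set.Icc 0 T, ∀ j j', order j' ≤ J + 3 * L →
      ((indicesLE d (J + 3 * L)).card : ℝ) * ‖K k s j j'‖ ≤ G ^ k)
    (n : ℕ) (hn : n ≤ L) : ∀ t ∈ Set.Icc 0 T, ∀ j,
      (J + 3 * n < order j → hierarchy K c₀ n t j = 0) ∧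
      ‖hierarchy K c₀ n t j‖ ≤ C₀ * ((1 + T) * G ^ 3) ^ n := by
  have hC : 0 ≤ C₀ := (norm_nonneg _).trans (hC₀ 0)
  induction n using Nat.strong_induction_on with
  | _ n ih =>
  rcases n with _ | n
  · intro t _ j
    simp only [hierarchy_zero]
    exact ⟨fun h => hc₀ j (by omega), by simpa using hC₀ j⟩
  intro t ht j
  have hT : 0 ≤ T := ht.1.trans ht.2
  have ih' : ∀ k : Fin (n + 1), ∀ s ∈ Set.Icc 0 T, ∀ j,
      (J + 3 * (k : ℕ) < order j → hierarchy K c₀ k s j = 0) ∧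
      ‖hierarchy K c₀ k s j‖ ≤ C₀ * ((1 + T) * G ^ 3) ^ (k : ℕ) :=
    fun k => ih k k.2 (by have := k.2; omega)
  rw [hierarchy_succ]
  constructor
  · intro hj
    -- The matrix of index n + 3 - k lifts degree J + 3k to at most J + n + 3 + 2k, which is at most
    -- J + 3(n + 1) because k ≤ n.
    have h0 : ∀ s ∈ Set.uIcc 0 t,
        ∑ k : Fin (n + 1), ∑' j', K (n + 1 + 2 - k) s j j' * hierarchy K c₀ k s j' = 0 := by
      intro s hs
      rw [Set.uIcc_of_le ht.1] at hs
      have hs' : s ∈ Set.Icc 0 T := ⟨hs.1, hs.2.trans ht.2⟩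
      refine Finset.sum_eq_zero fun k _ => ?_
      have : ∀ j', K (n + 1 + 2 - k) s j j' * hierarchy K c₀ k s j' = 0 := by
        intro j'
        by_cases h : J + 3 * (k : ℕ) < order j'
        · rw [((ih' k s hs' j').1 h), mul_zero]
        · rw [hband _ s hs' j j' (by have := k.2; omega), zero_mul]
      simp [this]
    rw [intervalIntegral.integral_congr (g := fun _ => (0 : ℂ)) h0]
    simp
  · set S := indicesLE d (J + 3 * L) with hS
    have hScard : (0 : ℝ) < S.card := by
      have : (0 : MultiIndex d) ∈ S := by rw [hS, mem_indicesLE, order_zero]; omega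
      exact_mod_cast Finset.card_pos.2 ⟨0, this⟩
    have hbd : ∀ s ∈ Set.uIoc 0 t,
        ‖∑ k : Fin (n + 1), ∑' j', K (n + 1 + 2 - k) s j j' * hierarchy K c₀ k s j'‖ ≤
          C₀ * (G ^ 3) ^ (n + 1) * ∑ k ∈ Finset.range (n + 1), (1 + T) ^ k := by
      intro s hs
      rw [Set.uIoc_of_le ht.1] at hs
      have hs' : s ∈ Set.Icc 0 T := ⟨hs.1.le, hs.2.trans ht.2⟩
      rw [← Fin.sum_univ_eq_sum_range, Finset.mul_sum]
      refine (norm_sum_le _ _).trans (Finset.sum_le_sum fun k _ => ?_)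
      have hk := k.2
      rw [tsum_eq_sum (s := S) (fun j' hj' => by
        rw [hS, mem_indicesLE] at hj'
        rw [(ih' k s hs' j').1 (by omega), mul_zero])]
      -- The cardinality built into `hK` is spent here: each entry is at most G^(n+3-k)/|S|, so
      -- summing over S costs nothing.
      have hterm : ∀ j' ∈ S, ‖K (n + 1 + 2 - k) s j j' * hierarchy K c₀ k s j'‖ ≤
          G ^ (n + 1 + 2 - k) / S.card * (C₀ * ((1 + T) * G ^ 3) ^ (k : ℕ)) := by
        intro j' hj'
        rw [norm_mul]
        refine mul_le_mul ?_ (ih' k s hs' j').2 (norm_nonneg _) (by positivity)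
        rw [le_div_iff₀ hScard, mul_comm]
        exact hK _ (by omega) (by omega) s hs' j j' (mem_indicesLE.1 hj')
      refine (norm_sum_le _ _).trans ((Finset.sum_le_sum hterm).trans ?_)
      rw [Finset.sum_const, nsmul_eq_mul, ← mul_assoc, mul_div_cancel₀ _ hScard.ne']
      -- As k ≤ n, the index n + 3 - k is at most 3(n + 1 - k): a factor G³ for each order gained.
      have hpow : G ^ (n + 1 + 2 - (k : ℕ)) ≤ (G ^ 3) ^ (n + 1 - (k : ℕ)) := by
        rw [← pow_mul]
        exact pow_le_pow_right₀ hG (by omega)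
      calc G ^ (n + 1 + 2 - (k : ℕ)) * (C₀ * ((1 + T) * G ^ 3) ^ (k : ℕ))
          ≤ (G ^ 3) ^ (n + 1 - (k : ℕ)) * (C₀ * ((1 + T) * G ^ 3) ^ (k : ℕ)) := by gcongr
        _ = C₀ * ((G ^ 3) ^ (n + 1 - (k : ℕ)) * (G ^ 3) ^ (k : ℕ)) * (1 + T) ^ (k : ℕ) := by
            rw [mul_pow]; ring
        _ = _ := by rw [← pow_add]; congr 3; omega
    have h1 := intervalIntegral.norm_integral_le_of_norm_le_const hbd
    rw [norm_mul, norm_neg, Complex.norm_I, one_mul]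
    refine h1.trans ?_
    rw [sub_zero, abs_of_nonneg ht.1]
    -- The base 1 + T is chosen so that the sum over earlier orders, times the length T, telescopes.
    have hgeom : (∑ k ∈ Finset.range (n + 1), (1 + T) ^ k) * T ≤ (1 + T) ^ (n + 1) := by
      have := geom_sum_mul (1 + T) (n + 1)
      rw [add_sub_cancel_left] at this
      rw [this]; linarith
    have hsum : 0 ≤ ∑ k ∈ Finset.range (n + 1), (1 + T) ^ k :=
      Finset.sum_nonneg fun _ _ => by positivity
    calc C₀ * (G ^ 3) ^ (n + 1) * (∑ k ∈ Finset.range (n + 1), (1 + T) ^ k) * t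
        ≤ C₀ * (G ^ 3) ^ (n + 1) * (∑ k ∈ Finset.range (n + 1), (1 + T) ^ k) * T := by
          gcongr; exact ht.2
      _ = C₀ * (G ^ 3) ^ (n + 1) * ((∑ k ∈ Finset.range (n + 1), (1 + T) ^ k) * T) := by ring
      _ ≤ C₀ * (G ^ 3) ^ (n + 1) * (1 + T) ^ (n + 1) := by gcongr
      _ = _ := by rw [mul_pow (1 + T)]; ring

end Hierarchy

/-! ### Band structure and size of the interaction matrices. -/

section Interaction

variable {d : ℕ} {V : EuclideanSpace ℝ (Fin d) → ℝ} {γ : Path d} {ħ : ℝ}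

theorem interaction_eq_zero (hγ : γ.IsClassical V) (hV : ContDiff ℝ 2 V) (hħ : 0 < ħ) {k : ℕ}
    {t : ℝ} (ht : 0 ≤ t) {j j' : MultiIndex d} (h : order j' + k < order j) :
    interaction V γ ħ k t j j' = 0 := by
  refine Finset.sum_eq_zero fun m hm => ?_
  rw [Packet.posMatrix_eq_zero (p := γ.packet t) (hγ.admissible_at hV ht) hħ
    (hγ.sqrtDet_sq t ht) (by rw [mem_indicesEq.1 hm]; exact h), mul_zero]

theorem norm_interaction_le (hγ : γ.IsClassical V) (hV : ContDiff ℝ 2 V) (hħ : 0 < ħ) {k q : ℕ}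
    {t α Y : ℝ} (ht : 0 ≤ t) (hα : ∀ i l, ‖γ.A t i l‖ ≤ α) (hα0 : 0 ≤ α)
    (hY : ∀ m, order m = k → |mixedDeriv m V (γ.a t)| ≤ Y) {j j' : MultiIndex d}
    (hq : order j' + k ≤ q) :
    ‖interaction V γ ħ k t j j'‖ ≤ (k + 1) ^ d * (Y * (2 * d * α * Real.sqrt q) ^ k) := by
  have hterm : ∀ m ∈ indicesEq d k,
      ‖((mixedDeriv m V (γ.a t) / (multiFactorial m : ℝ) : ℝ) : ℂ) *
        (γ.packet t).posMatrix ħ m j j'‖ ≤ Y * (2 * d * α * Real.sqrt q) ^ k := by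
    intro m hm
    have hmk := mem_indicesEq.1 hm
    have h1 : (1 : ℝ) ≤ multiFactorial m := by exact_mod_cast multiFactorial_pos m
    have h2 := Packet.norm_posMatrix_le (p := γ.packet t) (hγ.admissible_at hV ht) hħ
      (hγ.sqrtDet_sq t ht) hα hα0 m j j' (q := q) (by rw [hmk]; exact hq)
    rw [hmk] at h2
    rw [norm_mul, Complex.norm_real, Real.norm_eq_abs, abs_div, abs_of_pos (zero_lt_one.trans_le h1)]
    have h3 : |mixedDeriv m V (γ.a t)| / (multiFactorial m : ℝ) ≤ Y :=
      (div_le_self (abs_nonneg _) h1).trans (hY m hmk)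
    exact mul_le_mul h3 h2 (norm_nonneg _)
      ((div_nonneg (abs_nonneg _) (zero_le_one.trans h1)).trans h3)
  -- A member of the index set shows that the common bound is nonnegative. The set is empty only for
  -- d = 0 < k, where both sides vanish.
  rcases (indicesEq d k).eq_empty_or_nonempty with he | ⟨m, hm⟩
  · unfold interaction
    rw [he]
    by_cases hd : d = 0
    · subst hd
      by_cases hk : k = 0
      · subst hk
        have : (0 : MultiIndex 0) ∈ indicesEq 0 0 := mem_indicesEq.2 order_zero
        rw [he] at this
        simp at this
      · simp [hk]
    · have : (Pi.single ⟨0, Nat.pos_of_ne_zero hd⟩ k : MultiIndex d) ∈ indicesEq d k := by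
        rw [mem_indicesEq]; simp [order]
      rw [he] at this
      simp at this
  · have h0 := (norm_nonneg _).trans (hterm m hm)
    refine (norm_sum_le _ _).trans ((Finset.sum_le_sum hterm).trans ?_)
    rw [Finset.sum_const, nsmul_eq_mul]
    have : ((indicesEq d k).card : ℝ) ≤ (k + 1) ^ d := by exact_mod_cast card_indicesEq_le k
    gcongr

end Interaction

/-! ### Coefficient bound for the truncated approximation. -/

section Approximation

variable {d : ℕ} {V : EuclideanSpace ℝ (Fin d) → ℝ} {γ : Path d} {ħ : ℝ}

/-- A bound for the `k`-th root of the norm of the `k`-th interaction matrix, `3 ≤ k ≤ l + 1`, on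
the indices relevant for the approximation of order `l`. -/
def growth (d J l : ℕ) (δ M τ α ρ : ℝ) : ℝ :=
  (J + 3 * l + 1) ^ d * (l + 2) ^ d * (1 + M * Real.exp (τ * ρ)) *
    (1 + Real.exp (τ * δ) * (l + 1) / δ) * (1 + 2 * d * α * Real.sqrt (J + 4 * l + 1 : ℕ))

theorem one_le_growth (d J l : ℕ) {δ M τ α ρ : ℝ} (hδ : 0 < δ) (hM : 0 ≤ M) (hα : 0 ≤ α) :
    1 ≤ growth d J l δ M τ α ρ := by
  have h1 : (1 : ℝ) ≤ (J + 3 * l + 1 : ℝ) ^ d := one_le_pow₀ (by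
    have : (0 : ℝ) ≤ J + 3 * l := by positivity
    linarith)
  have h2 : (1 : ℝ) ≤ (l + 2 : ℝ) ^ d := one_le_pow₀ (by
    have : (0 : ℝ) ≤ l := by positivity
    linarith)
  have h3 : 1 ≤ 1 + M * Real.exp (τ * ρ) := by
    have : 0 ≤ M * Real.exp (τ * ρ) := by positivity
    linarith
  have h4 : 1 ≤ 1 + Real.exp (τ * δ) * (l + 1) / δ := by
    have : 0 ≤ Real.exp (τ * δ) * (l + 1) / δ := by positivity
    linarith
  have h5 : 1 ≤ 1 + 2 * d * α * Real.sqrt (J + 4 * l + 1 : ℕ) := by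
    have : 0 ≤ 2 * d * α * Real.sqrt (J + 4 * l + 1 : ℕ) := by positivity
    linarith
  exact one_le_mul_of_one_le_of_one_le (one_le_mul_of_one_le_of_one_le
    (one_le_mul_of_one_le_of_one_le (one_le_mul_of_one_le_of_one_le h1 h2) h3) h4) h5

/-- Adding 1 to the factors makes them increase under powers, so even those that occur only once may
be raised to the k-th power, as k ≥ 1. The number J + 4l + 1 bounds |j'| + k. -/
theorem card_mul_norm_interaction_le {W : EuclideanSpace ℂ (Fin d) → ℂ} {δ M τ α ρ t : ℝ}
    (hγ : γ.IsClassical V) (hδ : 0 < δ) (hW : AnalyticOnNhd ℂ W (strip d δ))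
    (hWV : ∀ x, W (toComplex x) = (V x : ℂ)) (hM : 0 ≤ M) (hτ : 0 ≤ τ) (hb : ExpBound W δ M τ)
    (hħ : 0 < ħ) (ht : 0 ≤ t) (hα : ∀ i k, ‖γ.A t i k‖ ≤ α) (hα0 : 0 ≤ α) (hρ : ‖γ.a t‖ ≤ ρ)
    {J l k : ℕ} (hk : 1 ≤ k) (hkl : k ≤ l + 1) {j j' : MultiIndex d}
    (hj' : order j' ≤ J + 3 * l) :
    ((indicesLE d (J + 3 * l)).card : ℝ) * ‖interaction V γ ħ k t j j'‖ ≤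
      growth d J l δ M τ α ρ ^ k := by
  have hV := contDiff_potential hδ.le hW hWV
  have hkl' : (k : ℝ) ≤ l + 1 := by exact_mod_cast hkl
  have hY : ∀ m, order m = k → |mixedDeriv m V (γ.a t)| ≤
      M * (Real.exp (τ * δ) * (l + 1) / δ) ^ k * Real.exp (τ * ρ) := by
    intro m hm
    refine (abs_mixedDeriv_le hδ hW hWV hM hτ hb m (by omega) (γ.a t)).trans ?_
    rw [hm]
    gcongr
  have h := norm_interaction_le hγ hV hħ ht hα hα0 hY (j := j) (j' := j') (q := J + 4 * l + 1)
    (by omega)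
  have hc : ((indicesLE d (J + 3 * l)).card : ℝ) ≤ (J + 3 * l + 1) ^ d := by
    exact_mod_cast card_indicesLE_le (d := d) (J + 3 * l)
  have hk0 : k ≠ 0 := by omega
  have b1 : (1 : ℝ) ≤ (J + 3 * l + 1 : ℝ) ^ d := one_le_pow₀ (by
    have : (0 : ℝ) ≤ J + 3 * l := by positivity
    linarith)
  have b2 : (1 : ℝ) ≤ (l + 2 : ℝ) ^ d := one_le_pow₀ (by
    have : (0 : ℝ) ≤ l := by positivity
    linarith)
  have b3 : 1 ≤ 1 + M * Real.exp (τ * ρ) := by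
    have : 0 ≤ M * Real.exp (τ * ρ) := by positivity
    linarith
  calc ((indicesLE d (J + 3 * l)).card : ℝ) * ‖interaction V γ ħ k t j j'‖
      ≤ (J + 3 * l + 1) ^ d * ((k + 1) ^ d * (M * (Real.exp (τ * δ) * (l + 1) / δ) ^ k *
          Real.exp (τ * ρ) * (2 * d * α * Real.sqrt (J + 4 * l + 1 : ℕ)) ^ k)) := by gcongr
    _ = (J + 3 * l + 1) ^ d * (k + 1) ^ d * (M * Real.exp (τ * ρ)) *
          (Real.exp (τ * δ) * (l + 1) / δ) ^ k *
          (2 * d * α * Real.sqrt (J + 4 * l + 1 : ℕ)) ^ k := by ring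
    _ ≤ ((J + 3 * l + 1) ^ d) ^ k * ((l + 2) ^ d) ^ k * (1 + M * Real.exp (τ * ρ)) ^ k *
          (1 + Real.exp (τ * δ) * (l + 1) / δ) ^ k *
          (1 + 2 * d * α * Real.sqrt (J + 4 * l + 1 : ℕ)) ^ k := by
        have c1 : ((J + 3 * l + 1 : ℝ)) ^ d ≤ ((J + 3 * l + 1 : ℝ) ^ d) ^ k :=
          le_self_pow₀ b1 hk0
        have c2 : ((k + 1 : ℝ)) ^ d ≤ ((l + 2 : ℝ) ^ d) ^ k :=
          (pow_le_pow_left₀ (by positivity) (by linarith) d).trans (le_self_pow₀ b2 hk0)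
        have c3 : M * Real.exp (τ * ρ) ≤ (1 + M * Real.exp (τ * ρ)) ^ k :=
          (by linarith : M * Real.exp (τ * ρ) ≤ 1 + M * Real.exp (τ * ρ)).trans
            (le_self_pow₀ b3 hk0)
        have c4 : (Real.exp (τ * δ) * (l + 1) / δ) ^ k ≤ (1 + Real.exp (τ * δ) * (l + 1) / δ) ^ k :=
          pow_le_pow_left₀ (by positivity) (by linarith) k
        have c5 : (2 * d * α * Real.sqrt (J + 4 * l + 1 : ℕ)) ^ k ≤
            (1 + 2 * d * α * Real.sqrt (J + 4 * l + 1 : ℕ)) ^ k :=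
          pow_le_pow_left₀ (by positivity) (by linarith) k
        gcongr
    _ = growth d J l δ M τ α ρ ^ k := by
        unfold growth
        rw [mul_pow, mul_pow, mul_pow, mul_pow]

/-- The polynomial factor of the approximation with `l` terms. -/
def approxPoly (V : EuclideanSpace ℝ (Fin d) → ℝ) (γ : Path d) (ħ : ℝ) (J : ℕ)
    (c₀ : MultiIndex d → ℂ) (l : ℕ) (t : ℝ) : MvPolynomial (Fin d) ℂ :=
  ∑ j ∈ indicesLE d (J + 3 * l - 3), truncatedCoeff V γ ħ c₀ l t j • (γ.packet t).statePoly ħ j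

theorem norm_approximation_eq (hγ : γ.IsClassical V) (hV : ContDiff ℝ 2 V) (hħ : 0 < ħ) {t : ℝ}
    (ht : 0 ≤ t) (J : ℕ) (c₀ : MultiIndex d → ℂ) (σ' : ℝ) (x : EuclideanSpace ℝ (Fin d)) :
    ‖approximation V γ ħ J c₀ σ' t x‖ =
      ‖(γ.packet t).wave ħ (approxPoly V γ ħ J c₀ ⌊ħ ^ (-σ')⌋₊ t) x‖ := by
  have h1 : ‖Complex.exp (I * (γ.S t : ℂ) / (ħ : ℂ))‖ = 1 := by
    rw [show I * (γ.S t : ℂ) / (ħ : ℂ) = ((γ.S t / ħ : ℝ) : ℂ) * I by push_cast; ring,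
      Complex.norm_exp_ofReal_mul_I]
  unfold approximation approxPoly
  simp only
  rw [norm_mul, h1, one_mul, Packet.wave_sum]
  congr 1
  refine Finset.sum_congr rfl fun j _ => ?_
  rw [Packet.wave_smul, (γ.packet t).state_eq_wave ħ (hγ.admissible_at hV ht) hħ]

theorem expands_approxPoly {W : EuclideanSpace ℂ (Fin d) → ℂ} {δ M τ α ρ T : ℝ}
    (hγ : γ.IsClassical V) (hδ : 0 < δ) (hW : AnalyticOnNhd ℂ W (strip d δ))
    (hWV : ∀ x, W (toComplex x) = (V x : ℂ)) (hM : 0 ≤ M) (hτ : 0 ≤ τ) (hb : ExpBound W δ M τ)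
    (hħ : 0 < ħ) (hħ1 : ħ ≤ 1) (hT : 0 ≤ T) (hα : ∀ t ∈ Set.Icc 0 T, ∀ i k, ‖γ.A t i k‖ ≤ α)
    (hα0 : 0 ≤ α) (hρ : ∀ t ∈ Set.Icc 0 T, ‖γ.a t‖ ≤ ρ)
    {J l : ℕ} {c₀ : MultiIndex d → ℂ} {C₀ : ℝ}
    (hC₀ : ∀ j, ‖c₀ j‖ ≤ C₀) (hc₀ : ∀ j, J < order j → c₀ j = 0) :
    (γ.packet T).Expands ħ (approxPoly V γ ħ J c₀ l T) (J + 3 * l - 3)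
      ((J + 3 * l + 1) ^ d * (l * (C₀ * ((1 + T) * growth d J l δ M τ α ρ ^ 3) ^ l))) := by
  have hV := contDiff_potential hδ.le hW hWV
  have hG := one_le_growth d J l (τ := τ) (ρ := ρ) hδ hM hα0
  have hC : 0 ≤ C₀ := (norm_nonneg _).trans (hC₀ 0)
  set B := (1 + T) * growth d J l δ M τ α ρ ^ 3 with hB
  have hB1 : 1 ≤ B := one_le_mul_of_one_le_of_one_le (by linarith) (one_le_pow₀ hG)
  refine ⟨fun j => truncatedCoeff V γ ħ c₀ l T j, rfl, ?_⟩
  have hcoeff : ∀ j, ‖truncatedCoeff V γ ħ c₀ l T j‖ ≤ l * (C₀ * B ^ l) := by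
    intro j
    have hterm : ∀ k ∈ Finset.range l, ‖((ħ ^ ((k : ℝ) / 2) : ℝ) : ℂ) *
        hierarchy (interaction V γ ħ) c₀ k T j‖ ≤ C₀ * B ^ l := by
      intro k hk
      have hkl := Finset.mem_range.1 hk
      -- The last order is l - 1, so only interaction matrices of index at most l + 1 enter.
      have h1 := (hierarchy_bound (K := interaction V γ ħ) (J := J) (L := l - 1) (T := T) hG hC₀ hc₀
        (fun k s hs j j' h => interaction_eq_zero hγ hV hħ hs.1 h)
        (fun k hk3 hk s hs j j' hj' => ?_) k (by omega) T ⟨hT, le_rfl⟩ j).2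
      · rw [norm_mul, Complex.norm_real, Real.norm_eq_abs, abs_of_nonneg (by positivity)]
        have h2 : ħ ^ ((k : ℝ) / 2) ≤ 1 := Real.rpow_le_one hħ.le hħ1 (by positivity)
        calc _ ≤ 1 * (C₀ * B ^ k) := mul_le_mul h2 h1 (norm_nonneg _) zero_le_one
          _ ≤ C₀ * B ^ l := by
            rw [one_mul]
            exact mul_le_mul_of_nonneg_left (pow_le_pow_right₀ hB1 hkl.le) hC
      · refine le_trans ?_ (card_mul_norm_interaction_le hγ hδ hW hWV hM hτ hb hħ hs.1 (hα s hs) hα0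
          (hρ s hs) (J := J) (l := l) (by omega) (by omega) (j := j) (j' := j') (by omega))
        have : ((indicesLE d (J + 3 * (l - 1))).card : ℝ) ≤ (indicesLE d (J + 3 * l)).card := by
          exact_mod_cast Finset.card_le_card (Packet.indicesLE_mono (by omega))
        gcongr
    refine (norm_sum_le _ _).trans ((Finset.sum_le_sum hterm).trans ?_)
    rw [Finset.sum_const, Finset.card_range, nsmul_eq_mul]
  refine (Finset.sum_le_sum fun j _ => hcoeff j).trans ?_
  rw [Finset.sum_const, nsmul_eq_mul]
  have hc : ((indicesLE d (J + 3 * l - 3)).card : ℝ) ≤ (J + 3 * l + 1) ^ d := by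
    have h1 := Finset.card_le_card
      (Packet.indicesLE_mono (d := d) (show J + 3 * l - 3 ≤ J + 3 * l by omega))
    exact_mod_cast h1.trans (card_indicesLE_le (d := d) (J + 3 * l))
  gcongr

end Approximation

/-! ### Calculus of polynomially bounded quantities. -/

section PolynomialGrowth

variable {ι : Type*} {u : ι → ℝ}

/-- `f` is bounded by a polynomial in `u`. -/
def PolyBounded (u f : ι → ℝ) : Prop := ∃ C, 0 ≤ C ∧ ∃ q : ℕ, ∀ i, f i ≤ C * u i ^ q

theorem PolyBounded.mono {f g : ι → ℝ} (hg : PolyBounded u g) (h : ∀ i, f i ≤ g i) :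
    PolyBounded u f := by
  obtain ⟨C, hC, q, hq⟩ := hg
  exact ⟨C, hC, q, fun i => (h i).trans (hq i)⟩

theorem polyBounded_const (c : ℝ) : PolyBounded u fun _ => c :=
  ⟨|c|, abs_nonneg c, 0, fun _ => by simpa using le_abs_self c⟩

theorem polyBounded_self : PolyBounded u u := ⟨1, zero_le_one, 1, fun i => by simp⟩

theorem PolyBounded.add (hu : ∀ i, 1 ≤ u i) {f g : ι → ℝ} (hf : PolyBounded u f)
    (hg : PolyBounded u g) : PolyBounded u fun i => f i + g i := by
  obtain ⟨C, hC, q, hq⟩ := hf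
  obtain ⟨C', hC', q', hq'⟩ := hg
  refine ⟨C + C', by positivity, q + q', fun i => ?_⟩
  have h1 : u i ^ q ≤ u i ^ (q + q') := pow_le_pow_right₀ (hu i) (by omega)
  have h2 : u i ^ q' ≤ u i ^ (q + q') := pow_le_pow_right₀ (hu i) (by omega)
  calc f i + g i ≤ C * u i ^ q + C' * u i ^ q' := add_le_add (hq i) (hq' i)
    _ ≤ C * u i ^ (q + q') + C' * u i ^ (q + q') := by gcongr
    _ = _ := by ring

theorem PolyBounded.mul (hu : ∀ i, 1 ≤ u i) {f g : ι → ℝ} (hg0 : ∀ i, 0 ≤ g i)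
    (hf : PolyBounded u f) (hg : PolyBounded u g) : PolyBounded u fun i => f i * g i := by
  obtain ⟨C, hC, q, hq⟩ := hf
  obtain ⟨C', hC', q', hq'⟩ := hg
  refine ⟨C * C', by positivity, q + q', fun i => ?_⟩
  have hu0 : 0 ≤ u i := zero_le_one.trans (hu i)
  calc f i * g i ≤ C * u i ^ q * (C' * u i ^ q') :=
        mul_le_mul (hq i) (hq' i) (hg0 i) (by positivity)
    _ = _ := by ring

theorem PolyBounded.pow (hu : ∀ i, 1 ≤ u i) {f : ι → ℝ} (hf0 : ∀ i, 0 ≤ f i)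
    (hf : PolyBounded u f) (n : ℕ) : PolyBounded u fun i => f i ^ n := by
  induction n with
  | zero => simpa using polyBounded_const (u := u) 1
  | succ n ih =>
    simp only [pow_succ]
    exact ih.mul hu hf0 hf

end PolynomialGrowth

/-! ### Exponential localization for small ħ. -/

section SmallPlanckConstant

variable {d : ℕ} {V : EuclideanSpace ℝ (Fin d) → ℝ} {γ : Path d}

/-- The parameters `(ħ, t, l)` on the time scale `T' ln (1/ħ)`. -/
def Regime (T' : ℝ) : Type :=
  {x : ℝ × ℝ × ℕ // 0 < x.1 ∧ x.1 ≤ 1 ∧ 0 ≤ x.2.1 ∧ x.2.1 ≤ T' * Real.log (1 / x.1) ∧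
    (x.2.2 : ℝ) ≤ 1 / x.1}

theorem exp_mul_le_rpow {ħ t T' c : ℝ} (hħ : 0 < ħ) (hc : 0 ≤ c)
    (ht : t ≤ T' * Real.log (1 / ħ)) : Real.exp (c * t) ≤ (1 / ħ) ^ (c * T') := by
  rw [Real.rpow_def_of_pos (by positivity)]
  apply Real.exp_le_exp.2
  nlinarith

/-- On a logarithmic time scale both exp(λt) and exp(τvt) are powers of 1/ħ; the remaining factors
are polynomial in l ≤ 1/ħ. -/
theorem polyBounded_growth {T' : ℝ} (J : ℕ) {δ M τ N lam ρ v : ℝ} (hδ : 0 < δ)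
    (hM : 0 ≤ M) (hτ : 0 ≤ τ) (hN : 0 ≤ N) (hlam : 0 ≤ lam) (hv : 0 ≤ v) :
    PolyBounded (fun i : Regime T' => 1 / i.1.1) fun i =>
      growth d J i.1.2.2 δ M τ (N * Real.exp (lam * i.1.2.1)) (ρ + v * i.1.2.1) := by
  set u : Regime T' → ℝ := fun i => 1 / i.1.1 with hu_def
  have hu : ∀ i, 1 ≤ u i := fun i => one_le_one_div i.2.1 i.2.2.1
  have hl : PolyBounded u fun i => (i.1.2.2 : ℝ) := polyBounded_self.mono fun i => i.2.2.2.2.2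
  have hexp : ∀ c, 0 ≤ c → PolyBounded u fun i => Real.exp (c * i.1.2.1) := by
    intro c hc
    refine ⟨1, zero_le_one, ⌈c * T'⌉₊, fun i => ?_⟩
    rw [one_mul, ← Real.rpow_natCast]
    exact (exp_mul_le_rpow i.2.1 hc i.2.2.2.2.1).trans
      (Real.rpow_le_rpow_of_exponent_le (hu i) (Nat.le_ceil _))
  have c := fun r : ℝ => polyBounded_const (u := u) r
  have f1 : PolyBounded u fun i => ((J : ℝ) + 3 * i.1.2.2 + 1) ^ d :=
    (((c J).add hu ((c 3).mul hu (fun i => by positivity) hl)).add hu (c 1)).pow hu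
      (fun i => by positivity) d
  have f2 : PolyBounded u fun i => ((i.1.2.2 : ℝ) + 2) ^ d :=
    (hl.add hu (c 2)).pow hu (fun i => by positivity) d
  have f3 : PolyBounded u fun i => 1 + M * Real.exp (τ * (ρ + v * i.1.2.1)) := by
    have e : ∀ i : Regime T', M * Real.exp (τ * (ρ + v * i.1.2.1)) =
        M * Real.exp (τ * ρ) * Real.exp (τ * v * i.1.2.1) := fun i => by
      rw [mul_assoc, ← Real.exp_add]; ring_nf
    simp only [e]
    exact (c 1).add hu ((c _).mul hu (fun i => by positivity) (hexp _ (by positivity)))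
  have f4 : PolyBounded u fun i => 1 + Real.exp (τ * δ) * ((i.1.2.2 : ℝ) + 1) / δ := by
    have e : ∀ i : Regime T', Real.exp (τ * δ) * ((i.1.2.2 : ℝ) + 1) / δ =
        Real.exp (τ * δ) / δ * ((i.1.2.2 : ℝ) + 1) := fun i => by ring
    simp only [e]
    exact (c 1).add hu ((c _).mul hu (fun i => by positivity) (hl.add hu (c 1)))
  have f5 : PolyBounded u fun i => 1 + 2 * d * (N * Real.exp (lam * i.1.2.1)) *
      Real.sqrt ((J + 4 * i.1.2.2 + 1 : ℕ) : ℝ) := by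
    have hs : PolyBounded u fun i => Real.sqrt ((J + 4 * i.1.2.2 + 1 : ℕ) : ℝ) := by
      refine (((c J).add hu ((c 4).mul hu (fun i => by positivity) hl)).add hu (c 1)).mono
        fun i => ?_
      rw [Real.sqrt_le_left (by positivity)]
      push_cast
      have : (1 : ℝ) ≤ J + 4 * i.1.2.2 + 1 := by
        have : (0 : ℝ) ≤ J + 4 * i.1.2.2 := by positivity
        linarith
      exact le_self_pow₀ this two_ne_zero
    exact (c 1).add hu (((c _).mul hu (fun i => by positivity)
      ((c _).mul hu (fun i => by positivity) (hexp _ hlam))).mul hu (fun i => by positivity) hs)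
  exact (((f1.mul hu (fun i => by positivity) f2).mul hu (fun i => by positivity) f3).mul hu
    (fun i => by positivity) f4).mul hu (fun i => by positivity) f5

theorem exists_coefficient_bound {T' : ℝ} (hT' : 0 < T') (J : ℕ) {δ M τ N lam ρ v C₀ : ℝ}
    (hδ : 0 < δ) (hM : 0 ≤ M) (hτ : 0 ≤ τ) (hN : 0 ≤ N) (hlam : 0 ≤ lam)
    (hv : 0 ≤ v) (hC₀ : 0 ≤ C₀) :
    ∃ (U : ℝ) (Q : ℕ), ∀ ħ t : ℝ, ∀ l : ℕ, 0 < ħ → ħ ≤ 1 → 0 ≤ t →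
      t ≤ T' * Real.log (1 / ħ) → (l : ℝ) ≤ 1 / ħ → 1 ≤ l → U ≤ 1 / ħ →
      (J + 3 * l + 1 : ℝ) ^ d * (l * (C₀ * ((1 + t) *
        growth d J l δ M τ (N * Real.exp (lam * t)) (ρ + v * t) ^ 3) ^ l)) ≤
        (1 / ħ) ^ (Q * l) := by
  set u : Regime T' → ℝ := fun i => 1 / i.1.1 with hu_def
  have hu : ∀ i, 1 ≤ u i := fun i => one_le_one_div i.2.1 i.2.2.1
  have hl : PolyBounded u fun i => (i.1.2.2 : ℝ) := polyBounded_self.mono fun i => i.2.2.2.2.2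
  have c := fun r : ℝ => polyBounded_const (u := u) r
  have ht : PolyBounded u fun i => i.1.2.1 := by
    refine ((c T').mul hu (fun i => zero_le_one.trans (hu i)) polyBounded_self).mono fun i => ?_
    refine i.2.2.2.2.1.trans ?_
    have := Real.log_le_sub_one_of_pos (zero_lt_one.trans_le (hu i))
    gcongr
    linarith
  have hg1 : ∀ i : Regime T', 1 ≤ growth d J i.1.2.2 δ M τ (N * Real.exp (lam * i.1.2.1))
      (ρ + v * i.1.2.1) := fun i => one_le_growth _ _ _ hδ hM (by positivity)
  obtain ⟨C₁, hC₁, q₁, h₁⟩ := ((c 1).add hu ht).mul hu (fun i => by have := hg1 i; positivity)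
    ((polyBounded_growth (d := d) J (ρ := ρ) hδ hM hτ hN hlam hv).pow hu
      (fun i => zero_le_one.trans (hg1 i)) 3)
  obtain ⟨C₂, hC₂, q₂, h₂⟩ := ((((c J).add hu ((c 3).mul hu (fun i => by positivity) hl)).add hu
    (c 1)).pow hu (fun i => by positivity) d).mul hu
      (g := fun i => i.1.2.2 * C₀) (fun i => by positivity) (hl.mul hu (fun _ => hC₀) (c C₀))
  -- One extra power of w in each factor absorbs the constants C₁ and C₂, and l ≥ 1 lets the
  -- exponent q₂ + 1 of the prefactor merge into Q l.
  refine ⟨max C₁ C₂, q₁ + q₂ + 2, fun ħ t l hħ hħ1 ht0 htT hlħ hl1 hU => ?_⟩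
  have hw : 1 ≤ 1 / ħ := one_le_one_div hħ hħ1
  have e1 := h₁ ⟨(ħ, t, l), hħ, hħ1, ht0, htT, hlħ⟩
  have e2 := h₂ ⟨(ħ, t, l), hħ, hħ1, ht0, htT, hlħ⟩
  have g1 := hg1 ⟨(ħ, t, l), hħ, hħ1, ht0, htT, hlħ⟩
  simp only [hu_def] at e1 e2 g1
  set w := 1 / ħ with hw_def
  set g := growth d J l δ M τ (N * Real.exp (lam * t)) (ρ + v * t)
  have e1' : (1 + t) * g ^ 3 ≤ w ^ (q₁ + 1) := e1.trans (by
    rw [pow_succ']; gcongr; exact (le_max_left _ _).trans hU)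
  have e2' : (J + 3 * l + 1 : ℝ) ^ d * (l * C₀) ≤ w ^ (q₂ + 1) := e2.trans (by
    rw [pow_succ']; gcongr; exact (le_max_right _ _).trans hU)
  have hg0 : 0 ≤ (1 + t) * g ^ 3 := by positivity
  calc (J + 3 * l + 1 : ℝ) ^ d * (l * (C₀ * ((1 + t) * g ^ 3) ^ l))
      = (J + 3 * l + 1 : ℝ) ^ d * (l * C₀) * ((1 + t) * g ^ 3) ^ l := by ring
    _ ≤ w ^ (q₂ + 1) * (w ^ (q₁ + 1)) ^ l := by gcongr
    _ = w ^ (q₂ + 1 + (q₁ + 1) * l) := by rw [← pow_mul, ← pow_add]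
    _ ≤ w ^ ((q₁ + q₂ + 2) * l) := pow_le_pow_right₀ hw (by nlinarith)

/-- The exponents of ħ, α² and n add up to -1 + 1/3 + 1/2 = -1/6; half of this decay pays for the
constants. -/
theorem moment_base_le {w ħ α N b l q n : ℝ} {d J : ℕ} (hw1 : 1 ≤ w)
    (hħw : ħ ≤ w ^ (-1 : ℝ)) (hα0 : 0 ≤ α) (hα : α ≤ N * w ^ (1 / 6 : ℝ))
    (hl : l ≤ w ^ (1 / 4 : ℝ)) (hq : q ≤ 2 * w ^ (1 / 2 : ℝ)) (hn0 : 0 ≤ n)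
    (hn : n ≤ J + 3 * l + q)
    (hC : d / b ^ 2 * (4 * d ^ 2 * N ^ 2 * (J + 5)) ≤ w ^ (1 / 12 : ℝ)) :
    d / b ^ 2 * (ħ * (2 * d * α) ^ 2 * n) ≤ w ^ (-(1 / 12) : ℝ) := by
  have hw0 : 0 < w := zero_lt_one.trans_le hw1
  have hw42 : w ^ (1 / 4 : ℝ) ≤ w ^ (1 / 2 : ℝ) :=
    Real.rpow_le_rpow_of_exponent_le hw1 (by norm_num)
  have hw2 : 1 ≤ w ^ (1 / 2 : ℝ) := Real.one_le_rpow hw1 (by norm_num)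
  -- The 5 is 3 from 3l plus 2 from q.
  have e1 : n ≤ (J + 5) * w ^ (1 / 2 : ℝ) := by
    have hJ : (J : ℝ) ≤ J * w ^ (1 / 2 : ℝ) := le_mul_of_one_le_right (by positivity) hw2
    linarith
  have e2 : α ^ 2 ≤ N ^ 2 * w ^ (1 / 3 : ℝ) := by
    have h6 : (w ^ (1 / 6 : ℝ)) ^ 2 = w ^ (1 / 3 : ℝ) := by
      rw [← Real.rpow_natCast, ← Real.rpow_mul hw0.le]; norm_num
    rw [← h6, ← mul_pow]
    gcongr
  have h0 : 0 ≤ w ^ (-1 : ℝ) := by positivity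
  calc d / b ^ 2 * (ħ * (2 * d * α) ^ 2 * n) = d / b ^ 2 * (ħ * (4 * d ^ 2 * α ^ 2) * n) := by ring
    _ ≤ d / b ^ 2 * (w ^ (-1 : ℝ) * (4 * d ^ 2 * (N ^ 2 * w ^ (1 / 3 : ℝ))) *
          ((J + 5) * w ^ (1 / 2 : ℝ))) := by gcongr
    _ = d / b ^ 2 * (4 * d ^ 2 * N ^ 2 * (J + 5)) *
          (w ^ (-1 : ℝ) * w ^ (1 / 3 : ℝ) * w ^ (1 / 2 : ℝ)) := by ring
    _ = d / b ^ 2 * (4 * d ^ 2 * N ^ 2 * (J + 5)) * w ^ (-(1 / 6) : ℝ) := by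
        rw [← Real.rpow_add hw0, ← Real.rpow_add hw0]; norm_num
    _ ≤ w ^ (1 / 12 : ℝ) * w ^ (-(1 / 6) : ℝ) := by gcongr
    _ = _ := by rw [← Real.rpow_add hw0]; norm_num

/-- The gain w^(-q/12) competes with the loss w^(1 + 2Ql), whose exponent is at most (2Q + 1)
w^(1/4). The threshold 24(2Q + 1) ≤ w^(1/4) keeps the loss below half of the gain, and w ≥ e turns
the power of w into an exponential. -/
theorem localization_exponent_le {w K x : ℝ} {d q l Q : ℕ} (hw1 : 1 ≤ w) (hd : (d : ℝ) ≤ w)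
    (he : Real.exp 1 ≤ w) (hQ : 24 * (2 * Q + 1) ≤ w ^ (1 / 4 : ℝ)) (hq : w ^ (1 / 2 : ℝ) ≤ q)
    (hl : (l : ℝ) ≤ w ^ (1 / 4 : ℝ)) (hx0 : 0 ≤ x) (hx : x ≤ w ^ (-(1 / 12) : ℝ)) (hK0 : 0 ≤ K)
    (hK : K ≤ w ^ (Q * l)) :
    d * x ^ q * K ^ 2 ≤ Real.exp (-w ^ (1 / 2 : ℝ) / 24) := by
  have hw0 : 0 < w := zero_lt_one.trans_le hw1
  have hw41 : 1 ≤ w ^ (1 / 4 : ℝ) := Real.one_le_rpow hw1 (by norm_num)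
  have hsq : w ^ (1 / 2 : ℝ) = w ^ (1 / 4 : ℝ) * w ^ (1 / 4 : ℝ) := by
    rw [← Real.rpow_add hw0]; norm_num
  calc d * x ^ q * K ^ 2 ≤ w ^ (1 : ℝ) * (w ^ (-(1 / 12) : ℝ)) ^ q * (w ^ (Q * l)) ^ 2 := by
        rw [Real.rpow_one]; gcongr
    _ = w ^ (1 + -(1 / 12) * (q : ℝ) + (Q : ℝ) * l * 2) := by
        rw [← Real.rpow_natCast (w ^ (-(1 / 12) : ℝ)), ← Real.rpow_mul hw0.le,
          ← pow_mul, ← Real.rpow_natCast w, ← Real.rpow_add hw0, ← Real.rpow_add hw0]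
        push_cast; rfl
    _ ≤ w ^ (-(w ^ (1 / 2 : ℝ)) / 24) := by
        apply Real.rpow_le_rpow_of_exponent_le hw1
        have h1 : (Q : ℝ) * l * 2 ≤ Q * w ^ (1 / 4 : ℝ) * 2 := by gcongr
        have h2 : 24 * (2 * Q + 1) * w ^ (1 / 4 : ℝ) ≤ w ^ (1 / 2 : ℝ) := by
          rw [hsq]; gcongr
        nlinarith
    _ ≤ Real.exp (-w ^ (1 / 2 : ℝ) / 24) := by
        rw [Real.rpow_def_of_pos hw0]
        apply Real.exp_le_exp.2
        have : 1 ≤ Real.log w := (Real.le_log_iff_exp_le hw0).2 he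
        nlinarith

/-- For small `ħ` the approximation is exponentially localized, whatever the truncation exponent
`σ' ≤ 1/4`. -/
theorem exists_small_hbar_bound {W : EuclideanSpace ℂ (Fin d) → ℂ} {δ M τ N lam : ℝ}
    (hVbdd : BddBelow (Set.range V)) (hδ : 0 < δ) (hW : AnalyticOnNhd ℂ W (strip d δ))
    (hWV : ∀ x, W (toComplex x) = (V x : ℂ)) (hM : 0 ≤ M) (hτ : 0 ≤ τ) (hb : ExpBound W δ M τ)
    (hγ : γ.IsClassical V) (hN : 0 < N) (hlam : 0 < lam)
    (hA : ∀ t, 0 ≤ t → ‖Matrix.toEuclideanCLM (n := Fin d) (𝕜 := ℂ) (γ.A t)‖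
      ≤ N * Real.exp (lam * t)) {J : ℕ} {c₀ : MultiIndex d → ℂ} {C₀ : ℝ}
    (hC₀ : ∀ j, ‖c₀ j‖ ≤ C₀) (hc₀ : ∀ j, J < order j → c₀ j = 0) {b : ℝ} (hb0 : 0 < b)
    {T' : ℝ} (hT' : 0 < T') (hT'lam : T' * lam < 1 / 6) :
    ∃ U : ℝ, ∀ ħ, 0 < ħ → ħ ≤ 1 → U ≤ 1 / ħ → ∀ σ' ∈ Set.Ioc (0 : ℝ) (1 / 4), ∀ t, 0 ≤ t →
      t ≤ T' * Real.log (1 / ħ) →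
      ∫ x in {x | b < ‖x - γ.a t‖}, ‖approximation V γ ħ J c₀ σ' t x‖ ^ 2 ≤
        Real.exp (-(1 / ħ) ^ (1 / 2 : ℝ) / 24) := by
  have hV := contDiff_potential hδ.le hW hWV
  have hC : 0 ≤ C₀ := (norm_nonneg _).trans (hC₀ 0)
  obtain ⟨v, hv, hav⟩ := hγ.exists_norm_a_le hV hVbdd
  obtain ⟨U₀, Q, hQ⟩ := exists_coefficient_bound (d := d) (ρ := ‖γ.a 0‖) hT' J hδ hM hτ hN.le
    hlam.le hv hC
  set C₁ : ℝ := d / b ^ 2 * (4 * d ^ 2 * N ^ 2 * (J + 5)) with hC₁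
  have hev : ∀ᶠ w : ℝ in Filter.atTop, U₀ ≤ w ∧ (d : ℝ) ≤ w ∧ Real.exp 1 ≤ w ∧
      C₁ ≤ w ^ (1 / 12 : ℝ) ∧ 24 * (2 * Q + 1) ≤ w ^ (1 / 4 : ℝ) :=
    (Filter.eventually_ge_atTop _).and <| (Filter.eventually_ge_atTop _).and <|
      (Filter.eventually_ge_atTop _).and <|
      ((tendsto_rpow_atTop (by norm_num)).eventually_ge_atTop _).and
      ((tendsto_rpow_atTop (by norm_num)).eventually_ge_atTop _)
  obtain ⟨U, hU⟩ := Filter.eventually_atTop.1 hev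
  refine ⟨U, fun ħ hħ hħ1 hUħ σ' hσ' t ht htT => ?_⟩
  obtain ⟨u1, u2, u3, u4, u5⟩ := hU _ hUħ
  set w := 1 / ħ with hw_def
  have hw1 : 1 ≤ w := one_le_one_div hħ hħ1
  have hw0 : 0 < w := zero_lt_one.trans_le hw1
  set l := ⌊ħ ^ (-σ')⌋₊ with hl
  have hpw : ħ ^ (-σ') = w ^ σ' := by
    rw [hw_def, one_div, Real.inv_rpow hħ.le, Real.rpow_neg hħ.le]
  have hl1 : 1 ≤ l := by
    rw [hl, Nat.one_le_floor_iff, hpw]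
    exact Real.one_le_rpow hw1 hσ'.1.le
  have hl4 : (l : ℝ) ≤ w ^ (1 / 4 : ℝ) :=
    (Nat.floor_le (by positivity)).trans (by
      rw [hpw]; exact Real.rpow_le_rpow_of_exponent_le hw1 hσ'.2)
  have hw4 : w ^ (1 / 4 : ℝ) ≤ w := by
    conv_rhs => rw [← Real.rpow_one w]
    exact Real.rpow_le_rpow_of_exponent_le hw1 (by norm_num)
  have hw2 : 1 ≤ w ^ (1 / 2 : ℝ) := Real.one_le_rpow hw1 (by norm_num)
  set α := N * Real.exp (lam * t) with hα_def
  have hα0 : 0 ≤ α := by positivity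
  have hα : ∀ s ∈ Set.Icc 0 t, ∀ i k, ‖γ.A s i k‖ ≤ α := by
    intro s hs i k
    refine (norm_entry_le _ i k).trans ((hA s hs.1).trans ?_)
    rw [hα_def]
    gcongr
    exact hs.2
  have hρ : ∀ s ∈ Set.Icc 0 t, ‖γ.a s‖ ≤ ‖γ.a 0‖ + v * t := by
    intro s hs
    refine (hav s hs.1).trans ?_
    gcongr
    exact hs.2
  have hexpands := expands_approxPoly hγ hδ hW hWV hM hτ hb hħ hħ1 ht hα hα0 hρ (l := l) hC₀ hc₀
  set K := (J + 3 * l + 1 : ℝ) ^ d * (l * (C₀ * ((1 + t) *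
        growth d J l δ M τ α (‖γ.a 0‖ + v * t) ^ 3) ^ l)) with hK
  have hKle : K ≤ w ^ (Q * l) := hQ ħ t l hħ hħ1 ht htT (hl4.trans hw4) hl1 u1
  have hgr := one_le_growth d J l (τ := τ) (ρ := ‖γ.a 0‖ + v * t) hδ hM hα0
  have hK0 : 0 ≤ K := by positivity
  -- Large enough to dominate Q l, with l ≤ w^(1/4), yet small enough that ħ α² q still decays like
  -- w^(-1/6).
  set q := ⌈w ^ (1 / 2 : ℝ)⌉₊ with hq
  have hqle : w ^ (1 / 2 : ℝ) ≤ q := Nat.le_ceil _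
  have hq2 : (q : ℝ) ≤ 2 * w ^ (1 / 2 : ℝ) := (Nat.ceil_lt_add_one (by positivity)).le.trans
    (by linarith)
  have hout := hexpands.integral_outside_le (hγ.admissible_at hV ht) hħ (hγ.sqrtDet_sq t ht)
    (hα t ⟨ht, le_rfl⟩) hα0 hK0 q hb0
  simp only [norm_approximation_eq hγ hV hħ ht]
  refine le_trans hout ?_
  have hlam' : Real.exp (lam * t) ≤ w ^ (1 / 6 : ℝ) :=
    (exp_mul_le_rpow hħ hlam.le htT).trans
      (Real.rpow_le_rpow_of_exponent_le hw1 (by linarith))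
  have hħw : ħ = w ^ (-1 : ℝ) := by rw [hw_def, Real.rpow_neg_one]; simp
  have hαw : α ≤ N * w ^ (1 / 6 : ℝ) := by rw [hα_def]; gcongr
  have hn : ((J + 3 * l - 3 + q : ℕ) : ℝ) ≤ J + 3 * l + q := by
    have : J + 3 * l - 3 + q ≤ J + 3 * l + q := by omega
    exact_mod_cast this
  exact localization_exponent_le hw1 u2 u3 u5 hqle hl4 (by positivity)
    (moment_base_le hw1 hħw.le hα0 hαw hl4 hq2 (Nat.cast_nonneg _) hn u4) hK0 hKle

end SmallPlanckConstant

/-! ### Polynomials depending continuously on a parameter. -/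

section ContinuousFamilies

open MvPolynomial

variable {d : ℕ} {X : Type*} [TopologicalSpace X]

/-- Evaluation of a continuous function at a point, as a ring homomorphism. -/
def evalPoint (x : X) : C(X, ℂ) →+* ℂ :=
  (Pi.evalRingHom (fun _ : X => ℂ) x).comp ContinuousMap.coeFnRingHom

/-- A family of polynomials of bounded degree with continuous coefficients. -/
def ContFamily (P : X → MvPolynomial (Fin d) ℂ) : Prop :=
  ∃ R : MvPolynomial (Fin d) C(X, ℂ), ∀ x, P x = MvPolynomial.map (evalPoint x) R

theorem contFamily_C {f : X → ℂ} (hf : Continuous f) :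
    ContFamily fun x => (C (f x) : MvPolynomial (Fin d) ℂ) :=
  ⟨C ⟨f, hf⟩, fun x => by rw [map_C]; rfl⟩

theorem contFamily_const (P : MvPolynomial (Fin d) ℂ) : ContFamily fun _ : X => P := by
  refine ⟨MvPolynomial.map (algebraMap ℂ C(X, ℂ)) P, fun x => ?_⟩
  rw [MvPolynomial.map_map]
  have : (evalPoint x).comp (algebraMap ℂ C(X, ℂ)) = RingHom.id ℂ := RingHom.ext fun _ => rfl
  rw [this, MvPolynomial.map_id]

theorem ContFamily.add {P Q : X → MvPolynomial (Fin d) ℂ} (hP : ContFamily P)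
    (hQ : ContFamily Q) : ContFamily fun x => P x + Q x := by
  obtain ⟨R, hR⟩ := hP
  obtain ⟨S, hS⟩ := hQ
  exact ⟨R + S, fun x => by simp only [map_add, hR, hS]⟩

theorem ContFamily.sub {P Q : X → MvPolynomial (Fin d) ℂ} (hP : ContFamily P)
    (hQ : ContFamily Q) : ContFamily fun x => P x - Q x := by
  obtain ⟨R, hR⟩ := hP
  obtain ⟨S, hS⟩ := hQ
  exact ⟨R - S, fun x => by simp only [map_sub, hR, hS]⟩

theorem ContFamily.mul {P Q : X → MvPolynomial (Fin d) ℂ} (hP : ContFamily P)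
    (hQ : ContFamily Q) : ContFamily fun x => P x * Q x := by
  obtain ⟨R, hR⟩ := hP
  obtain ⟨S, hS⟩ := hQ
  exact ⟨R * S, fun x => by simp only [map_mul, hR, hS]⟩

theorem ContFamily.smul {f : X → ℂ} {P : X → MvPolynomial (Fin d) ℂ} (hf : Continuous f)
    (hP : ContFamily P) : ContFamily fun x => f x • P x := by
  simp only [MvPolynomial.smul_eq_C_mul]
  exact (contFamily_C hf).mul hP

theorem ContFamily.pderiv {P : X → MvPolynomial (Fin d) ℂ} (hP : ContFamily P) (n : Fin d) :
    ContFamily fun x => MvPolynomial.pderiv n (P x) := by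
  obtain ⟨R, hR⟩ := hP
  exact ⟨MvPolynomial.pderiv n R, fun x => by simp only [hR, MvPolynomial.pderiv_map]⟩

theorem ContFamily.sum {ι : Type*} (s : Finset ι) {P : ι → X → MvPolynomial (Fin d) ℂ}
    (hP : ∀ i ∈ s, ContFamily (P i)) : ContFamily fun x => ∑ i ∈ s, P i x := by
  classical
  induction s using Finset.induction_on with
  | empty => simpa using contFamily_const (X := X) (0 : MvPolynomial (Fin d) ℂ)
  | insert i s hi ih =>
    simp only [Finset.sum_insert hi]
    exact (hP i (Finset.mem_insert_self _ _)).add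
      (ih fun k hk => hP k (Finset.mem_insert_of_mem hk))

theorem contFamily_linForm {v : X → Fin d → ℂ} (hv : ∀ n, Continuous fun x => v x n) :
    ContFamily fun x => linForm (v x) :=
  ContFamily.sum _ fun n _ => (contFamily_C (hv n)).mul (contFamily_const (MvPolynomial.X n))

theorem ContFamily.dirDeriv {v : X → Fin d → ℂ} (hv : ∀ n, Continuous fun x => v x n)
    {P : X → MvPolynomial (Fin d) ℂ} (hP : ContFamily P) :
    ContFamily fun x => Semiclassical.dirDeriv (v x) (P x) := by
  simp only [dirDeriv_eq_sum]
  exact ContFamily.sum _ fun n _ => (contFamily_C (hv n)).mul (hP.pderiv n)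

/-- The whole family is one polynomial over C(X, ℂ), so joint continuity in parameter and argument
follows by induction on that polynomial. -/
theorem ContFamily.continuous_eval {P : X → MvPolynomial (Fin d) ℂ} (hP : ContFamily P)
    {Y : Type*} [TopologicalSpace Y] {g : Y → X} (hg : Continuous g) {v : Y → Fin d → ℂ}
    (hv : Continuous v) : Continuous fun y => MvPolynomial.eval (v y) (P (g y)) := by
  obtain ⟨R, hR⟩ := hP
  have key : ∀ R : MvPolynomial (Fin d) C(X, ℂ), Continuous fun y =>
      MvPolynomial.eval (v y) (MvPolynomial.map (evalPoint (g y)) R) := by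
    intro R
    induction R using MvPolynomial.induction_on with
    | C f =>
      simp only [map_C, eval_C]
      exact f.continuous.comp hg
    | add R S hR hS =>
      simp only [map_add]
      exact hR.add hS
    | mul_X R i hR =>
      simp only [map_mul, map_X, eval_X]
      exact hR.mul ((continuous_apply i).comp hv)
  simp only [hR]
  exact key R

end ContinuousFamilies

/-! ### Uniform lower bound for the mass near the centre. -/

section InsideMass

open MvPolynomial

variable {d : ℕ} {X : Type*} [TopologicalSpace X] {p : X → Packet d} {h : X → ℝ}

theorem contFamily_raisePoly (hA : ∀ i k, Continuous fun x => (p x).A i k)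
    (hAinv : ∀ i k, Continuous fun x => (p x).A⁻¹ i k) (hh : Continuous h) (hpos : ∀ x, 0 < h x)
    (m : Fin d) {P : X → MvPolynomial (Fin d) ℂ} (hP : ContFamily P) :
    ContFamily fun x => (p x).raisePoly (h x) m (P x) := by
  simp only [Packet.raisePoly_apply]
  have hc : Continuous fun x => ((1 / Real.sqrt (2 * h x) : ℝ) : ℂ) := by
    refine Complex.continuous_ofReal.comp (continuous_const.div (by fun_prop) fun x => ?_)
    have := hpos x
    positivity
  exact ((((contFamily_const 2).mul (contFamily_linForm fun n => hAinv m n)).mul hP).sub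
    ((hP.dirDeriv fun n => Complex.continuous_conj.comp (hA n m)).smul
      (Complex.continuous_ofReal.comp hh))).smul hc

theorem contFamily_statePoly (hA : ∀ i k, Continuous fun x => (p x).A i k)
    (hAinv : ∀ i k, Continuous fun x => (p x).A⁻¹ i k) (hh : Continuous h) (hpos : ∀ x, 0 < h x)
    (j : MultiIndex d) : ContFamily fun x => (p x).statePoly (h x) j := by
  have key : ∀ L : List (Fin d), ContFamily fun x =>
      L.foldr (fun m P => ((p x).raisePoly (h x) m)^[j m] P) 1 := by
    intro L
    induction L with
    | nil => exact contFamily_const 1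
    | cons m L ih =>
      simp only [List.foldr_cons]
      induction j m with
      | zero => exact ih
      | succ k ihk =>
        simp only [Function.iterate_succ_apply']
        exact contFamily_raisePoly hA hAinv hh hpos m ihk
  exact (key _).smul continuous_const

theorem continuous_inv_entry {A : X → Matrix (Fin d) (Fin d) ℂ}
    (hA : ∀ i k, Continuous fun x => A x i k) (hdet : ∀ x, (A x).det ≠ 0) (i k : Fin d) :
    Continuous fun x => (A x)⁻¹ i k := by
  have hA' : Continuous A := continuous_matrix hA
  simp only [Matrix.inv_def, Ring.inverse_eq_inv', Matrix.smul_apply, smul_eq_mul]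
  exact (hA'.matrix_det.inv₀ hdet).mul (hA'.matrix_adjugate.matrix_elem i k)

/-- Translating the centre to the origin makes the ball independent of the parameter, so the inside
mass becomes an integral over a fixed compact set. -/
theorem continuous_gaussian_family
    (hB : ∀ i k, Continuous fun x => (p x).B i k)
    (hAinv : ∀ i k, Continuous fun x => (p x).A⁻¹ i k) (hη : Continuous fun x => (p x).η)
    (hs : Continuous fun x => (p x).sqrtDet) (hs0 : ∀ x, (p x).sqrtDet ≠ 0) (hh : Continuous h)
    (hpos : ∀ x, 0 < h x) :
    Continuous fun z : X × EuclideanSpace ℝ (Fin d) =>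
      (p z.1).gaussian (h z.1) (z.2 + (p z.1).a) := by
  unfold Packet.gaussian
  simp only [PiLp.add_apply, add_sub_cancel_right, dotProduct, mulVec, mul_apply]
  have hh1 : Continuous fun z : X × EuclideanSpace ℝ (Fin d) => (h z.1 : ℂ) :=
    Complex.continuous_ofReal.comp (hh.comp continuous_fst)
  have hh0 : ∀ z : X × EuclideanSpace ℝ (Fin d), (h z.1 : ℂ) ≠ 0 := fun z => by
    exact_mod_cast (hpos z.1).ne'
  have hy : ∀ i, Continuous fun z : X × EuclideanSpace ℝ (Fin d) => ((z.2 i : ℝ) : ℂ) := fun i =>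
    Complex.continuous_ofReal.comp ((EuclideanSpace.proj (𝕜 := ℝ) i).continuous.comp continuous_snd)
  have hη' : ∀ i, Continuous fun z : X × EuclideanSpace ℝ (Fin d) => (((p z.1).η i : ℝ) : ℂ) :=
    fun i => Complex.continuous_ofReal.comp
      ((EuclideanSpace.proj (𝕜 := ℝ) i).continuous.comp (hη.comp continuous_fst))
  refine ((Complex.continuous_ofReal.comp (continuous_const.mul
    ((hh.comp continuous_fst).rpow_const fun z => .inl (hpos z.1).ne'))).mul
    ((hs.comp continuous_fst).inv₀ fun z => hs0 z.1)).mul (Complex.continuous_exp.comp ?_)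
  refine Continuous.add ?_ ?_
  · refine Continuous.div (Continuous.neg ?_) (continuous_const.mul hh1)
      fun z => mul_ne_zero two_ne_zero (hh0 z)
    refine continuous_finsetSum _ fun i _ => (hy i).mul (continuous_finsetSum _ fun k _ =>
      Continuous.mul (continuous_finsetSum _ fun n _ => ?_) (hy k))
    exact ((hB i n).comp continuous_fst).mul ((hAinv n k).comp continuous_fst)
  · exact Continuous.div (continuous_const.mul (continuous_finsetSum _ fun i _ =>
      (hη' i).mul (hy i))) hh1 hh0

/-- The ball contains a cube, a product of infinite sets, and a polynomial vanishing on such a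
product is zero. -/
theorem eq_zero_of_eval_eq_zero_on_ball {P : MvPolynomial (Fin d) ℂ} {b : ℝ} (hb : 0 < b)
    (hP : ∀ y ∈ Metric.ball (0 : EuclideanSpace ℝ (Fin d)) b,
      MvPolynomial.eval (fun i => ((y i : ℝ) : ℂ)) P = 0) : P = 0 := by
  have hcont : Continuous fun v : Fin d → ℝ => (WithLp.toLp 2 v : EuclideanSpace ℝ (Fin d)) :=
    PiLp.continuous_toLp 2 _
  have hopen : IsOpen {v : Fin d → ℝ | (WithLp.toLp 2 v : EuclideanSpace ℝ (Fin d)) ∈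
      Metric.ball (0 : EuclideanSpace ℝ (Fin d)) b} := Metric.isOpen_ball.preimage hcont
  obtain ⟨ε, hε, hsub⟩ := Metric.isOpen_iff.1 hopen 0 (by
    change WithLp.toLp 2 (0 : Fin d → ℝ) ∈ Metric.ball (0 : EuclideanSpace ℝ (Fin d)) b
    rw [WithLp.toLp_zero]
    exact Metric.mem_ball_self hb)
  refine MvPolynomial.funext_set (fun _ => Complex.ofReal '' Set.Ioo (-ε) ε)
    (fun _ => (Set.Ioo_infinite (by linarith)).image Complex.ofReal_injective.injOn) ?_
  intro z hz
  choose v hv hvz using fun i => hz i (Set.mem_univ i)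
  have hvmem : v ∈ Metric.ball (0 : Fin d → ℝ) ε := by
    rw [mem_ball_zero_iff, pi_norm_lt_iff hε]
    intro i
    rw [Real.norm_eq_abs, abs_lt]
    exact hv i
  have h0 := hP _ (hsub hvmem)
  have hz' : (fun i => ((v i : ℝ) : ℂ)) = z := funext hvz
  rw [map_zero, ← hz']
  exact h0

theorem setIntegral_outside_eq (a : EuclideanSpace ℝ (Fin d)) (b : ℝ)
    (f : EuclideanSpace ℝ (Fin d) → ℝ) :
    ∫ x in {x | b < ‖x - a‖}, f x = ∫ y in {y | b < ‖y‖}, f (y + a) := by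
  have h := (measurePreserving_sub_right (volume : Measure (EuclideanSpace ℝ (Fin d)))
    a).setIntegral_preimage_emb (MeasurableEquiv.subRight a).measurableEmbedding
    (fun y => f (y + a)) {y | b < ‖y‖}
  simp only [sub_add_cancel] at h
  exact h

theorem Packet.wave_add_center (q : Packet d) (ħ : ℝ) (P : MvPolynomial (Fin d) ℂ)
    (y : EuclideanSpace ℝ (Fin d)) : q.wave ħ P (y + q.a) =
      MvPolynomial.eval (fun i => ((y i : ℝ) : ℂ)) P * q.gaussian ħ (y + q.a) := by
  simp [Packet.wave, evalAt]

theorem Packet.gaussian_ne_zero {q : Packet d} {ħ : ℝ} (hħ : 0 < ħ) (hs : q.sqrtDet ≠ 0)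
    (x : EuclideanSpace ℝ (Fin d)) : q.gaussian ħ x ≠ 0 := by
  have h3 : Real.pi ^ (-(d : ℝ) / 4) * ħ ^ (-(d : ℝ) / 4) ≠ 0 :=
    (mul_pos (Real.rpow_pos_of_pos Real.pi_pos _) (Real.rpow_pos_of_pos hħ _)).ne'
  unfold Packet.gaussian
  exact mul_ne_zero (mul_ne_zero (Complex.ofReal_ne_zero.2 h3) (inv_ne_zero hs))
    (Complex.exp_ne_zero _)

theorem continuous_wave_family (hB : ∀ i k, Continuous fun x => (p x).B i k)
    (hAinv : ∀ i k, Continuous fun x => (p x).A⁻¹ i k) (hη : Continuous fun x => (p x).η)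
    (hs : Continuous fun x => (p x).sqrtDet) (hs0 : ∀ x, (p x).sqrtDet ≠ 0) (hh : Continuous h)
    (hpos : ∀ x, 0 < h x) {P : X → MvPolynomial (Fin d) ℂ} (hP : ContFamily P) :
    Continuous fun z : X × EuclideanSpace ℝ (Fin d) =>
      (p z.1).wave (h z.1) (P z.1) (z.2 + (p z.1).a) := by
  simp only [Packet.wave_add_center]
  refine Continuous.mul (hP.continuous_eval continuous_fst (continuous_pi fun i => ?_))
    (continuous_gaussian_family hB hAinv hη hs hs0 hh hpos)
  exact Complex.continuous_ofReal.comp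
    ((EuclideanSpace.proj (𝕜 := ℝ) i).continuous.comp continuous_snd)

/-- A wave packet is determined by its values near its center. -/
theorem Packet.eq_zero_of_setIntegral_eq_zero {q : Packet d} {ħ : ℝ} (hħ : 0 < ħ)
    (hs : q.sqrtDet ≠ 0) {P : MvPolynomial (Fin d) ℂ}
    (hcont : Continuous fun y => q.wave ħ P (y + q.a))
    (hint : Integrable fun y => ‖q.wave ħ P (y + q.a)‖ ^ 2) {b : ℝ} (hb : 0 < b)
    (h0 : ∫ y in Metric.closedBall 0 b, ‖q.wave ħ P (y + q.a)‖ ^ 2 = 0) : P = 0 := by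
  have hae := (setIntegral_eq_zero_iff_of_nonneg_ae (Filter.Eventually.of_forall fun y => by
    positivity) hint.integrableOn).1 h0
  have hae' := ae_restrict_of_ae_restrict_of_subset
    (Metric.ball_subset_closedBall (x := (0 : EuclideanSpace ℝ (Fin d))) (ε := b)) hae
  have heq := Measure.eqOn_open_of_ae_eq hae' Metric.isOpen_ball (hcont.norm.pow 2).continuousOn
    continuous_const.continuousOn
  refine eq_zero_of_eval_eq_zero_on_ball hb fun y hy => ?_
  have h1 : ‖q.wave ħ P (y + q.a)‖ ^ 2 = 0 := heq hy
  rw [sq_eq_zero_iff, norm_eq_zero, Packet.wave_add_center] at h1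
  exact (mul_eq_zero.1 h1).resolve_right (Packet.gaussian_ne_zero hħ hs _)

theorem Packet.inside_mass_pos {q : Packet d} {ħ : ℝ} (hħ : 0 < ħ) (hs : q.sqrtDet ≠ 0)
    {P : MvPolynomial (Fin d) ℂ} (hcont : Continuous fun y => q.wave ħ P (y + q.a))
    (hint : Integrable fun y => ‖q.wave ħ P (y + q.a)‖ ^ 2)
    (htot : ∫ y, ‖q.wave ħ P (y + q.a)‖ ^ 2 = 1) {b : ℝ} (hb : 0 < b) :
    0 < ∫ y in Metric.closedBall 0 b, ‖q.wave ħ P (y + q.a)‖ ^ 2 := by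
  refine lt_of_le_of_ne (integral_nonneg fun y => by positivity) fun h0 => ?_
  have hP := Packet.eq_zero_of_setIntegral_eq_zero hħ hs hcont hint hb h0.symm
  subst hP
  simp [Packet.wave_add_center] at htot

theorem exists_pos_le_of_compactSpace [CompactSpace X] {f : X → ℝ} (hf : Continuous f)
    (hpos : ∀ x, 0 < f x) : ∃ κ > 0, ∀ x, κ ≤ f x := by
  rcases isEmpty_or_nonempty X with hX | hX
  · exact ⟨1, one_pos, fun x => (hX.false x).elim⟩
  · obtain ⟨x₀, -, hx₀⟩ := isCompact_univ.exists_isMinOn Set.univ_nonempty hf.continuousOn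
    exact ⟨f x₀, hpos x₀, fun x => isMinOn_iff.1 hx₀ x (Set.mem_univ x)⟩

theorem setIntegral_outside_eq_one_sub {f : EuclideanSpace ℝ (Fin d) → ℝ} (hf : Integrable f)
    (htot : ∫ y, f y = 1) (b : ℝ) :
    ∫ y in {y | b < ‖y‖}, f y = 1 - ∫ y in Metric.closedBall 0 b, f y := by
  have h1 := integral_add_compl (measurableSet_closedBall (x := (0 : EuclideanSpace ℝ (Fin d)))
    (ε := b)) hf
  have h2 : (Metric.closedBall (0 : EuclideanSpace ℝ (Fin d)) b)ᶜ = {y | b < ‖y‖} := by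
    ext y; simp
  rw [h2, htot] at h1
  linarith

/-- The mass inside the closed ball is a continuous positive function on a compact space, hence
bounded below. -/
theorem exists_setIntegral_outside_le [CompactSpace X] [LocallyCompactSpace X] [FirstCountableTopology X]
    {F : X → EuclideanSpace ℝ (Fin d) → ℝ} (hF : Continuous (Function.uncurry F))
    (hint : ∀ x, Integrable (F x)) (htot : ∀ x, ∫ y, F x y = 1) {b : ℝ}
    (hpos : ∀ x, 0 < ∫ y in Metric.closedBall 0 b, F x y) :
    ∃ κ > 0, ∀ x, ∫ y in {y | b < ‖y‖}, F x y ≤ 1 - κ := by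
  obtain ⟨κ, hκ, hκle⟩ := exists_pos_le_of_compactSpace
    (continuous_parametric_integral_of_continuous (μ := volume) hF (isCompact_closedBall 0 b)) hpos
  refine ⟨κ, hκ, fun x => ?_⟩
  rw [setIntegral_outside_eq_one_sub (hint x) (htot x)]
  exact sub_le_sub_left (hκle x) 1

theorem exists_inside_mass_of_contFamily [CompactSpace X] [LocallyCompactSpace X] [FirstCountableTopology X]
    (hB : ∀ i k, Continuous fun x => (p x).B i k)
    (hAinv : ∀ i k, Continuous fun x => (p x).A⁻¹ i k) (hη : Continuous fun x => (p x).η)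
    (hs : Continuous fun x => (p x).sqrtDet) (hs0 : ∀ x, (p x).sqrtDet ≠ 0) (hh : Continuous h)
    (hpos : ∀ x, 0 < h x) {P : X → MvPolynomial (Fin d) ℂ} (hP : ContFamily P)
    (hint : ∀ x, Integrable fun y => ‖(p x).wave (h x) (P x) y‖ ^ 2)
    (htot : ∀ x, ∫ y, ‖(p x).wave (h x) (P x) y‖ ^ 2 = 1) {b : ℝ} (hb : 0 < b) :
    ∃ κ > 0, ∀ x, ∫ y in {y | b < ‖y - (p x).a‖}, ‖(p x).wave (h x) (P x) y‖ ^ 2 ≤ 1 - κ := by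
  have hwave := continuous_wave_family hB hAinv hη hs hs0 hh hpos hP
  have hint' : ∀ x, Integrable fun y => ‖(p x).wave (h x) (P x) (y + (p x).a)‖ ^ 2 :=
    fun x => (hint x).comp_add_right (p x).a
  have htot' : ∀ x, ∫ y, ‖(p x).wave (h x) (P x) (y + (p x).a)‖ ^ 2 = 1 := fun x =>
    (integral_add_right_eq_self (fun y => ‖(p x).wave (h x) (P x) y‖ ^ 2) (p x).a).trans (htot x)
  have hF : Continuous (Function.uncurry fun x y =>
      ‖(p x).wave (h x) (P x) (y + (p x).a)‖ ^ 2) := by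
    simp only [Function.uncurry_def]
    exact hwave.norm.pow 2
  have hslice : ∀ x, Continuous fun y => (p x).wave (h x) (P x) (y + (p x).a) := by
    intro x
    have h1 : Continuous fun y : EuclideanSpace ℝ (Fin d) => (x, y) := by fun_prop
    simpa only [Function.comp_def] using hwave.comp h1
  have hin : ∀ x, 0 < ∫ y in Metric.closedBall 0 b,
      ‖(p x).wave (h x) (P x) (y + (p x).a)‖ ^ 2 := fun x =>
    Packet.inside_mass_pos (hpos x) (hs0 x) (hslice x) (hint' x) (htot' x) hb
  obtain ⟨κ, hκ, hle⟩ := exists_setIntegral_outside_le hF hint' htot' hin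
  refine ⟨κ, hκ, fun x => ?_⟩
  rw [setIntegral_outside_eq]
  exact hle x

/-- Along a compact family of parameters, a normalized combination of finitely many of the states
has a fixed amount of mass in the ball of radius `b`. -/
theorem exists_inside_mass [CompactSpace X] [LocallyCompactSpace X] [FirstCountableTopology X]
    (hA : ∀ i k, Continuous fun x => (p x).A i k) (hB : ∀ i k, Continuous fun x => (p x).B i k)
    (hη : Continuous fun x => (p x).η) (hs : Continuous fun x => (p x).sqrtDet)
    (hadm : ∀ x, Admissible (p x).A (p x).B) (hdet : ∀ x, (p x).sqrtDet ^ 2 = (p x).A.det)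
    (hh : Continuous h) (hpos : ∀ x, 0 < h x) (s : Finset (MultiIndex d)) {c : MultiIndex d → ℂ}
    (hc : ∑ j ∈ s, ‖c j‖ ^ 2 = 1) {b : ℝ} (hb : 0 < b) :
    ∃ κ > 0, ∀ x, ∫ y in {y | b < ‖y - (p x).a‖},
      ‖(p x).wave (h x) (∑ j ∈ s, c j • (p x).statePoly (h x) j) y‖ ^ 2 ≤ 1 - κ := by
  have hdet0 : ∀ x, (p x).A.det ≠ 0 := fun x => (hadm x).isUnit_left.ne_zero
  have hs0 : ∀ x, (p x).sqrtDet ≠ 0 := fun x h0 => hdet0 x (by rw [← hdet, h0]; simp)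
  have hAinv := continuous_inv_entry hA hdet0
  have hPc : ContFamily fun x => ∑ j ∈ s, c j • (p x).statePoly (h x) j :=
    ContFamily.sum _ fun j _ => (contFamily_statePoly hA hAinv hh hpos j).smul continuous_const
  exact exists_inside_mass_of_contFamily hB hAinv hη hs hs0 hh hpos hPc
    (fun x => Packet.integrable_norm_wave_sq (hadm x) (hpos x) (hdet x) _)
    (fun x => (Packet.integral_norm_wave_sq (hadm x) (hpos x) (hdet x) s c).trans hc) hb

end InsideMass

/-! ### Combination of the two ranges of ħ. -/

section Localization

variable {d : ℕ} {V : EuclideanSpace ℝ (Fin d) → ℝ} {γ : Path d}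

/-- For l = 1 the degree cut-off J + 3l - 3 is exactly J, and only the time-independent zeroth order
survives, so the total mass is 1. -/
theorem approxPoly_one (ħ : ℝ) (J : ℕ) (c₀ : MultiIndex d → ℂ) (t : ℝ) :
    approxPoly V γ ħ J c₀ 1 t = ∑ j ∈ indicesLE d J, c₀ j • (γ.packet t).statePoly ħ j := by
  simp [approxPoly, truncatedCoeff, hierarchy_zero]

theorem integrable_norm_approximation_sq (hγ : γ.IsClassical V) (hV : ContDiff ℝ 2 V) {ħ : ℝ}
    (hħ : 0 < ħ) {t : ℝ} (ht : 0 ≤ t) (J : ℕ) (c₀ : MultiIndex d → ℂ) (σ' : ℝ) :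
    Integrable fun x => ‖approximation V γ ħ J c₀ σ' t x‖ ^ 2 := by
  simp only [norm_approximation_eq hγ hV hħ ht]
  exact Packet.integrable_norm_wave_sq (hγ.admissible_at hV ht) hħ (hγ.sqrtDet_sq t ht) _

/-- The bound on σ' log U keeps (1/ħ)^σ' between 1 and √e, and √e < 2. -/
theorem floor_rpow_neg_eq_one {ħ σ' U : ℝ} (hħ : 0 < ħ) (hħ1 : ħ ≤ 1) (hU : 1 / ħ ≤ U)
    (hσ : 0 < σ') (hσU : σ' * Real.log U ≤ 1 / 2) : ⌊ħ ^ (-σ')⌋₊ = 1 := by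
  have hw : 1 ≤ 1 / ħ := one_le_one_div hħ hħ1
  have hpw : ħ ^ (-σ') = (1 / ħ) ^ σ' := by
    rw [one_div, Real.inv_rpow hħ.le, Real.rpow_neg hħ.le]
  rw [Nat.floor_eq_iff (by positivity), hpw]
  refine ⟨by simpa using Real.one_le_rpow hw hσ.le, ?_⟩
  have h1 : (1 / ħ) ^ σ' ≤ Real.exp (1 / 2) := by
    rw [Real.rpow_def_of_pos (by positivity), Real.exp_le_exp, mul_comm]
    exact (mul_le_mul_of_nonneg_left (Real.log_le_log (by positivity) hU) hσ.le).trans hσU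
  have h2 : Real.exp (1 / 2) ^ 2 < 2 ^ 2 := by
    rw [← Real.exp_nat_mul]
    norm_num
    linarith [Real.exp_one_lt_d9]
  have h3 := lt_of_pow_lt_pow_left₀ 2 zero_le_two h2
  exact (h1.trans_lt h3).trans_eq (by norm_num)

/-- For `ħ` bounded away from zero, a fixed part of the mass of the zeroth order approximation
stays in the ball of radius `b` about the center. -/
theorem exists_large_hbar_bound (hγ : γ.IsClassical V) (hV : ContDiff ℝ 2 V) {J : ℕ}
    {c₀ : MultiIndex d → ℂ} (hnorm : ∑ j ∈ indicesLE d J, ‖c₀ j‖ ^ 2 = 1) {b : ℝ} (hb : 0 < b)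
    (T : ℝ) {h₀ : ℝ} (hh₀ : 0 < h₀) :
    ∃ κ > 0, ∀ t ∈ Set.Icc 0 T, ∀ ħ ∈ Set.Icc h₀ 1, ∀ σ', ⌊ħ ^ (-σ')⌋₊ = 1 →
      ∫ x in {x | b < ‖x - γ.a t‖}, ‖approximation V γ ħ J c₀ σ' t x‖ ^ 2 ≤ 1 - κ := by
  have hcompact : IsCompact (Set.Icc 0 T ×ˢ Set.Icc h₀ 1) := isCompact_Icc.prod isCompact_Icc
  have : CompactSpace ↥(Set.Icc 0 T ×ˢ Set.Icc h₀ 1) := isCompact_iff_compactSpace.1 hcompact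
  have htime : Continuous fun x : ↥(Set.Icc 0 T ×ˢ Set.Icc h₀ 1) => x.1.1 := by fun_prop
  have ht0 : ∀ x : ↥(Set.Icc 0 T ×ˢ Set.Icc h₀ 1), x.1.1 ∈ Set.Ici 0 := fun x => x.2.1.1
  obtain ⟨κ, hκ, hle⟩ := exists_inside_mass (X := ↥(Set.Icc 0 T ×ˢ Set.Icc h₀ 1))
    (p := fun x => γ.packet x.1.1) (h := fun x => x.1.2)
    (fun i k => (hγ.continuousOn_A i k).comp_continuous htime ht0)
    (fun i k => (hγ.continuousOn_B i k).comp_continuous htime ht0)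
    (hγ.continuousOn_η.comp_continuous htime ht0)
    (hγ.sqrtDet_continuous.comp_continuous htime ht0)
    (fun x => hγ.admissible_at hV (ht0 x)) (fun x => hγ.sqrtDet_sq _ (ht0 x)) (by fun_prop)
    (fun x => hh₀.trans_le x.2.2.1) (indicesLE d J) hnorm hb
  refine ⟨κ, hκ, fun t ht ħ hħ σ' hl => ?_⟩
  simp only [norm_approximation_eq hγ hV (hh₀.trans_le hħ.1) ht.1, hl, approxPoly_one]
  exact hle ⟨(t, ħ), ht, hħ⟩

theorem rpow_half_le_exp_of_le_exp {m Γ y : ℝ} (hm : 0 ≤ m) (h : m ≤ Real.exp (2 * (-Γ / y))) :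
    m ^ (1 / 2 : ℝ) ≤ Real.exp (-Γ / y) := by
  refine (Real.rpow_le_rpow hm h (by norm_num)).trans_eq ?_
  rw [← Real.exp_mul]
  ring_nf

theorem localizedUpTo {W : EuclideanSpace ℂ (Fin d) → ℂ} {δ M τ N lam : ℝ}
    (hVbdd : BddBelow (Set.range V)) (hδ : 0 < δ) (hW : AnalyticOnNhd ℂ W (strip d δ))
    (hWV : ∀ x, W (toComplex x) = (V x : ℂ)) (hM : 0 ≤ M) (hτ : 0 ≤ τ) (hb : ExpBound W δ M τ)
    (hγ : γ.IsClassical V) (hN : 0 < N) (hlam : 0 < lam)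
    (hA : ∀ t, 0 ≤ t → ‖Matrix.toEuclideanCLM (n := Fin d) (𝕜 := ℂ) (γ.A t)‖
      ≤ N * Real.exp (lam * t)) {J : ℕ} {c₀ : MultiIndex d → ℂ}
    (hc₀ : ∀ j, J < order j → c₀ j = 0) (hnorm : ∑ j ∈ indicesLE d J, ‖c₀ j‖ ^ 2 = 1) {b : ℝ}
    (hb0 : 0 < b) {T' : ℝ} (hT' : 0 < T') (hT'lam : T' * lam < 1 / 6) :
    LocalizedUpTo V γ J c₀ b T' := by
  have hV := contDiff_potential hδ.le hW hWV
  have hC₀ : ∀ j, ‖c₀ j‖ ≤ 1 := by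
    intro j
    by_cases hj : J < order j
    · simp [hc₀ j hj]
    · have h1 := Finset.single_le_sum (f := fun j => ‖c₀ j‖ ^ 2) (fun i _ => by positivity)
        (mem_indicesLE.2 (not_lt.1 hj))
      rw [hnorm] at h1
      exact (sq_le_one_iff₀ (norm_nonneg _)).1 h1
  obtain ⟨U₀, hU₀⟩ := exists_small_hbar_bound hVbdd hδ hW hWV hM hτ hb hγ hN hlam hA hC₀ hc₀ hb0
    hT' hT'lam
  obtain ⟨U, hU, hU2⟩ : ∃ U, U₀ ≤ U ∧ 2 ≤ U := ⟨max U₀ 2, le_max_left _ _, le_max_right _ _⟩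
  have hU0 : 0 < U := by linarith
  have hlogU : 0 < Real.log U := Real.log_pos (by linarith)
  obtain ⟨κ₀, hκ₀, hlarge⟩ := exists_large_hbar_bound hγ hV hnorm hb0 (T' * Real.log U)
    (h₀ := 1 / U) (by positivity)
  -- Shrinking κ below 1 makes 1 - κ the exponential of its logarithm, as the choice of Γ' requires.
  obtain ⟨κ, hκ, hκ₀', hκ1⟩ : ∃ κ, 0 < κ ∧ κ ≤ κ₀ ∧ κ < 1 :=
    ⟨min κ₀ (1 / 2), lt_min hκ₀ (by norm_num), min_le_left _ _,
      (min_le_right _ _).trans_lt (by norm_num)⟩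
  have hlogκ : Real.log (1 - κ) < 0 := Real.log_neg (by linarith) (by linarith)
  have hUr : 0 < (1 / U) ^ (1 / 2 : ℝ) := by positivity
  -- The bound 1/4 on σ' serves 1/ħ ≥ U, and 1/(2 log U) forces l = 1 when 1/ħ ≤ U. In Γ', 1/48 is
  -- half of 1/24 because of the square root, and the second term ensures 1 - κ ≤ exp(-2Γ'/ħ^(1/2))
  -- for ħ ≥ 1/U.
  refine ⟨min (1 / 4) (1 / (2 * Real.log U)), ⟨by positivity, (min_le_left _ _).trans_lt
    (by norm_num)⟩, fun σ' hσ' => ⟨min (1 / 48) (-(1 / 2) * Real.log (1 - κ) * (1 / U) ^ (1 / 2 : ℝ)),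
      lt_min (by norm_num) (mul_pos (by linarith) hUr), 1 / 2, ⟨by norm_num, by norm_num⟩,
      fun ħ hħ t ht htT => ⟨integrable_norm_approximation_sq hγ hV hħ ht J c₀ σ', ?_⟩⟩⟩
  set Γ := min (1 / 48) (-(1 / 2) * Real.log (1 - κ) * (1 / U) ^ (1 / 2 : ℝ)) with hΓ
  -- For ħ > 1 the upper limit T' ln(1/ħ) is negative, so no time is admissible.
  have hħ1 : ħ ≤ 1 := by
    by_contra! h
    have := Real.log_neg (x := 1 / ħ) (by positivity) (by rw [div_lt_one hħ]; exact h)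
    nlinarith
  have hħr : 0 < ħ ^ (1 / 2 : ℝ) := by positivity
  refine rpow_half_le_exp_of_le_exp (integral_nonneg fun x => by positivity) ?_
  rcases le_total U (1 / ħ) with hUħ | hUħ
  · refine (hU₀ ħ hħ hħ1 (hU.trans hUħ) σ' ⟨hσ'.1, hσ'.2.trans (min_le_left _ _)⟩ t ht htT).trans ?_
    rw [Real.exp_le_exp, one_div ħ, Real.inv_rpow hħ.le]
    have h1 : Γ ≤ 1 / 48 := min_le_left _ _
    have h2 := mul_le_mul_of_nonneg_right h1 (inv_pos.2 hħr).le
    rw [div_eq_mul_inv (-Γ)]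
    linarith
  · have hUħ' : 1 / U ≤ ħ := by
      rwa [one_div_le hU0 hħ]
    have hl : ⌊ħ ^ (-σ')⌋₊ = 1 := by
      refine floor_rpow_neg_eq_one hħ hħ1 hUħ hσ'.1 ?_
      have h1 := mul_le_mul_of_nonneg_right (hσ'.2.trans (min_le_right _ _)) hlogU.le
      refine h1.trans_eq ?_
      field_simp
    have htU : t ≤ T' * Real.log U := htT.trans
      (mul_le_mul_of_nonneg_left (Real.log_le_log (by positivity) hUħ) hT'.le)
    refine (hlarge t ⟨ht, htU⟩ ħ ⟨hUħ', hħ1⟩ σ' hl).trans ?_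
    have h1 : (1 / U) ^ (1 / 2 : ℝ) ≤ ħ ^ (1 / 2 : ℝ) :=
      Real.rpow_le_rpow (by positivity) hUħ' (by norm_num)
    have h2 : Γ ≤ -(1 / 2) * Real.log (1 - κ) * ħ ^ (1 / 2 : ℝ) := (min_le_right _ _).trans
      (mul_le_mul_of_nonneg_left h1 (by linarith))
    have h3 : Γ / ħ ^ (1 / 2 : ℝ) ≤ -(1 / 2) * Real.log (1 - κ) := (div_le_iff₀ hħr).2 h2
    have h4 : 1 - κ = Real.exp (Real.log (1 - κ)) := (Real.exp_log (by linarith)).symm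
    refine (sub_le_sub_left hκ₀' 1).trans ?_
    rw [h4, Real.exp_le_exp, neg_div]
    linarith

end Localization

end Semiclassical

end

theorem theorem3p4 {d : ℕ}
    -- the potential, its analytic continuation `W` and the exponential bound
    (V : EuclideanSpace ℝ (Fin d) → ℝ) (hVbdd : BddBelow (Set.range V))
    (δ : ℝ) (hδ : 0 < δ) (W : EuclideanSpace ℂ (Fin d) → ℂ)
    (hW : AnalyticOnNhd ℂ W (Semiclassical.strip d δ))
    (hWV : ∀ x, W (Semiclassical.toComplex x) = (V x : ℂ))
    (hbound : ∃ M > 0, ∃ τ > 0, Semiclassical.ExpBound W δ M τ)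
    -- the classical motion and its Lyapunov exponent
    (γ : Semiclassical.Path d) (hγ : γ.IsClassical V)
    (N lam : ℝ) (hN : 0 < N) (hlam : 0 < lam)
    (hA : ∀ t, 0 ≤ t → ‖Matrix.toEuclideanCLM (n := Fin d) (𝕜 := ℂ) (γ.A t)‖
      ≤ N * Real.exp (lam * t))
    -- the normalized initial coherent state
    (J : ℕ) (c₀ : Semiclassical.MultiIndex d → ℂ)
    (hc₀ : ∀ j, J < Semiclassical.order j → c₀ j = 0)
    (hnorm : ∑ j ∈ Semiclassical.indicesLE d J, ‖c₀ j‖ ^ 2 = 1)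
    (b : ℝ) (hb : 0 < b) :
    (∃ T₀ > 0, ∀ T' ∈ Set.Ioo 0 T₀, Semiclassical.LocalizedUpTo V γ J c₀ b T') ∧
    ((∀ τ > 0, ∃ M > 0, Semiclassical.ExpBound W δ M τ) →
      ∀ ε ∈ Set.Ioo (0 : ℝ) 1,
        Semiclassical.LocalizedUpTo V γ J c₀ b (1 / (6 * lam) * (1 - ε))) := by
  -- Both claims are instances: T₀ = 1/(6λ) for the first, and T'λ = (1 - ε)/6 for the second.
  have key : ∀ T', 0 < T' → T' * lam < 1 / 6 → Semiclassical.LocalizedUpTo V γ J c₀ b T' := by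
    obtain ⟨M, hM, τ, hτ, hb'⟩ := hbound
    exact fun T' hT' hT'lam => Semiclassical.localizedUpTo hVbdd hδ hW hWV hM.le hτ.le hb' hγ hN
      hlam hA hc₀ hnorm hb hT' hT'lam
  have hlam6 : 1 / (6 * lam) * lam = 1 / 6 := by field_simp
  refine ⟨⟨1 / (6 * lam), by positivity, fun T' hT' => key T' hT'.1 ?_⟩, fun _ ε hε => key _ ?_ ?_⟩
  · rw [← hlam6]
    exact mul_lt_mul_of_pos_right hT'.2 hlam
  · exact mul_pos (by positivity) (by linarith [hε.2])
  · rw [mul_right_comm, hlam6]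
    linarith [hε.1]
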